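/- Let $\mathbb{K}=\mathbb{R}$ or $\mathbb{C}$ and let $\mathfrak{g}$ be a nilpotent locally convex Lie algebra over $\mathbb{K}$, i.e. a locally convex topological vector space with a (jointly) continuous Lie bracket for which $\mathfrak{g}$ is a nilpotent Lie algebra. Let $\mathrm{Sym}^n(\mathfrak{g})\subseteq \mathfrak{g}^{\otimes n}$ be the image of the symmetrizer $v_1\otimes\cdots\otimes v_n\mapsto \frac1{n!}\sum_{\sigma\in S_n}v_{\sigma(1)}\otimes\cdots\otimes v_{\sigma(n)}$, let $\xi_1\cdots\xi_n\in \mathrm{Sym}^n(\mathfrak g)$ be the symmetrization of $\xi_1\otimes\cdots\otimes\xi_n$, and let $\mathrm{Sym}^\bullet(\mathfrak{g})=\bigoplus_{n\ge0}\mathrm{Sym}^n(\mathfrak{g})$. For a continuous seminorm $p$ on $\mathfrak{g}$ let $p^n$ be its projective tensor power on $\mathfrak{g}^{\otimes n}$ ($p^0$ is the absolute value of $\mathbb{K}$), and for $R\in\mathbb{R}$ put $p_R(\sum_n x_n)=\sum_n n!^R\,p^n(x_n)$. The $\mathrm{Sym}_R$-topology on $\mathrm{Sym}^\bullet(\mathfrak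 g)$ is defined by all the seminorms $p_R$, and $\mathrm{Sym}_{1^-}^\bullet(\mathfrak{g})$ is $\mathrm{Sym}^\bullet(\mathfrak g)$ with the projective limit of the $\mathrm{Sym}_{1-\epsilon}$-topologies, $\epsilon>0$. Let $\widehat{\mathrm{Sym}}{}_{1^-}^\bullet(\mathfrak{g})$ be its completion. Let $\mathfrak{q}\colon\mathrm{Sym}^\bullet(\mathfrak{g})\to U(\mathfrak{g})$ be the Poincaré–Birkhoff–Witt isomorphism $\mathfrak q(\xi_1\cdots\xi_n)=\frac{1}{n!}\sum_{\sigma\in S_n}\xi_{\sigma(1)}\odot\cdots\odot\xi_{\sigma(n)}$, where $\odot$ is the product of the universal enveloping algebra. For $z\in\mathbb{K}$ the Gutt star product $\star_z$ is the bilinear product on $\mathrm{Sym}^\bullet(\mathfrak{g})$ with $$x\star_z y=\sum_{n=0}^{k+\ell} z^n\,\pi_{k+\ell-n}\bigl(\mathfrak{q}^{-1}(\mathfrak{q}(x)\odot\mathfrak{q}(y))\bigr)\qquad (x\in\mathrm{Sym}^k(\mathfrak{g}),\ y\in\mathrm{Sym}^\ell(\mathfrak{g})),$$ where $\pi_r$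 is the projection onto the homogeneous component of degree $r$ and $0^0=1$. Let $\mathrm{BCH}(\xi,\eta)=\sum_{n\ge1}\mathrm{BCH}_n(\xi,\eta)$ be the Baker–Campbell–Hausdorff series, a finite sum since $\mathfrak{g}$ is nilpotent, and let $\exp(\xi)=\sum_{n=0}^\infty\frac{\xi^n}{n!}$. Then for every $z\in\mathbb{K}$ the product $\star_z$ on $\mathrm{Sym}_{1^-}^\bullet(\mathfrak{g})$ extends to a continuous product, again denoted $\star_z$, on $\widehat{\mathrm{Sym}}{}_{1^-}^\bullet(\mathfrak{g})$, and the following hold. 1. For every $\xi\in\mathfrak{g}$ we have $\exp(\xi)\in\widehat{\mathrm{Sym}}{}_{1^-}^\bullet(\mathfrak{g})$. That is, $\sum_{n} n!^{1-\epsilon}\,p^n\bigl(\tfrac{\xi^n}{n!}\bigr)<\infty$ for all continuous seminorms $p$ on $\mathfrak g$ and all $\epsilon>0$, and the series $\sum_n\frac{\xi^n}{n!}$ converges (unconditionally) in $\widehat{\mathrm{Sym}}{}_{1^-}^\bullet(\mathfrak{g})$, with sum $\exp(\xi)$. 2. For all $\xi,\eta\in\mathfrak{g}$ and $z\in\mathbb{K}$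 with $z\neq0$, $$\exp(\xi)\star_z\exp(\eta)=\exp\Bigl(\tfrac1z\,\mathrm{BCH}(z\xi,z\eta)\Bigr).$$ 3. For all $z,s,t\in\mathbb{K}$ and $\xi\in\mathfrak{g}$, $$\exp(t\xi)\star_z\exp(s\xi)=\exp\bigl((t+s)\xi\bigr).$$ -/

import Mathlib

open scoped TensorProduct DirectSum Nat

noncomputable section

namespace GuttStar

section Tensor

variable (𝕜 : Type*) [RCLike 𝕜] (V : Type*) [AddCommGroup V] [Module 𝕜 V]

/-- The symmetrizer `v₁ ⊗ ⋯ ⊗ vₙ ↦ (1 / n!) ∑ σ, v_{σ 1} ⊗ ⋯ ⊗ v_{σ n}` on the `n`-th tensor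
power. -/
def symmetrizer (n : ℕ) : (⨂[𝕜]^n V) →ₗ[𝕜] (⨂[𝕜]^n V) :=
  ((n ! : 𝕜)⁻¹) • ∑ σ : Equiv.Perm (Fin n),
    (PiTensorProduct.reindex 𝕜 (fun _ : Fin n => V) σ).toLinearMap

theorem symmetrizer_tprod (n : ℕ) (v : Fin n → V) :
    symmetrizer 𝕜 V n (PiTensorProduct.tprod 𝕜 v) =
      ((n ! : 𝕜)⁻¹) • ∑ σ : Equiv.Perm (Fin n), PiTensorProduct.tprod 𝕜 (fun i => v (σ i)) := by
  simp only [symmetrizer, LinearMap.smul_apply, LinearMap.sum_apply, LinearEquiv.coe_coe]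
  congr 1
  refine Fintype.sum_equiv (Equiv.inv _) _ _ fun σ => ?_
  exact PiTensorProduct.reindex_tprod σ v

/-- The symmetric tensor power `Symⁿ(V)`, the image of the symmetrizer in `V^{⊗ n}`. -/
def SymPower (n : ℕ) : Submodule 𝕜 (⨂[𝕜]^n V) := LinearMap.range (symmetrizer 𝕜 V n)

/-- The symmetric algebra `Sym(V) = ⨁ₙ Symⁿ(V)`, as a graded vector space. -/
abbrev SymAlg : Type _ := ⨁ n : ℕ, SymPower 𝕜 V n

variable {V}

/-- The symmetric product `v₁ ⋯ vₙ` of vectors: the symmetrization of `v₁ ⊗ ⋯ ⊗ vₙ`. -/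
def symProd {n : ℕ} (v : Fin n → V) : SymPower 𝕜 V n :=
  ⟨symmetrizer 𝕜 V n (PiTensorProduct.tprod 𝕜 v), LinearMap.mem_range_self _ _⟩

/-- The power `ξⁿ` in the symmetric algebra. -/
def symPow (ξ : V) (n : ℕ) : SymPower 𝕜 V n := symProd 𝕜 (fun _ : Fin n => ξ)

/-- `ξⁿ` is the tensor `ξ ⊗ ⋯ ⊗ ξ`. -/
theorem coe_symPow (ξ : V) (n : ℕ) :
    (symPow 𝕜 ξ n : ⨂[𝕜]^n V) = PiTensorProduct.tprod 𝕜 (fun _ : Fin n => ξ) := by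
  have h : (n ! : 𝕜) ≠ 0 := Nat.cast_ne_zero.mpr (Nat.factorial_ne_zero n)
  simp only [symPow, symProd, symmetrizer_tprod, Finset.sum_const, Finset.card_univ,
    Fintype.card_perm, Fintype.card_fin]
  rw [← Nat.cast_smul_eq_nsmul 𝕜, smul_smul, inv_mul_cancel₀ h, one_smul]

/-- The exponential series `exp ξ = ∑ ξⁿ / n!` as a formal series in `∏ₙ Symⁿ(V)`. -/
def formalExp (ξ : V) (n : ℕ) : SymPower 𝕜 V n := ((n ! : 𝕜)⁻¹) • symPow 𝕜 ξ n

variable {𝕜}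

/-- The cost `∑ⱼ |cⱼ| p(vⱼ₁) ⋯ p(vⱼₙ)` of the representation `∑ⱼ cⱼ vⱼ₁ ⊗ ⋯ ⊗ vⱼₙ`. -/
def repCost (p : Seminorm 𝕜 V) (n : ℕ) (r : FreeAddMonoid (𝕜 × (Fin n → V))) : ℝ :=
  (r.toList.map fun a => ‖a.1‖ * ∏ i, p (a.2 i)).sum

theorem repCost_nonneg (p : Seminorm 𝕜 V) (n : ℕ) (r : FreeAddMonoid (𝕜 × (Fin n → V))) :
    0 ≤ repCost p n r := by
  refine List.sum_nonneg fun a ha => ?_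
  obtain ⟨b, -, rfl⟩ := List.mem_map.mp ha
  exact mul_nonneg (norm_nonneg _) (Finset.prod_nonneg fun i _ => apply_nonneg p _)

theorem bddBelow_repCost (p : Seminorm 𝕜 V) (n : ℕ) (x : ⨂[𝕜]^n V) :
    BddBelow (Set.range fun r : PiTensorProduct.lifts x => repCost p n r.1) :=
  ⟨0, by rintro _ ⟨r, rfl⟩; exact repCost_nonneg p n _⟩

/-- The projective tensor power `pⁿ = p ⊗ ⋯ ⊗ p` of a seminorm `p`: the infimum of
`∑ⱼ |cⱼ| p(vⱼ₁) ⋯ p(vⱼₙ)` over all representations `x = ∑ⱼ cⱼ vⱼ₁ ⊗ ⋯ ⊗ vⱼₙ`.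
For `n = 0` it is the absolute value of the scalar field. -/
def tensorSeminorm (p : Seminorm 𝕜 V) (n : ℕ) : Seminorm 𝕜 (⨂[𝕜]^n V) :=
  Seminorm.ofSMulLE
    (fun x => ⨅ r : PiTensorProduct.lifts x, repCost p n r.1)
    (le_antisymm
      (ciInf_le_of_le (bddBelow_repCost p n _) ⟨0, PiTensorProduct.lifts_zero⟩
        (by simp [repCost]))
      (Real.iInf_nonneg fun r => repCost_nonneg p n r.1))
    (fun x y => le_ciInf_add_ciInf fun r s =>
      ciInf_le_of_le (bddBelow_repCost p n _)
        ⟨r.1 + s.1, PiTensorProduct.lifts_add r.2 s.2⟩ (by simp [repCost]))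
    (fun c x => by
      rw [Real.mul_iInf_of_nonneg (norm_nonneg _)]
      refine le_ciInf fun r => ciInf_le_of_le (bddBelow_repCost p n _)
        ⟨_, PiTensorProduct.lifts_smul r.2 c⟩ (le_of_eq ?_)
      simp [repCost, Function.comp_def, mul_assoc, List.sum_map_mul_left])

theorem summable_symSeminorm (R : ℝ) (p : Seminorm 𝕜 V) (x : SymAlg 𝕜 V) :
    Summable fun n : ℕ => (n ! : ℝ) ^ R * tensorSeminorm p n (x n : ⨂[𝕜]^n V) := by
  classical
  refine summable_of_ne_finset_zero (s := DFinsupp.support x) fun n hn => ?_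
  have : x n = 0 := by simpa using hn
  simp [this]

/-- The seminorm `p_R = ∑ₙ (n!)^R pⁿ` on the symmetric algebra. -/
def symSeminorm (R : ℝ) (p : Seminorm 𝕜 V) : Seminorm 𝕜 (SymAlg 𝕜 V) :=
  Seminorm.of
    (fun x => ∑' n : ℕ, (n ! : ℝ) ^ R * tensorSeminorm p n (x n : ⨂[𝕜]^n V))
    (fun x y => by
      rw [← (summable_symSeminorm R p x).tsum_add (summable_symSeminorm R p y)]
      refine (summable_symSeminorm R p (x + y)).tsum_le_tsum (fun n => ?_)
        ((summable_symSeminorm R p x).add (summable_symSeminorm R p y))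
      rw [← mul_add]
      exact mul_le_mul_of_nonneg_left (map_add_le_add _ _ _) (by positivity))
    (fun c x => by
      rw [← tsum_mul_left]
      refine tsum_congr fun n => ?_
      have : ((c • x) n : ⨂[𝕜]^n V) = c • (x n : ⨂[𝕜]^n V) := rfl
      rw [this, map_smul_eq_mul]
      ring)

end Tensor

section Topology

variable (𝕜 : Type*) [RCLike 𝕜] (V : Type*) [AddCommGroup V] [Module 𝕜 V] [TopologicalSpace V]

/-- The uniform structure of the `Sym_R`-topology: the one defined by all the seminorms `p_R`
for `p` a continuous seminorm on `V`. -/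
@[reducible] def symUniformSpace (R : ℝ) : UniformSpace (SymAlg 𝕜 V) :=
  ⨅ p : {p : Seminorm 𝕜 V // Continuous p},
    (symSeminorm R p.1).toSeminormedAddCommGroup.toUniformSpace

/-- The symmetric algebra, to be equipped with the `Sym_{R⁻}`-topology. -/
def SymMinus (_R : ℝ) : Type _ := SymAlg 𝕜 V

instance (R : ℝ) : AddCommGroup (SymMinus 𝕜 V R) := inferInstanceAs (AddCommGroup (SymAlg 𝕜 V))

instance (R : ℝ) : Module 𝕜 (SymMinus 𝕜 V R) := inferInstanceAs (Module 𝕜 (SymAlg 𝕜 V))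

/-- The `Sym_{R⁻}`-topology: the projective limit of the `Sym_{R - ε}`-topologies for `ε > 0`,
i.e. the coarsest one that is finer than all of them. -/
instance (R : ℝ) : UniformSpace (SymMinus 𝕜 V R) :=
  ⨅ ε : {ε : ℝ // 0 < ε}, symUniformSpace 𝕜 V (R - ε.1)

instance (R : ℝ) : IsUniformAddGroup (SymMinus 𝕜 V R) :=
  isUniformAddGroup_iInf fun ε =>
    (isUniformAddGroup_iInf fun p : {p : Seminorm 𝕜 V // Continuous p} =>
      (symSeminorm (R - ε.1) p.1).toSeminormedAddCommGroup.to_isUniformAddGroup :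
      @IsUniformAddGroup (SymAlg 𝕜 V) (symUniformSpace 𝕜 V (R - ε.1)) _)

/-- The completion of `Sym_{R⁻}(V)`. -/
abbrev SymHat (R : ℝ) : Type _ := UniformSpace.Completion (SymMinus 𝕜 V R)

variable {V}

/-- The inclusion `Symⁿ(V) → Sym_{R⁻}(V)` of a homogeneous component. -/
def inclSymMinus (R : ℝ) (n : ℕ) : SymPower 𝕜 V n →ₗ[𝕜] SymMinus 𝕜 V R :=
  DirectSum.lof 𝕜 ℕ (fun n => SymPower 𝕜 V n) n

/-- The exponential series `∑ₙ ξⁿ / n!`, summed in the completion of `Sym_{R⁻}(V)`. -/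
def expHat (R : ℝ) (ξ : V) : SymHat 𝕜 V R :=
  ∑' n : ℕ, ((inclSymMinus 𝕜 R n (formalExp 𝕜 ξ n) : SymMinus 𝕜 V R) : SymHat 𝕜 V R)

end Topology

section Star

variable (𝕜 : Type*) [RCLike 𝕜] (g : Type*) [LieRing g] [LieAlgebra 𝕜 g]

/-- The canonical linear map `g → U(g)` into the universal enveloping algebra; it is the map
underlying Mathlib's `UniversalEnvelopingAlgebra.ι`. -/
def envIncl : g →ₗ[𝕜] UniversalEnvelopingAlgebra 𝕜 g :=
  (UniversalEnvelopingAlgebra.mkAlgHom 𝕜 g).toLinearMap.comp (TensorAlgebra.ι 𝕜)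

/-- The canonical map `x₁ ⊗ ⋯ ⊗ xₙ ↦ x₁ ⊙ ⋯ ⊙ xₙ` into the universal enveloping algebra. -/
def tensorToEnveloping (n : ℕ) : (⨂[𝕜]^n g) →ₗ[𝕜] UniversalEnvelopingAlgebra 𝕜 g :=
  PiTensorProduct.lift
    ((MultilinearMap.mkPiAlgebraFin 𝕜 n (UniversalEnvelopingAlgebra 𝕜 g)).compLinearMap
      fun _ => envIncl 𝕜 g)

/-- The component `𝔮ₙ : Symⁿ(g) → U(g)` of the quantization map, see `quantN_symProd`. -/
def quantN (n : ℕ) : SymPower 𝕜 g n →ₗ[𝕜] UniversalEnvelopingAlgebra 𝕜 g :=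
  (tensorToEnveloping 𝕜 g n).comp (SymPower 𝕜 g n).subtype

/-- `𝔮ₙ(ξ₁ ⋯ ξₙ) = (1 / n!) ∑ σ, ξ_{σ 1} ⊙ ⋯ ⊙ ξ_{σ n}`. -/
theorem quantN_symProd (n : ℕ) (ξ : Fin n → g) :
    quantN 𝕜 g n (symProd 𝕜 ξ) = ((n ! : 𝕜)⁻¹) • ∑ σ : Equiv.Perm (Fin n),
      (List.ofFn fun i => envIncl 𝕜 g (ξ (σ i))).prod := by
  simp [quantN, symProd, symmetrizer_tprod, tensorToEnveloping]

/-- The quantization (symmetrization) map `𝔮 = ∑ₙ 𝔮ₙ : Sym(g) → U(g)`. -/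
def quant : SymAlg 𝕜 g →ₗ[𝕜] UniversalEnvelopingAlgebra 𝕜 g :=
  DirectSum.toModule 𝕜 ℕ _ (quantN 𝕜 g)

open Classical in
/-- The inverse `𝔮⁻¹ : U(g) → Sym(g)` of the quantization map, which is bijective by the
Poincaré-Birkhoff-Witt theorem. -/
def quantInv : UniversalEnvelopingAlgebra 𝕜 g →ₗ[𝕜] SymAlg 𝕜 g :=
  if h : Function.Bijective (quant 𝕜 g) then (LinearEquiv.ofBijective (quant 𝕜 g) h).symm else 0

variable {𝕜}

/-- The Gutt star product on homogeneous elements `x ∈ Symᵏ(g)`, `y ∈ Symˡ(g)`: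
`x ⋆_z y = ∑ₙ zⁿ π_{k+l-n} (𝔮⁻¹ (𝔮 x ⊙ 𝔮 y))`, see `starHom_apply`. -/
def starHom (z : 𝕜) (k l : ℕ) : SymPower 𝕜 g k →ₗ[𝕜] SymPower 𝕜 g l →ₗ[𝕜] SymAlg 𝕜 g :=
  ∑ n ∈ Finset.range (k + l + 1), z ^ n •
    ((LinearMap.mul 𝕜 (UniversalEnvelopingAlgebra 𝕜 g)).compl₁₂
      (quantN 𝕜 g k) (quantN 𝕜 g l)).compr₂
      ((DirectSum.lof 𝕜 ℕ (fun m => SymPower 𝕜 g m) (k + l - n)).comp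
        ((DirectSum.component 𝕜 ℕ (fun m => SymPower 𝕜 g m) (k + l - n)).comp (quantInv 𝕜 g)))

theorem starHom_apply (z : 𝕜) (k l : ℕ) (x : SymPower 𝕜 g k) (y : SymPower 𝕜 g l) :
    starHom g z k l x y = ∑ n ∈ Finset.range (k + l + 1), z ^ n •
      DirectSum.lof 𝕜 ℕ (fun m => SymPower 𝕜 g m) (k + l - n)
        (quantInv 𝕜 g (quantN 𝕜 g k x * quantN 𝕜 g l y) (k + l - n)) := by
  simp [starHom, LinearMap.sum_apply, DirectSum.component]
  rfl

/-- The Gutt star product `⋆_z` on `Sym(g)`: the bilinear extension of `starHom`. -/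
def star (z : 𝕜) : SymAlg 𝕜 g →ₗ[𝕜] SymAlg 𝕜 g →ₗ[𝕜] SymAlg 𝕜 g :=
  DirectSum.toModule 𝕜 ℕ _ fun k =>
    (DirectSum.toModule 𝕜 ℕ _ fun l => (starHom g z k l).flip).flip

theorem star_lof (z : 𝕜) (k l : ℕ) (x : SymPower 𝕜 g k) (y : SymPower 𝕜 g l) :
    star g z (DirectSum.lof 𝕜 ℕ (fun m => SymPower 𝕜 g m) k x)
      (DirectSum.lof 𝕜 ℕ (fun m => SymPower 𝕜 g m) l y) = starHom g z k l x y := by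
  simp [star]

variable {g} [TopologicalSpace g]

/-- The Gutt star product as a product on `Sym_{R⁻}(g)`. -/
def starMinus {R : ℝ} (z : 𝕜) (x y : SymMinus 𝕜 g R) : SymMinus 𝕜 g R := star g z x y

/-- The extension by continuity of the Gutt star product to the completion of `Sym_{R⁻}(g)`. -/
def starHat {R : ℝ} (z : 𝕜) (x y : SymHat 𝕜 g R) : SymHat 𝕜 g R :=
  (UniformSpace.Completion.isDenseInducing_coe.prodMap
    UniformSpace.Completion.isDenseInducing_coe).extend
    (fun a : SymMinus 𝕜 g R × SymMinus 𝕜 g R => (starMinus z a.1 a.2 : SymHat 𝕜 g R)) (x, y)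

end Star

section BCH

/-- The word `ξ^{r₁} η^{s₁} ⋯ ξ^{r_k} η^{s_k}`, where `m i = (rᵢ, sᵢ)`. -/
def bchWord {α : Type*} {k : ℕ} (ξ η : α) (m : Fin k → ℕ × ℕ) : List α :=
  (List.ofFn fun i => List.replicate (m i).1 ξ ++ List.replicate (m i).2 η).flatten

theorem length_bchWord {α : Type*} {k : ℕ} (ξ η : α) (m : Fin k → ℕ × ℕ) :
    (bchWord ξ η m).length = ∑ i, ((m i).1 + (m i).2) := by
  simp [bchWord, List.length_flatten, List.map_ofFn, List.sum_ofFn]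

variable (𝕜 : Type*) [RCLike 𝕜] {g : Type*} [LieRing g] [LieAlgebra 𝕜 g]

/-- The nested bracket `[x₁, [x₂, … [xₙ₋₁, xₙ] … ]]` of a word `x₁ … xₙ`. -/
def nestedBracket : List g → g
  | [] => 0
  | [x] => x
  | x :: y :: w => ⁅x, nestedBracket (y :: w)⁆

/-- The part `BCHₙ(ξ, η)` of the Baker-Campbell-Hausdorff series with exactly `n` letters, in
Dynkin's form: the sum over `k` and over all `(r₁, s₁), …, (r_k, s_k)` with `rᵢ + sᵢ ≥ 1` and
`∑ (rᵢ + sᵢ) = n` of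
`((-1)^(k-1) / k) * [ξ^{r₁} η^{s₁} ⋯ ξ^{r_k} η^{s_k}] / (n * ∏ rᵢ! sᵢ!)`. -/
def bchTerm (n : ℕ) (ξ η : g) : g :=
  ∑ k ∈ Finset.Icc 1 n,
    ∑ m ∈ (Fintype.piFinset fun _ : Fin k => Finset.range (n + 1) ×ˢ Finset.range (n + 1)) with
        (∀ i, 1 ≤ (m i).1 + (m i).2) ∧ ∑ i, ((m i).1 + (m i).2) = n,
      ((-1 : 𝕜) ^ (k - 1) / k * ((n : 𝕜) * ∏ i, ((m i).1 ! * (m i).2 ! : 𝕜))⁻¹) •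
        nestedBracket (bchWord ξ η m)

theorem nestedBracket_mem (n : ℕ) (w : List g) (hw : w.length = n + 1) :
    nestedBracket w ∈ LieModule.lowerCentralSeries 𝕜 g g n := by
  induction n generalizing w with
  | zero => simp
  | succ n ih =>
    match w, hw with
    | x :: y :: w, hw =>
      rw [LieModule.lowerCentralSeries_succ]
      exact LieSubmodule.lie_mem_lie (LieSubmodule.mem_top x) (ih (y :: w) (by simpa using hw))

theorem bchTerm_mem (n : ℕ) (ξ η : g) :
    bchTerm 𝕜 (n + 1) ξ η ∈ LieModule.lowerCentralSeries 𝕜 g g n := by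
  refine Submodule.sum_mem (LieModule.lowerCentralSeries 𝕜 g g n).toSubmodule fun k _ =>
    Submodule.sum_mem _ fun m hm => Submodule.smul_mem _ _ ?_
  exact nestedBracket_mem 𝕜 n _ (by
    rw [length_bchWord]; exact (Finset.mem_filter.mp hm).2.2)

theorem bchTerm_finite_support [LieRing.IsNilpotent g] (ξ η : g) :
    (Function.support fun n : ℕ => bchTerm 𝕜 n ξ η).Finite := by
  obtain ⟨N, hN⟩ := LieModule.IsNilpotent.nilpotent 𝕜 g g
  refine (Set.finite_le_nat N).subset fun n hn => ?_
  by_contra hlt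
  obtain ⟨m, rfl⟩ : ∃ m, n = m + 1 := ⟨n - 1, by simp at hlt; omega⟩
  have h := LieModule.antitone_lowerCentralSeries 𝕜 g g
    (show N ≤ m by simp at hlt; omega) (bchTerm_mem 𝕜 m ξ η)
  rw [hN] at h
  exact hn (by simpa using h)

/-- The Baker-Campbell-Hausdorff series `BCH(ξ, η) = ∑ₙ BCHₙ(ξ, η)` of a nilpotent Lie algebra;
only finitely many terms are nonzero, see `bchTerm_finite_support`. -/
def bch (ξ η : g) : g := ∑ᶠ n : ℕ, bchTerm 𝕜 n ξ η

end BCH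

end GuttStar

end

/-! Left multiplication by `ξ` in the enveloping algebra becomes explicit on symmetric tensors: with
`b_j` the Taylor coefficients of `u / (exp u - 1)`, it sends `ηⁿ/n!` to the sum over `j + m = n` of
`b_j ((ad η)ʲ ξ) ηᵐ/m!`. This formula defines operators `rho ξ`. A functional equation of the
Bernoulli series shows that they represent the Lie algebra, so `U(g)` acts on `Sym(g)`; letting it
act on `1` inverts the symmetrization map. This proves Poincaré–Birkhoff–Witt (`quant_bijective`),
and the same formula later drives the estimates.

The Baker–Campbell–Hausdorff identity is proved in `U(g)[t]/(tᴹ)`. Dynkin's series solves the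
differential equation of `log(exp tξ exp tη)`, because the Euler derivation `t d/dt` cancels
Dynkin's factor `1/n`. Uniqueness of the solution, modulo growing powers of `t`, gives
`nexp_bchSeries`. The coefficient of `tⁿ` is a symmetric expression in the terms `BCH_m`, so its
component in each `Symʳ` can be read off (`quantInv_sum_antidiagonal`). If the lower central series
vanishes at step `D`, only terms with `m ≤ D` survive, and the product of `Symᵏ` and `Symˡ` has no
component of degree `r < (k+l)/D` (`quantInv_mul_apply_eq_zero`).

Continuity rests on three facts. Nilpotency allows every continuous seminorm to be dominated by a
continuous submultiplicative one (`exists_submultiplicative_seminorm`). Iterating `rho` in seminorms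
rescaled by `n = k+l` bounds the degree `r` component by `Cⁿ n^(n-r)`
(`pow_mul_tensorSeminorm_quantInv_le`). Finally `n ≤ D r` turns a loss `ε` in the weight of the
product into a gain `ε/D` in the weights of the factors (`factorial_estimate`). Since `ε` is
arbitrary, the `1⁻` topology absorbs this change of exponent.

For exponentials, the triple family of components indexed by `(k, l, r)` is unconditionally summable
in the completion. Regrouping by `r` leaves finite sums, which are the components of the exponential
on the right-hand side. -/

open scoped TensorProduct DirectSum Nat

noncomputable section

namespace GuttStar

open Finset.HasAntidiagonal (antidiagonal)

/-! ### Functional equations of the Bernoulli generating function. -/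

section PowerSeriesIdentities

open PowerSeries

variable (R : Type*) [CommRing R] [Algebra ℚ R]

/-- The Taylor coefficients of `u / (exp u - 1)`. -/
def bern (j : ℕ) : R := coeff j (bernoulliPowerSeries R)

variable {R}

theorem rescale_bernoulli_mul (u : R) :
    rescale u (bernoulliPowerSeries R) * (rescale u (exp R) - 1) = C u * X := by
  have h := congrArg (rescale u) (bernoulliPowerSeries_mul_exp_sub_one R)
  rw [map_mul, map_sub, map_one, rescale_X] at h
  exact h

theorem rescale_exp_add (u v : R) :
    rescale (u + v) (exp R) = rescale u (exp R) * rescale v (exp R) :=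
  (exp_mul_exp_eq_exp_add u v).symm

theorem rescale_exp_sub_one_ne_zero [IsDomain R] {u : R} (hu : u ≠ 0) :
    rescale u (exp R) - 1 ≠ 0 := by
  intro h
  have h1 := rescale_bernoulli_mul u
  rw [h, mul_zero] at h1
  have h2 := congrArg (coeff 1) h1
  simp at h2
  exact hu h2.symm

/-- Write `exp(uX) = exp((u-v)X) exp(vX)` and multiply the defining relation of the Bernoulli series
at `u - v` by `exp(vX)`. -/
theorem bern_identity_left_aux [IsDomain R] (u v : R) :
    C (u - v) * X * rescale v (exp R) =
      rescale (u - v) (bernoulliPowerSeries R) * (rescale u (exp R) - rescale v (exp R)) := by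
  have h := rescale_exp_add (u - v) v
  rw [sub_add_cancel] at h
  rw [h, ← rescale_bernoulli_mul]
  ring

/-- This functional equation is the scalar form of the statement that the operators `rho` respect
the Lie bracket. -/
theorem bern_identity_lie_aux [IsDomain R] {u v : R} (hu : u ≠ 0) (hv : v ≠ 0)
    (huv : u + v ≠ 0) :
    C u * (rescale v (bernoulliPowerSeries R) *
      (rescale (u + v) (bernoulliPowerSeries R) - rescale u (bernoulliPowerSeries R))) +
    C v * (rescale u (bernoulliPowerSeries R) *
      (rescale (u + v) (bernoulliPowerSeries R) - rescale v (bernoulliPowerSeries R))) =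
    - (C (u * v) * X * rescale (u + v) (bernoulliPowerSeries R)) := by
  have a := rescale_bernoulli_mul u
  have b := rescale_bernoulli_mul v
  have c := rescale_bernoulli_mul (u + v)
  have a0 := rescale_exp_sub_one_ne_zero hu
  have b0 := rescale_exp_sub_one_ne_zero hv
  have c0 := rescale_exp_sub_one_ne_zero huv
  -- Once the three factors `exp - 1` are multiplied in, the claim follows from the defining
  -- relations `a`, `b`, `c` by polynomial algebra in the two exponentials.
  apply mul_right_cancel₀ (mul_ne_zero (mul_ne_zero a0 b0) c0)
  rw [rescale_exp_add, map_add] at *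
  generalize rescale u (bernoulliPowerSeries R) = Pu at *
  generalize rescale v (bernoulliPowerSeries R) = Pv at *
  generalize rescale (u + v) (bernoulliPowerSeries R) = Pw at *
  generalize rescale u (exp R) = Eu at *
  generalize rescale v (exp R) = Ev at *
  rw [map_mul]
  linear_combination C u * (Eu - 1) * ((Pw * (Eu * Ev - 1)) * b + C v * X * c)
    - (C u + C v) * (Eu * Ev - 1) * ((Pu * (Eu - 1)) * b + C v * X * a)
    + C v * (Ev - 1) * ((Pw * (Eu * Ev - 1)) * a + C u * X * c)
    + C u * C v * X * (Eu - 1) * (Ev - 1) * c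

theorem coeff_rescale_bernoulli (u : R) (n : ℕ) :
    coeff n (rescale u (bernoulliPowerSeries R)) = bern R n * u ^ n := by
  rw [coeff_rescale, bern, mul_comm]

/-- Compare coefficients of `X^(n+1)` and cancel `u - v`. The inner sum is the quotient of `u^(m+1)
- v^(m+1)` by `u - v`, written without division so that it can be evaluated at operators. -/
theorem bern_identity_left [IsDomain R] {u v : R} (huv : u - v ≠ 0) (n : ℕ) :
    algebraMap ℚ R (1 / n !) * v ^ n = ∑ p ∈ antidiagonal n,
      bern R p.1 * (u - v) ^ p.1 * (algebraMap ℚ R (1 / (p.2 + 1)!) *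
        ∑ i ∈ Finset.range (p.2 + 1), u ^ i * v ^ (p.2 - i)) := by
  have h := congrArg (coeff (n + 1)) (bern_identity_left_aux u v)
  rw [mul_assoc, coeff_C_mul, coeff_succ_X_mul, coeff_rescale, coeff_exp, coeff_mul,
    Finset.Nat.sum_antidiagonal_succ'] at h
  simp only [coeff_rescale_bernoulli, map_sub] at h
  simp only [coeff_rescale, coeff_exp, pow_zero, sub_self, mul_zero, zero_add] at h
  apply mul_left_cancel₀ huv
  rw [mul_comm (algebraMap ℚ R _), h, Finset.mul_sum]
  refine Finset.sum_congr rfl fun p _ => ?_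
  have g := geom_sum₂_mul u v (p.2 + 1)
  rw [← sub_mul, ← g]
  simp only [Nat.add_sub_cancel]
  ring

/-- Coefficients of the functional equation after cancelling `u v`; the differences of powers of `u
+ v` and `u`, and of `u + v` and `v`, are again replaced by geometric sums. -/
theorem bern_identity_lie [IsDomain R] {u v : R} (hu : u ≠ 0) (hv : v ≠ 0)
    (huv : u + v ≠ 0) (k : ℕ) :
    ∑ p ∈ antidiagonal (k + 1), bern R p.1 * bern R p.2 *
      ((∑ i ∈ Finset.range p.2, (u + v) ^ i * u ^ (p.2 - 1 - i)) * v ^ p.1 +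
        (∑ i ∈ Finset.range p.2, (u + v) ^ i * v ^ (p.2 - 1 - i)) * u ^ p.1) =
    - (bern R k * (u + v) ^ k) := by
  have h := congrArg (coeff (k + 1)) (bern_identity_lie_aux hu hv huv)
  rw [map_neg, mul_assoc, coeff_C_mul, coeff_succ_X_mul, map_add, coeff_C_mul, coeff_C_mul,
    coeff_mul, coeff_mul, Finset.mul_sum, Finset.mul_sum, ← Finset.sum_add_distrib] at h
  simp only [coeff_rescale_bernoulli, map_sub] at h
  apply mul_left_cancel₀ (mul_ne_zero hu hv)
  rw [mul_neg, ← h, Finset.mul_sum]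
  refine Finset.sum_congr rfl fun p _ => ?_
  have g := geom_sum₂_mul (u + v) u p.2
  have g' := geom_sum₂_mul (u + v) v p.2
  rw [add_sub_cancel_left] at g
  rw [add_sub_cancel_right] at g'
  linear_combination bern R p.1 * bern R p.2 * (u * v ^ p.1 * g + v * u ^ p.1 * g')

end PowerSeriesIdentities

/-! ### Transfer of the identities to commuting operators. -/

section CommutingPair

variable {K E : Type*} [Field K] [Ring E] [Algebra K E]

/-- Evaluation of polynomials in two variables at a commuting pair. -/
theorem exists_aeval_commute {f g : E} (h : Commute f g) :
    ∃ Φ : MvPolynomial (Fin 2) K →ₐ[K] E, Φ (MvPolynomial.X 0) = f ∧ Φ (MvPolynomial.X 1) = g := by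
  let s : Set E := {f, g}
  have hc : ∀ a ∈ s, ∀ b ∈ s, a * b = b * a := by
    rintro a (rfl | rfl) b (rfl | rfl)
    exacts [rfl, h.eq, h.eq.symm, rfl]
  -- Polynomial evaluation needs a commutative target, hence the detour through the subalgebra
  -- generated by the pair.
  have hcomm := Algebra.isMulCommutative_adjoin K hc
  let _ : CommRing (Algebra.adjoin K s) :=
    { (inferInstance : Ring (Algebra.adjoin K s)) with mul_comm := hcomm.is_comm.comm }
  have hf : f ∈ Algebra.adjoin K s := Algebra.subset_adjoin (Or.inl rfl)
  have hg : g ∈ Algebra.adjoin K s := Algebra.subset_adjoin (Or.inr rfl)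
  refine ⟨(Algebra.adjoin K s).val.comp
    (MvPolynomial.aeval (![⟨f, hf⟩, ⟨g, hg⟩] : Fin 2 → Algebra.adjoin K s)), ?_, ?_⟩ <;>
  simp

variable [CharZero K]

theorem map_bern (Φ : MvPolynomial (Fin 2) K →ₐ[K] E) (j : ℕ) :
    Φ (bern _ j) = algebraMap K E (bern K j) := by
  have : bern (MvPolynomial (Fin 2) K) j = algebraMap K _ (bern K j) := by
    simp only [bern, bernoulliPowerSeries, PowerSeries.coeff_mk]
    rw [← IsScalarTower.algebraMap_apply]
  rw [this, AlgHom.commutes]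

theorem map_rat_algebraMap (Φ : MvPolynomial (Fin 2) K →ₐ[K] E) (q : ℚ) :
    Φ (algebraMap ℚ _ q) = algebraMap K E (q : K) := by
  rw [IsScalarTower.algebraMap_apply ℚ K (MvPolynomial (Fin 2) K), AlgHom.commutes]
  simp

-- The cancellation of `u - v` is legitimate for two independent variables; evaluating the resulting
-- identity at `f` and `g` needs no assumption that `E` is a domain.
open MvPolynomial in
theorem commute_bern_identity_left {f g : E} (h : Commute f g) (n : ℕ) :
    ((n ! : K)⁻¹) • g ^ n = ∑ p ∈ antidiagonal n,
      bern K p.1 • ((((p.2 + 1)! : K)⁻¹) •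
        (∑ i ∈ Finset.range (p.2 + 1), f ^ i * g ^ (p.2 - i)) * (f - g) ^ p.1) := by
  obtain ⟨Φ, rfl, rfl⟩ := exists_aeval_commute (K := K) h
  have hX : (X 0 - X 1 : MvPolynomial (Fin 2) K) ≠ 0 :=
    sub_ne_zero.mpr fun h => by simpa using X_injective h
  have key := congrArg Φ (bern_identity_left hX n)
  simp only [map_mul, map_sum, map_pow, map_sub, map_rat_algebraMap, map_bern] at key
  rw [← Algebra.smul_def] at key
  simp only [one_div, Rat.cast_inv, Rat.cast_natCast] at key
  rw [key]
  refine Finset.sum_congr rfl fun p _ => ?_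
  have hc : Commute ((Φ (X 0) - Φ (X 1)) ^ p.1) (algebraMap K E ((p.2 + 1)! : K)⁻¹ *
        ∑ i ∈ Finset.range (p.2 + 1), Φ (X 0) ^ i * Φ (X 1) ^ (p.2 - i)) := by
    refine Commute.mul_right (Algebra.commutes _ _).symm (Commute.sum_right _ _ _ fun i _ => ?_)
    rw [← map_sub, ← map_pow, ← map_pow, ← map_pow, ← map_mul]
    exact (Commute.all _ _).map Φ
  rw [mul_assoc, hc.eq, Algebra.smul_def, Algebra.smul_def]

-- Again proved for two independent variables, where the denominators are nonzero, and then
-- specialized.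
open MvPolynomial in
theorem commute_bern_identity_lie {f g : E} (h : Commute f g) (k : ℕ) :
    ∑ p ∈ antidiagonal (k + 1), (bern K p.1 * bern K p.2) •
      ((∑ i ∈ Finset.range p.2, (f + g) ^ i * f ^ (p.2 - 1 - i)) * g ^ p.1 +
        (∑ i ∈ Finset.range p.2, (f + g) ^ i * g ^ (p.2 - 1 - i)) * f ^ p.1) =
    - (bern K k • (f + g) ^ k) := by
  obtain ⟨Φ, rfl, rfl⟩ := exists_aeval_commute (K := K) h
  have hX : (X 0 + X 1 : MvPolynomial (Fin 2) K) ≠ 0 := by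
    intro h
    have := congrArg (eval ![1, 0]) h
    simp at this
  have key := congrArg Φ (bern_identity_lie (X_ne_zero 0) (X_ne_zero 1) hX k)
  simp only [map_mul, map_sum, map_pow, map_add, map_neg, map_bern] at key
  rw [← Algebra.smul_def] at key
  rw [← key]
  refine Finset.sum_congr rfl fun p _ => ?_
  rw [Algebra.smul_def, map_mul]

end CommutingPair

/-! ### Left multiplication in terms of symmetrized products. -/

section AssociativeIdentity

variable {K A : Type*} [Field K] [Ring A] [Algebra K A]

/-- The polarized divided power `1/(m+1)! ∑ Bⁱ Z B^(m-i)`. -/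
def dpow (B : A) (m : ℕ) : A →ₗ[K] A :=
  (((m + 1)! : K)⁻¹) • ∑ i ∈ Finset.range (m + 1),
    LinearMap.mulLeft K (B ^ i) ∘ₗ LinearMap.mulRight K (B ^ (m - i))

theorem dpow_apply (B Z : A) (m : ℕ) :
    dpow (K := K) B m Z = (((m + 1)! : K)⁻¹) • ∑ i ∈ Finset.range (m + 1), B ^ i * Z * B ^ (m - i) := by
  simp [dpow, LinearMap.sum_apply, mul_assoc]

/-- The commutator with `B`. -/
def adOp (B : A) : A →ₗ[K] A := LinearMap.mulLeft K B - LinearMap.mulRight K B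

@[simp] theorem adOp_apply (B Z : A) : adOp (K := K) B Z = B * Z - Z * B := rfl

/-- Left and right multiplication by `B` commute and their difference is the commutator with `B`, so
the two-variable identity applies. This is the source of the formula for `rho`. -/
theorem mul_pow_eq_sum_dpow [CharZero K] (W B : A) (n : ℕ) :
    ((n ! : K)⁻¹) • (W * B ^ n) = ∑ p ∈ antidiagonal n,
      bern K p.1 • dpow (K := K) B p.2 ((adOp (K := K) B ^ p.1) W) := by
  have h := commute_bern_identity_left (K := K) (LinearMap.commute_mulLeft_right (R := K) B B) n
  have h2 := congrArg (fun F : Module.End K A => F W) h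
  simp only [LinearMap.smul_apply, LinearMap.sum_apply, LinearMap.pow_mulRight,
    LinearMap.mulRight_apply] at h2
  rw [h2]
  refine Finset.sum_congr rfl fun p _ => ?_
  congr 1
  simp only [dpow, LinearMap.pow_mulLeft]
  rfl

end AssociativeIdentity

/-! ### The Bernoulli identity for iterated brackets. -/

section LieIdentity

variable {K L : Type*} [Field K] [LieRing L] [LieAlgebra K L]

open LieAlgebra

/-- The derivative of `y ↦ (ad y)ʲ x` at `y` in the direction `z`. -/
def dad (y : L) (j : ℕ) (x z : L) : L :=
  ∑ p ∈ Finset.range j, (ad K L y ^ p) ⁅z, (ad K L y ^ (j - 1 - p)) x⁆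

/-- On `L ⊗ L` the operators `ad y ⊗ 1` and `1 ⊗ ad y` commute, and by the Jacobi identity the
bracket intertwines their sum with `ad y`. The claim is the image under the bracket of the
commuting-pair identity applied to `x₁ ⊗ x₂`. -/
theorem bern_dad_identity [CharZero K] (y x₁ x₂ : L) (k : ℕ) :
    ∑ p ∈ antidiagonal (k + 1), (bern K p.1 * bern K p.2) •
      (dad (K := K) y p.2 x₁ ((ad K L y ^ p.1) x₂) - dad (K := K) y p.2 x₂ ((ad K L y ^ p.1) x₁)) =
    bern K k • (ad K L y ^ k) ⁅x₁, x₂⁆ := by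
  let f : Module.End K (L ⊗[K] L) := LinearMap.rTensor L (ad K L y : Module.End K L)
  let g : Module.End K (L ⊗[K] L) := LinearMap.lTensor L (ad K L y : Module.End K L)
  have hfg : Commute f g := by
    refine TensorProduct.ext' fun a b => ?_
    simp [f, g]
  let br : L ⊗[K] L →ₗ[K] L := TensorProduct.lift
    (LinearMap.mk₂ K (fun a b : L => ⁅a, b⁆) add_lie smul_lie lie_add fun c a b => lie_smul c a b)
  have hbr : ∀ a b, br (a ⊗ₜ b) = ⁅a, b⁆ := fun a b => by simp [br]
  have hs : ∀ (p : ℕ) (t : L ⊗[K] L), br (((f + g) ^ p) t) = (ad K L y ^ p) (br t) := by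
    have h1 : br ∘ₗ (f + g) = (ad K L y : Module.End K L) ∘ₗ br := by
      refine TensorProduct.ext' fun a b => ?_
      simp [f, g, hbr]
    intro p
    induction p with
    | zero => simp
    | succ p ih =>
      intro t
      rw [pow_succ, Module.End.mul_apply, ih, pow_succ, Module.End.mul_apply]
      congr 1
      exact LinearMap.congr_fun h1 t
  have hf : ∀ (p : ℕ) (a b : L), (f ^ p) (a ⊗ₜ b) = ((ad K L y ^ p) a) ⊗ₜ b := by
    intro p a b
    simp only [f, LinearMap.rTensor_pow]
    rfl
  have hg : ∀ (p : ℕ) (a b : L), (g ^ p) (a ⊗ₜ b) = a ⊗ₜ ((ad K L y ^ p) b) := by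
    intro p a b
    simp only [g, LinearMap.lTensor_pow]
    rfl
  have key := congrArg (fun F : Module.End K (L ⊗[K] L) => - br (F (x₁ ⊗ₜ x₂)))
    (commute_bern_identity_lie (K := K) hfg k)
  simp only [LinearMap.neg_apply, map_neg, neg_neg, LinearMap.smul_apply, map_smul, hs, hbr] at key
  rw [← key]
  simp only [LinearMap.sum_apply, LinearMap.smul_apply, map_sum, map_smul, LinearMap.add_apply,
    Module.End.mul_apply, map_add, hf, hg, hs, hbr]
  rw [← Finset.sum_neg_distrib]
  refine Finset.sum_congr rfl fun p _ => ?_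
  rw [← smul_neg]
  congr 1
  simp only [dad]
  rw [neg_add, sub_eq_add_neg]
  congr 1
  rw [← Finset.sum_neg_distrib]
  refine Finset.sum_congr rfl fun i _ => ?_
  rw [← lie_skew, map_neg]
  
end LieIdentity

/-! ### Polarization. -/

section Polarization

/-- Every linear functional turns the hypothesis into a polynomial vanishing on an infinite field.
It serves to separate bidegrees after scaling one argument. -/
theorem coeff_eq_zero_of_forall_sum_pow_smul_eq_zero {K V : Type*} [Field K] [Infinite K]
    [AddCommGroup V] [Module K V] (N : ℕ) (v : ℕ → V)
    (h : ∀ a : K, ∑ k ∈ Finset.range N, a ^ k • v k = 0) (k : ℕ) (hk : k < N) : v k = 0 := by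
  rw [← Module.forall_dual_apply_eq_zero_iff K]
  intro f
  let P : Polynomial K := ∑ k ∈ Finset.range N, Polynomial.monomial k (f (v k))
  have hP : P = 0 := by
    refine Polynomial.funext fun a => ?_
    have := congrArg f (h a)
    simpa [P, Polynomial.eval_finsetSum, mul_comm] using this
  have := congrArg (Polynomial.coeff · k) hP
  simpa [P, Polynomial.finsetSum_coeff, Polynomial.coeff_monomial, hk] using this

theorem sum_perm_eq_sum_powerset {K V W : Type*} [Field K] [AddCommGroup V] [Module K V]
    [AddCommGroup W] [Module K W] (n : ℕ) (f : MultilinearMap K (fun _ : Fin n => V) W)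
    (v : Fin n → V) :
    ∑ σ : Equiv.Perm (Fin n), f (fun i => v (σ i)) = (-1 : K) ^ n •
      ∑ t ∈ (Finset.univ : Finset (Fin n)).powerset,
        (-1 : K) ^ t.card • f (fun _ => ∑ j ∈ t, v j) := by
  classical
  -- Inclusion–exclusion: the sum over subsets factors into one factor per `j`, equal to `-1` if `j`
  -- is a value of `r` and to `0` otherwise. Only surjections, hence permutations, survive.
  have hcoef : ∀ r : Fin n → Fin n, ∑ t ∈ (Finset.univ : Finset (Fin n)).powerset,
      (-1 : K) ^ t.card * (if ∀ i, r i ∈ t then 1 else 0) =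
      if Function.Surjective r then (-1) ^ n else 0 := by
    intro r
    have h1 := Finset.prod_add (fun _ : Fin n => (-1 : K))
      (fun j => if ∃ i, r i = j then 0 else 1) Finset.univ
    have h2 : ∀ t ∈ (Finset.univ : Finset (Fin n)).powerset,
        (-1 : K) ^ t.card * (if ∀ i, r i ∈ t then 1 else 0) =
        (∏ _i ∈ t, (-1 : K)) * ∏ j ∈ Finset.univ \ t, (if ∃ i, r i = j then (0 : K) else 1) := by
      intro t _
      rw [Finset.prod_const]
      congr 1
      split_ifs with ht
      · refine (Finset.prod_eq_one fun j hj => if_neg ?_).symm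
        rintro ⟨i, rfl⟩
        exact (Finset.mem_sdiff.mp hj).2 (ht i)
      · push Not at ht
        obtain ⟨i, hi⟩ := ht
        refine (Finset.prod_eq_zero (Finset.mem_sdiff.mpr ⟨Finset.mem_univ (r i), hi⟩) ?_).symm
        exact if_pos ⟨i, rfl⟩
    rw [Finset.sum_congr rfl h2, ← h1]
    split_ifs with hr
    · rw [Finset.prod_congr rfl fun j _ => by rw [if_pos (hr j), add_zero]]
      simp
    · simp only [Function.Surjective, not_forall] at hr
      obtain ⟨j, hj⟩ := hr
      exact Finset.prod_eq_zero (Finset.mem_univ j) (by rw [if_neg hj]; ring)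
  have h3 : ∀ t ∈ (Finset.univ : Finset (Fin n)).powerset,
      (-1 : K) ^ t.card • f (fun _ => ∑ j ∈ t, v j) = ∑ r : Fin n → Fin n,
        ((-1 : K) ^ t.card * (if ∀ i, r i ∈ t then 1 else 0)) • f (fun i => v (r i)) := by
    intro t _
    rw [f.map_sum_finset (fun _ j => v j) (fun _ => t), Finset.smul_sum]
    rw [← Finset.sum_subset (Finset.subset_univ (Fintype.piFinset fun _ => t))]
    · refine Finset.sum_congr rfl fun r hr => ?_
      rw [Fintype.mem_piFinset] at hr
      rw [if_pos hr, mul_one]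
    · intro r _ hr
      rw [Fintype.mem_piFinset] at hr
      rw [if_neg hr, mul_zero, zero_smul]
  rw [Finset.sum_congr rfl h3, Finset.sum_comm]
  simp only [← Finset.sum_smul, hcoef, ite_smul, zero_smul]
  rw [← Finset.sum_filter, ← Finset.smul_sum, smul_smul, ← mul_pow]
  simp only [mul_neg, mul_one, neg_neg, one_pow, one_smul]
  refine Finset.sum_bij (fun σ _ => (σ : Fin n → Fin n)) (fun σ _ => ?_) (fun σ _ τ _ h => ?_)
    (fun r hr => ?_) (fun σ _ => rfl)
  · simpa using σ.surjective
  · exact DFunLike.coe_injective h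
  · have hs : Function.Surjective r := by simpa using hr
    exact ⟨Equiv.ofBijective r (Finite.surjective_iff_bijective.mp hs), Finset.mem_univ _, rfl⟩

end Polarization

/-! ### Symmetric powers. -/

section SymPower

variable {𝕜 : Type*} [RCLike 𝕜] {V : Type*} [AddCommGroup V] [Module 𝕜 V]

theorem reindex_symmetrizer (n : ℕ) (τ : Equiv.Perm (Fin n)) (x : ⨂[𝕜]^n V) :
    symmetrizer 𝕜 V n (PiTensorProduct.reindex 𝕜 (fun _ : Fin n => V) τ x) =
      symmetrizer 𝕜 V n x := by
  have : (symmetrizer 𝕜 V n) ∘ₗ (PiTensorProduct.reindex 𝕜 (fun _ : Fin n => V) τ).toLinearMap =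
      symmetrizer 𝕜 V n := by
    refine PiTensorProduct.ext (MultilinearMap.ext fun v => ?_)
    have h := PiTensorProduct.reindex_tprod (R := 𝕜) (s := fun _ => V) τ v
    simp only [LinearMap.compMultilinearMap_apply, LinearMap.comp_apply, LinearEquiv.coe_coe]
    erw [h]
    rw [symmetrizer_tprod, symmetrizer_tprod]
    congr 1
    exact Fintype.sum_equiv (Equiv.mulLeft τ⁻¹) _ _ fun σ => rfl
  exact LinearMap.congr_fun this x

theorem symProd_comp_perm {n : ℕ} (v : Fin n → V) (τ : Equiv.Perm (Fin n)) :
    symProd 𝕜 (fun i => v (τ i)) = symProd 𝕜 v := by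
  refine Subtype.ext ?_
  have h := PiTensorProduct.reindex_tprod (R := 𝕜) (s := fun _ => V) τ⁻¹ v
  have h2 := reindex_symmetrizer (𝕜 := 𝕜) n τ⁻¹ (PiTensorProduct.tprod 𝕜 v)
  erw [h] at h2
  exact h2

theorem symmetrizer_of_forall_reindex (n : ℕ) (x : ⨂[𝕜]^n V)
    (h : ∀ τ : Equiv.Perm (Fin n), PiTensorProduct.reindex 𝕜 (fun _ : Fin n => V) τ x = x) :
    symmetrizer 𝕜 V n x = x := by
  have h0 : (n ! : 𝕜) ≠ 0 := Nat.cast_ne_zero.mpr (Nat.factorial_ne_zero n)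
  simp only [symmetrizer, LinearMap.smul_apply, LinearMap.sum_apply, LinearEquiv.coe_coe]
  erw [Finset.sum_congr rfl fun τ _ => h τ]
  rw [Finset.sum_const, Finset.card_univ, Fintype.card_perm, Fintype.card_fin,
    ← Nat.cast_smul_eq_nsmul 𝕜, smul_smul, inv_mul_cancel₀ h0, one_smul]

/-- The symmetrizer as a projection onto the symmetric power. -/
def symProj (𝕜 : Type*) [RCLike 𝕜] (V : Type*) [AddCommGroup V] [Module 𝕜 V] (n : ℕ) :
    (⨂[𝕜]^n V) →ₗ[𝕜] SymPower 𝕜 V n :=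
  (symmetrizer 𝕜 V n).rangeRestrict

/-- The symmetric product as a multilinear map. -/
def symProdMulti (𝕜 : Type*) [RCLike 𝕜] (V : Type*) [AddCommGroup V] [Module 𝕜 V] (n : ℕ) :
    MultilinearMap 𝕜 (fun _ : Fin n => V) (SymPower 𝕜 V n) :=
  (symProj 𝕜 V n).compMultilinearMap (PiTensorProduct.tprod 𝕜)

@[simp] theorem symProdMulti_apply {n : ℕ} (v : Fin n → V) :
    symProdMulti 𝕜 V n v = symProd 𝕜 v := rfl

theorem span_symProd (n : ℕ) :
    Submodule.span 𝕜 (Set.range fun v : Fin n → V => symProd 𝕜 v) = ⊤ := by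
  have h : (Set.range fun v : Fin n → V => symProd 𝕜 v) =
      symProj 𝕜 V n '' Set.range (PiTensorProduct.tprod 𝕜) := by
    rw [← Set.range_comp]
    rfl
  rw [h, ← Submodule.map_span, PiTensorProduct.span_tprod_eq_top, Submodule.map_top]
  exact LinearMap.range_rangeRestrict _

/-- The polarization formula expresses a symmetric product through powers of partial sums. Hence
linear maps on `Symⁿ(V)` need only be compared on powers, which is how all later identities are
checked. -/
theorem symProd_mem_span_symPow {n : ℕ} (v : Fin n → V) :
    symProd 𝕜 v ∈ Submodule.span 𝕜 (Set.range fun ξ : V => symPow 𝕜 ξ n) := by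
  have h0 : (n ! : 𝕜) ≠ 0 := Nat.cast_ne_zero.mpr (Nat.factorial_ne_zero n)
  have h := sum_perm_eq_sum_powerset n (symProdMulti 𝕜 V n) v
  simp only [symProdMulti_apply, symProd_comp_perm] at h
  rw [Finset.sum_const, Finset.card_univ, Fintype.card_perm, Fintype.card_fin,
    ← Nat.cast_smul_eq_nsmul 𝕜] at h
  rw [← one_smul 𝕜 (symProd 𝕜 v), ← inv_mul_cancel₀ h0, ← smul_smul, h]
  refine Submodule.smul_mem _ _ (Submodule.smul_mem _ _ (Submodule.sum_mem _ fun t _ =>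
    Submodule.smul_mem _ _ (Submodule.subset_span ⟨∑ j ∈ t, v j, rfl⟩)))

theorem span_symPow (n : ℕ) :
    Submodule.span 𝕜 (Set.range fun ξ : V => symPow 𝕜 ξ n) = ⊤ := by
  rw [eq_top_iff, ← span_symProd, Submodule.span_le]
  rintro _ ⟨v, rfl⟩
  exact symProd_mem_span_symPow v

theorem symPower_hom_ext {n : ℕ} {W : Type*} [AddCommMonoid W] [Module 𝕜 W]
    {f g : SymPower 𝕜 V n →ₗ[𝕜] W} (h : ∀ ξ : V, f (symPow 𝕜 ξ n) = g (symPow 𝕜 ξ n)) : f = g :=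
  LinearMap.ext_on_range (span_symPow n) h

theorem symAlg_hom_ext {W : Type*} [AddCommMonoid W] [Module 𝕜 W]
    {f g : SymAlg 𝕜 V →ₗ[𝕜] W}
    (h : ∀ (n : ℕ) (ξ : V), f (DirectSum.lof 𝕜 ℕ (fun n => SymPower 𝕜 V n) n (symPow 𝕜 ξ n)) =
      g (DirectSum.lof 𝕜 ℕ (fun n => SymPower 𝕜 V n) n (symPow 𝕜 ξ n))) : f = g :=
  DirectSum.linearMap_ext 𝕜 fun n => symPower_hom_ext (h n)

theorem symProd_cons_update {m : ℕ} (ζ ζ' η : V) (i : Fin (m + 1)) :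
    symProd 𝕜 (Fin.cons ζ' (Function.update (fun _ => η) i ζ) : Fin (m + 2) → V) =
      symProd 𝕜 (Fin.cons ζ' (Fin.cons ζ fun _ => η) : Fin (m + 2) → V) := by
  rw [← symProd_comp_perm _ (Equiv.swap (Fin.succ 0) (Fin.succ i))]
  congr 1
  funext j
  refine Fin.cases ?_ (fun j => ?_) j
  · rw [Equiv.swap_apply_of_ne_of_ne (Fin.succ_ne_zero _).symm (Fin.succ_ne_zero _).symm]
    rfl
  · by_cases h : j = 0
    · subst h; simp
    · by_cases h' : j = i
      · subst h'
        obtain ⟨k, rfl⟩ := Fin.exists_succ_eq.mpr h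
        simp [Function.update_of_ne (Ne.symm h)]
      · rw [Equiv.swap_apply_of_ne_of_ne (fun e => h (Fin.succ_injective _ e))
          (fun e => h' (Fin.succ_injective _ e))]
        obtain ⟨k, rfl⟩ := Fin.exists_succ_eq.mpr h
        simp [h']

theorem symProd_update {m : ℕ} (ζ η : V) (i : Fin (m + 1)) :
    symProd 𝕜 (Function.update (fun _ => η) i ζ) =
      symProd 𝕜 (Fin.cons ζ (fun _ => η) : Fin (m + 1) → V) := by
  rw [← symProd_comp_perm _ (Equiv.swap 0 i)]
  congr 1
  funext j
  by_cases h : j = 0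
  · subst h; simp
  · obtain ⟨k, rfl⟩ := Fin.exists_succ_eq.mpr h
    by_cases h' : k.succ = i
    · subst h'
      simp [Function.update_of_ne (Ne.symm h)]
    · rw [Equiv.swap_apply_of_ne_of_ne h h']
      simp [h']

theorem symProd_cons_cons_comm {m : ℕ} (ζ ζ' : V) (w : Fin m → V) :
    symProd 𝕜 (Fin.cons ζ (Fin.cons ζ' w) : Fin (m + 2) → V) =
      symProd 𝕜 (Fin.cons ζ' (Fin.cons ζ w) : Fin (m + 2) → V) := by
  rw [← symProd_comp_perm _ (Equiv.swap 0 1)]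
  congr 1
  funext j
  refine Fin.cases ?_ (fun j => Fin.cases ?_ (fun j => ?_) j) j
  · simp
  · simp
  · rw [Equiv.swap_apply_of_ne_of_ne (Fin.succ_ne_zero _) (by simp [Fin.ext_iff])]
    rfl

/-- The symmetric product `ζ ηᵐ` is the average of the tensors with one factor `ζ`. -/
theorem coe_symProd_cons_const (ζ η : V) (m : ℕ) :
    (symProd 𝕜 (Fin.cons ζ (fun _ => η) : Fin (m + 1) → V) : ⨂[𝕜]^(m + 1) V) =
      ((m + 1 : ℕ) : 𝕜)⁻¹ • ∑ i : Fin (m + 1),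
        PiTensorProduct.tprod 𝕜 (Function.update (fun _ => η) i ζ) := by
  have h0 : ((m + 1 : ℕ) : 𝕜) ≠ 0 := Nat.cast_ne_zero.mpr (Nat.succ_ne_zero m)
  have h1 : symmetrizer 𝕜 V (m + 1) (∑ i : Fin (m + 1),
      PiTensorProduct.tprod 𝕜 (Function.update (fun _ => η) i ζ)) = ∑ i : Fin (m + 1),
      PiTensorProduct.tprod 𝕜 (Function.update (fun _ => η) i ζ) := by
    refine symmetrizer_of_forall_reindex _ _ fun τ => ?_
    rw [map_sum]
    refine Fintype.sum_equiv τ _ _ fun i => ?_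
    have h := PiTensorProduct.reindex_tprod (R := 𝕜) (s := fun _ => V) τ
      (Function.update (fun _ => η) i ζ)
    erw [h]
    congr 1
    funext j
    by_cases hj : j = τ i
    · subst hj; simp
    · have : τ.symm j ≠ i := fun h => hj (by rw [← h]; simp)
      simp [hj, this]
  rw [map_sum] at h1
  have h2 : ∀ i : Fin (m + 1), symmetrizer 𝕜 V (m + 1)
      (PiTensorProduct.tprod 𝕜 (Function.update (fun _ => η) i ζ)) =
      (symProd 𝕜 (Fin.cons ζ (fun _ => η) : Fin (m + 1) → V) : ⨂[𝕜]^(m + 1) V) := fun i =>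
    congrArg Subtype.val (symProd_update (𝕜 := 𝕜) ζ η i)
  rw [Finset.sum_congr rfl fun i _ => h2 i, Finset.sum_const, Finset.card_univ, Fintype.card_fin,
    ← Nat.cast_smul_eq_nsmul 𝕜] at h1
  rw [← h1, smul_smul, inv_mul_cancel₀ h0, one_smul]

end SymPower

theorem prod_ofFn_update {M : Type*} [Monoid M] (a b : M) {n : ℕ} (i : Fin n) :
    (List.ofFn (Function.update (fun _ => a) i b)).prod = a ^ (i : ℕ) * b * a ^ (n - 1 - i) := by
  induction n with
  | zero => exact i.elim0
  | succ n ih =>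
    rw [List.ofFn_succ, List.prod_cons]
    refine Fin.cases ?_ (fun i => ?_) i
    · simp
    · have : (fun j : Fin n => Function.update (fun _ => a) i.succ b j.succ) =
          Function.update (fun _ => a) i b := by
        funext j
        simp [Function.update_apply]
      have h2 : Function.update (fun _ => a) i.succ b 0 = a :=
        Function.update_of_ne (Fin.succ_ne_zero i).symm _ _
      rw [this, ih, h2, Fin.val_succ, pow_succ', mul_assoc, mul_assoc, mul_assoc]
      congr 4
      omega

/-! ### The operators of left multiplication on the symmetric algebra. -/

section Rho

variable {𝕜 : Type*} [RCLike 𝕜] {g : Type*} [LieRing g] [LieAlgebra 𝕜 g]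

open LieAlgebra

/-- The multilinear map `(v₁, …, vⱼ) ↦ [v₁, [v₂, … [vⱼ, ξ] … ]]`. -/
def adChain (𝕜 : Type*) [RCLike 𝕜] {g : Type*} [LieRing g] [LieAlgebra 𝕜 g] (ξ : g) (j : ℕ) :
    MultilinearMap 𝕜 (fun _ : Fin j => g) g :=
  (LinearMap.applyₗ (R := 𝕜) ξ).compMultilinearMap
    ((MultilinearMap.mkPiAlgebraFin 𝕜 j (Module.End 𝕜 g)).compLinearMap
      fun _ => (LieAlgebra.ad 𝕜 g : g →ₗ[𝕜] Module.End 𝕜 g))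

theorem adChain_apply (ξ : g) (j : ℕ) (v : Fin j → g) :
    adChain 𝕜 ξ j v = (List.ofFn fun i => (ad 𝕜 g (v i) : Module.End 𝕜 g)).prod ξ := by
  simp [adChain]

theorem adChain_const (ξ η : g) (j : ℕ) :
    adChain 𝕜 ξ j (fun _ => η) = (ad 𝕜 g η ^ j) ξ := by
  simp [adChain_apply]

theorem sum_adChain_update (ξ η ζ : g) (j : ℕ) :
    ∑ i : Fin j, adChain 𝕜 ξ j (Function.update (fun _ => η) i ζ) = dad (K := 𝕜) η j ξ ζ := by
  rw [dad, ← Fin.sum_univ_eq_sum_range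
    (fun p => (ad 𝕜 g η ^ p) ⁅ζ, (ad 𝕜 g η ^ (j - 1 - p)) ξ⁆) j]
  refine Finset.sum_congr rfl fun i _ => ?_
  have : (fun k => (ad 𝕜 g (Function.update (fun _ => η) i ζ k) : Module.End 𝕜 g)) =
      Function.update (fun _ => ad 𝕜 g η) i (ad 𝕜 g ζ) := by
    funext k
    by_cases h : k = i
    · subst h; simp
    · simp [h]
  rw [adChain_apply, this, prod_ofFn_update]
  rfl

/-- The multilinear map `(v₁, …, vⱼ₊ₘ) ↦ [v₁, [… [vⱼ, ξ] … ]] vⱼ₊₁ ⋯ vⱼ₊ₘ`. -/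
def insertAd (𝕜 : Type*) [RCLike 𝕜] {g : Type*} [LieRing g] [LieAlgebra 𝕜 g] (ξ : g) (j m : ℕ) :
    MultilinearMap 𝕜 (fun _ : Fin (j + m) => g) (SymPower 𝕜 g (m + 1)) :=
  have upl : ∀ (v : Fin (j + m) → g) (i : Fin j) (x : g),
      (fun k => Function.update v (Fin.castAdd m i) x (Fin.castAdd m k)) =
        Function.update (fun k => v (Fin.castAdd m k)) i x := fun v i x => by
    funext k
    simp [Function.update_apply]
  have upl' : ∀ (v : Fin (j + m) → g) (i : Fin j) (x : g),
      (fun k => Function.update v (Fin.castAdd m i) x (Fin.natAdd j k)) =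
        fun k => v (Fin.natAdd j k) := fun v i x => by
    funext k
    exact Function.update_of_ne (by simp [Fin.ext_iff]; omega) _ _
  have upr : ∀ (v : Fin (j + m) → g) (i : Fin m) (x : g),
      (fun k => Function.update v (Fin.natAdd j i) x (Fin.natAdd j k)) =
        Function.update (fun k => v (Fin.natAdd j k)) i x := fun v i x => by
    funext k
    simp [Function.update_apply]
  have upr' : ∀ (v : Fin (j + m) → g) (i : Fin m) (x : g),
      (fun k => Function.update v (Fin.natAdd j i) x (Fin.castAdd m k)) =
        fun k => v (Fin.castAdd m k) := fun v i x => by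
    funext k
    exact Function.update_of_ne (by simp [Fin.ext_iff]; omega) _ _
  MultilinearMap.mk' (fun v => symProdMulti 𝕜 g (m + 1)
      (Fin.cons (adChain 𝕜 ξ j fun k => v (Fin.castAdd m k)) fun k => v (Fin.natAdd j k)))
    (fun v i x y => by
      refine Fin.addCases (fun i => ?_) (fun i => ?_) i
      · simp only [upl, upl', MultilinearMap.map_update_add, MultilinearMap.cons_add]
      · simp only [upr, upr', Fin.cons_update, MultilinearMap.map_update_add])
    (fun v i c x => by
      refine Fin.addCases (fun i => ?_) (fun i => ?_) i
      · simp only [upl, upl', MultilinearMap.map_update_smul, MultilinearMap.cons_smul]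
      · simp only [upr, upr', Fin.cons_update, MultilinearMap.map_update_smul])

theorem insertAd_apply (ξ : g) (j m : ℕ) (v : Fin (j + m) → g) :
    insertAd 𝕜 ξ j m v = symProd 𝕜
      (Fin.cons (adChain 𝕜 ξ j fun k => v (Fin.castAdd m k)) fun k => v (Fin.natAdd j k)) := rfl

theorem insertAd_const (ξ η : g) (j m : ℕ) :
    insertAd 𝕜 ξ j m (fun _ => η) = symProd 𝕜 (Fin.cons ((ad 𝕜 g η ^ j) ξ) fun _ => η) := by
  rw [insertAd_apply, adChain_const]

theorem sum_insertAd_update (ξ η ζ : g) (j m : ℕ) :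
    ∑ i : Fin (j + m), insertAd 𝕜 ξ j m (Function.update (fun _ => η) i ζ) =
      symProd 𝕜 (Fin.cons (dad (K := 𝕜) η j ξ ζ) fun _ => η) +
      ∑ i : Fin m, symProd 𝕜
        (Fin.cons ((ad 𝕜 g η ^ j) ξ) (Function.update (fun _ => η) i ζ) : Fin (m + 1) → g) := by
  rw [Fin.sum_univ_add]
  congr 1
  · rw [← sum_adChain_update]
    have : ∀ z : g, symProd 𝕜 (Fin.cons z fun _ => η : Fin (m + 1) → g) =
        (symProdMulti 𝕜 g (m + 1)).toLinearMap (Fin.cons 0 fun _ => η) 0 z := fun z => by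
      simp [MultilinearMap.toLinearMap]
    rw [this, map_sum]
    refine Finset.sum_congr rfl fun i _ => ?_
    rw [← this, insertAd_apply]
    congr 2
    · congr 1
      funext k
      simp [Function.update_apply]
    · funext k
      exact Function.update_of_ne (by simp [Fin.ext_iff]; omega) _ _
  · refine Finset.sum_congr rfl fun i _ => ?_
    rw [insertAd_apply, ← adChain_const]
    congr 2
    · congr 1
      funext k
      exact Function.update_of_ne (by simp [Fin.ext_iff]; omega) _ _
    · funext k
      simp [Function.update_apply]

/-- The inclusion of the symmetric power in the symmetric algebra. -/
abbrev symIncl (𝕜 : Type*) [RCLike 𝕜] {V : Type*} [AddCommGroup V] [Module 𝕜 V] (n : ℕ) :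
    SymPower 𝕜 V n →ₗ[𝕜] SymAlg 𝕜 V :=
  DirectSum.lof 𝕜 ℕ (fun n => SymPower 𝕜 V n) n

/-- The component on `n`-fold tensors of left multiplication by `ξ`, transported to the symmetric
algebra. -/
def rhoN (𝕜 : Type*) [RCLike 𝕜] {g : Type*} [LieRing g] [LieAlgebra 𝕜 g] (ξ : g) (n : ℕ) :
    (⨂[𝕜]^n g) →ₗ[𝕜] SymAlg 𝕜 g :=
  PiTensorProduct.lift (∑ p ∈ (antidiagonal n).attach,
    ((n ! : 𝕜) * (p.1.2 ! : 𝕜)⁻¹ * bern 𝕜 p.1.1) • (symIncl 𝕜 (p.1.2 + 1)).compMultilinearMap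
      ((insertAd 𝕜 ξ p.1.1 p.1.2).domDomCongr
        (finCongr (Finset.HasAntidiagonal.mem_antidiagonal.mp p.2))))

theorem rhoN_tprod (ξ : g) (n : ℕ) (v : Fin n → g) :
    rhoN 𝕜 ξ n (PiTensorProduct.tprod 𝕜 v) = ∑ p ∈ (antidiagonal n).attach,
      ((n ! : 𝕜) * (p.1.2 ! : 𝕜)⁻¹ * bern 𝕜 p.1.1) • symIncl 𝕜 (p.1.2 + 1)
        (insertAd 𝕜 ξ p.1.1 p.1.2 fun i => v (finCongr (Finset.HasAntidiagonal.mem_antidiagonal.mp p.2) i)) := by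
  rw [rhoN, PiTensorProduct.lift.tprod, sum_apply]
  rfl

/-- Left multiplication by `ξ`, transported from the universal enveloping algebra to the
symmetric algebra. -/
def rho (𝕜 : Type*) [RCLike 𝕜] {g : Type*} [LieRing g] [LieAlgebra 𝕜 g] (ξ : g) :
    SymAlg 𝕜 g →ₗ[𝕜] SymAlg 𝕜 g :=
  DirectSum.toModule 𝕜 ℕ _ fun n => rhoN 𝕜 ξ n ∘ₗ (SymPower 𝕜 g n).subtype

theorem rho_symIncl (ξ : g) (n : ℕ) (x : SymPower 𝕜 g n) :
    rho 𝕜 ξ (symIncl 𝕜 n x) = rhoN 𝕜 ξ n x := by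
  simp [rho]

/-- The divided power `ηⁿ / n!`. -/
def divPow (𝕜 : Type*) [RCLike 𝕜] {g : Type*} [AddCommGroup g] [Module 𝕜 g] (η : g) (n : ℕ) :
    SymAlg 𝕜 g :=
  symIncl 𝕜 n (formalExp 𝕜 η n)

/-- The product `ζ ηᵐ / m!`, as a linear map in `ζ`. -/
def divPow₁ (𝕜 : Type*) [RCLike 𝕜] {g : Type*} [AddCommGroup g] [Module 𝕜 g] (η : g) (m : ℕ) :
    g →ₗ[𝕜] SymAlg 𝕜 g :=
  (m ! : 𝕜)⁻¹ • symIncl 𝕜 (m + 1) ∘ₗ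
    (symProdMulti 𝕜 g (m + 1)).toLinearMap (Fin.cons 0 fun _ => η) 0

theorem divPow₁_apply (η : g) (m : ℕ) (ζ : g) :
    divPow₁ 𝕜 η m ζ = (m ! : 𝕜)⁻¹ • symIncl 𝕜 (m + 1) (symProd 𝕜 (Fin.cons ζ fun _ => η)) := by
  simp [divPow₁, MultilinearMap.toLinearMap]

/-- The product `ζ ζ' ηᵐ / m!`. -/
def divPow₂ (𝕜 : Type*) [RCLike 𝕜] {g : Type*} [AddCommGroup g] [Module 𝕜 g] (η : g) (m : ℕ)
    (ζ ζ' : g) : SymAlg 𝕜 g :=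
  (m ! : 𝕜)⁻¹ • symIncl 𝕜 (m + 2) (symProd 𝕜 (Fin.cons ζ (Fin.cons ζ' fun _ => η)))

theorem divPow₂_comm (η : g) (m : ℕ) (ζ ζ' : g) : divPow₂ 𝕜 η m ζ ζ' = divPow₂ 𝕜 η m ζ' ζ := by
  rw [divPow₂, symProd_cons_cons_comm, divPow₂]

theorem rho_divPow (ξ η : g) (n : ℕ) :
    rho 𝕜 ξ (divPow 𝕜 η n) = ∑ p ∈ antidiagonal n,
      bern 𝕜 p.1 • divPow₁ 𝕜 η p.2 ((ad 𝕜 g η ^ p.1) ξ) := by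
  have h0 : (n ! : 𝕜) ≠ 0 := Nat.cast_ne_zero.mpr (Nat.factorial_ne_zero n)
  rw [divPow, rho_symIncl, formalExp, Submodule.coe_smul, map_smul, coe_symPow, rhoN_tprod,
    Finset.smul_sum, ← Finset.sum_attach (antidiagonal n)]
  refine Finset.sum_congr rfl fun p _ => ?_
  rw [insertAd_const, divPow₁_apply, smul_smul, smul_smul]
  congr 1
  field_simp

/-- This is the derivative of `rho_divPow` at `η` in direction `ζ`: the varied factor lies either
inside the iterated bracket, giving `dad`, or among the remaining factors, giving `divPow₂`. -/
theorem rho_divPow₁ (ξ η ζ : g) (m : ℕ) :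
    rho 𝕜 ξ (divPow₁ 𝕜 η m ζ) =
      ∑ p ∈ antidiagonal (m + 1),
        bern 𝕜 p.1 • divPow₁ 𝕜 η p.2 (dad (K := 𝕜) η p.1 ξ ζ) +
      ∑ p ∈ antidiagonal m, bern 𝕜 p.1 • divPow₂ 𝕜 η p.2 ((ad 𝕜 g η ^ p.1) ξ) ζ := by
  have h0 : ((m + 1)! : 𝕜) ≠ 0 := Nat.cast_ne_zero.mpr (Nat.factorial_ne_zero _)
  have h1 : rho 𝕜 ξ (divPow₁ 𝕜 η m ζ) = ((m + 1)! : 𝕜)⁻¹ • ∑ i : Fin (m + 1),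
      rhoN 𝕜 ξ (m + 1) (PiTensorProduct.tprod 𝕜 (Function.update (fun _ => η) i ζ)) := by
    rw [divPow₁_apply, map_smul, rho_symIncl, coe_symProd_cons_const, map_smul, map_sum, smul_smul,
      Nat.factorial_succ, Nat.cast_mul, mul_inv_rev]
  have h2 : ∀ (j k : ℕ) (h : j + k = m + 1), ∑ i : Fin (m + 1),
      insertAd 𝕜 ξ j k (fun l => Function.update (fun _ => η) i ζ (finCongr h l)) =
      symProd 𝕜 (Fin.cons (dad (K := 𝕜) η j ξ ζ) fun _ => η) +
      ∑ i : Fin k, symProd 𝕜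
        (Fin.cons ((ad 𝕜 g η ^ j) ξ) (Function.update (fun _ => η) i ζ) : Fin (k + 1) → g) := by
    intro j k h
    rw [← sum_insertAd_update]
    refine Fintype.sum_equiv (finCongr h).symm _ _ fun i => ?_
    congr 1
    funext l
    simp [Function.update_apply, Fin.ext_iff]
  rw [h1]
  simp only [rhoN_tprod]
  rw [Finset.sum_comm, Finset.smul_sum]
  have h3 : ∀ p ∈ (antidiagonal (m + 1)).attach, ((m + 1)! : 𝕜)⁻¹ • ∑ i : Fin (m + 1),
      (((m + 1)! : 𝕜) * (p.1.2 ! : 𝕜)⁻¹ * bern 𝕜 p.1.1) • symIncl 𝕜 (p.1.2 + 1)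
        (insertAd 𝕜 ξ p.1.1 p.1.2 fun l => Function.update (fun _ => η) i ζ
          (finCongr (Finset.HasAntidiagonal.mem_antidiagonal.mp p.2) l)) =
      bern 𝕜 p.1.1 • divPow₁ 𝕜 η p.1.2 (dad (K := 𝕜) η p.1.1 ξ ζ) +
      (bern 𝕜 p.1.1 * (p.1.2 ! : 𝕜)⁻¹) • ∑ i : Fin p.1.2, symIncl 𝕜 (p.1.2 + 1) (symProd 𝕜
        (Fin.cons ((ad 𝕜 g η ^ p.1.1) ξ) (Function.update (fun _ => η) i ζ))) := by
    intro p _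
    rw [← Finset.smul_sum, ← map_sum, h2, map_add, map_sum, smul_smul, smul_add, divPow₁_apply,
      smul_smul]
    congr 2 <;> field_simp
  rw [Finset.sum_congr rfl h3, Finset.sum_attach (antidiagonal (m + 1)) (fun p : ℕ × ℕ =>
      bern 𝕜 p.1 • divPow₁ 𝕜 η p.2 (dad (K := 𝕜) η p.1 ξ ζ) +
      (bern 𝕜 p.1 * (p.2 ! : 𝕜)⁻¹) • ∑ i : Fin p.2, symIncl 𝕜 (p.2 + 1) (symProd 𝕜
        (Fin.cons ((ad 𝕜 g η ^ p.1) ξ) (Function.update (fun _ => η) i ζ)))),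
    Finset.sum_add_distrib]
  congr 1
  -- When no free factor remains (`p.2 = 0`), nothing outside the bracket can be varied; dropping
  -- this term lowers the total degree from `m + 1` to `m`.
  rw [Finset.Nat.sum_antidiagonal_succ']
  simp only [Finset.univ_eq_empty, Finset.sum_empty, smul_zero, zero_add]
  refine Finset.sum_congr rfl fun p _ => ?_
  simp only [symProd_cons_update]
  have h4 : ((p.2 + 1 : ℕ) : 𝕜) ≠ 0 := Nat.cast_ne_zero.mpr (Nat.succ_ne_zero _)
  have h5 : (p.2 ! : 𝕜) ≠ 0 := Nat.cast_ne_zero.mpr (Nat.factorial_ne_zero _)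
  rw [Finset.sum_const, Finset.card_univ, Fintype.card_fin, ← Nat.cast_smul_eq_nsmul 𝕜, divPow₂,
    smul_smul, smul_smul, Nat.factorial_succ, Nat.cast_mul]
  congr 1
  field_simp

end Rho

theorem sum_antidiagonal_assoc {M : Type*} [AddCommMonoid M] (F : ℕ → ℕ → ℕ → M) (n : ℕ) :
    ∑ p ∈ antidiagonal n, ∑ q ∈ antidiagonal p.2, F p.1 q.1 q.2 =
      ∑ p ∈ antidiagonal n, ∑ q ∈ antidiagonal p.1, F q.1 q.2 p.2 := by
  rw [Finset.sum_sigma', Finset.sum_sigma']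
  refine Finset.sum_bij' (fun x _ => ⟨(x.1.1 + x.2.1, x.2.2), (x.1.1, x.2.1)⟩)
    (fun x _ => ⟨(x.2.1, x.2.2 + x.1.2), (x.2.2, x.1.2)⟩) ?_ ?_ ?_ ?_ ?_
  · rintro ⟨⟨a, b⟩, ⟨c, d⟩⟩ h
    simp only [Finset.mem_sigma, Finset.HasAntidiagonal.mem_antidiagonal, and_true] at h ⊢
    omega
  · rintro ⟨⟨a, b⟩, ⟨c, d⟩⟩ h
    simp only [Finset.mem_sigma, Finset.HasAntidiagonal.mem_antidiagonal, and_true] at h ⊢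
    omega
  · rintro ⟨⟨a, b⟩, ⟨c, d⟩⟩ h
    simp only [Finset.mem_sigma, Finset.HasAntidiagonal.mem_antidiagonal] at h ⊢
    obtain ⟨h1, rfl⟩ := h
    rfl
  · rintro ⟨⟨a, b⟩, ⟨c, d⟩⟩ h
    simp only [Finset.mem_sigma, Finset.HasAntidiagonal.mem_antidiagonal] at h ⊢
    obtain ⟨h1, rfl⟩ := h
    rfl
  · rintro ⟨⟨a, b⟩, ⟨c, d⟩⟩ h
    rfl

/-! ### The Poincaré–Birkhoff–Witt isomorphism. -/

section PBW

variable {𝕜 : Type*} [RCLike 𝕜] {g : Type*} [LieRing g] [LieAlgebra 𝕜 g]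

open LieAlgebra

theorem dad_zero (η ξ ζ : g) : dad (K := 𝕜) η 0 ξ ζ = 0 := by simp [dad]

/-- The splitting separates the terms with a single bracketed factor from those with two; the latter
are symmetric in `ξ₁` and `ξ₂` and drop out of the commutator. -/
theorem rho_rho_divPow (ξ₁ ξ₂ η : g) (n : ℕ) :
    rho 𝕜 ξ₁ (rho 𝕜 ξ₂ (divPow 𝕜 η n)) =
      ∑ p ∈ antidiagonal (n + 1), divPow₁ 𝕜 η p.2 (∑ q ∈ antidiagonal p.1,
        (bern 𝕜 q.1 * bern 𝕜 q.2) • dad (K := 𝕜) η q.2 ξ₁ ((ad 𝕜 g η ^ q.1) ξ₂)) +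
      ∑ p ∈ antidiagonal n, ∑ q ∈ antidiagonal p.1, (bern 𝕜 q.1 * bern 𝕜 q.2) •
        divPow₂ 𝕜 η p.2 ((ad 𝕜 g η ^ q.2) ξ₁) ((ad 𝕜 g η ^ q.1) ξ₂) := by
  rw [rho_divPow, map_sum]
  simp only [map_smul, rho_divPow₁, smul_add, Finset.smul_sum, smul_smul]
  rw [Finset.sum_add_distrib]
  congr 1
  · have h := Finset.Nat.sum_antidiagonal_succ' (n := n) (f := fun p => ∑ q ∈ antidiagonal p.2,
      (bern 𝕜 p.1 * bern 𝕜 q.1) • divPow₁ 𝕜 η q.2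
        (dad (K := 𝕜) η q.1 ξ₁ ((ad 𝕜 g η ^ p.1) ξ₂)))
    simp only [Finset.Nat.antidiagonal_zero, Finset.sum_singleton, dad_zero, map_zero, smul_zero,
      zero_add] at h
    rw [← h, sum_antidiagonal_assoc (fun a b c => (bern 𝕜 a * bern 𝕜 b) • divPow₁ 𝕜 η c
        (dad (K := 𝕜) η b ξ₁ ((ad 𝕜 g η ^ a) ξ₂)))]
    simp only [map_sum, map_smul]
  · exact sum_antidiagonal_assoc (fun a b c => (bern 𝕜 a * bern 𝕜 b) •
      divPow₂ 𝕜 η c ((ad 𝕜 g η ^ b) ξ₁) ((ad 𝕜 g η ^ a) ξ₂)) n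

/-- The parts with two bracketed factors cancel by symmetry, and the rest is `bern_dad_identity` in
each degree. It is stated without subtraction to match the relation defining the enveloping algebra.
-/
theorem rho_commutator_divPow (ξ₁ ξ₂ η : g) (n : ℕ) :
    rho 𝕜 ⁅ξ₁, ξ₂⁆ (divPow 𝕜 η n) + rho 𝕜 ξ₂ (rho 𝕜 ξ₁ (divPow 𝕜 η n)) =
      rho 𝕜 ξ₁ (rho 𝕜 ξ₂ (divPow 𝕜 η n)) := by
  have hsymm : ∑ p ∈ antidiagonal n, ∑ q ∈ antidiagonal p.1, (bern 𝕜 q.1 * bern 𝕜 q.2) •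
        divPow₂ 𝕜 η p.2 ((ad 𝕜 g η ^ q.2) ξ₁) ((ad 𝕜 g η ^ q.1) ξ₂) =
      ∑ p ∈ antidiagonal n, ∑ q ∈ antidiagonal p.1, (bern 𝕜 q.1 * bern 𝕜 q.2) •
        divPow₂ 𝕜 η p.2 ((ad 𝕜 g η ^ q.2) ξ₂) ((ad 𝕜 g η ^ q.1) ξ₁) := by
    refine Finset.sum_congr rfl fun p _ => ?_
    rw [← Finset.Nat.sum_antidiagonal_swap]
    refine Finset.sum_congr rfl fun q _ => ?_
    rw [divPow₂_comm, mul_comm]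
    rfl
  have hbern : ∀ k, ∑ q ∈ antidiagonal (k + 1),
      (bern 𝕜 q.1 * bern 𝕜 q.2) • dad (K := 𝕜) η q.2 ξ₁ ((ad 𝕜 g η ^ q.1) ξ₂) =
      bern 𝕜 k • (ad 𝕜 g η ^ k) ⁅ξ₁, ξ₂⁆ + ∑ q ∈ antidiagonal (k + 1),
      (bern 𝕜 q.1 * bern 𝕜 q.2) • dad (K := 𝕜) η q.2 ξ₂ ((ad 𝕜 g η ^ q.1) ξ₁) := fun k => by
    rw [← sub_eq_iff_eq_add, ← bern_dad_identity, ← Finset.sum_sub_distrib]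
    simp only [smul_sub]
  rw [rho_rho_divPow, rho_rho_divPow, hsymm, ← add_assoc]
  congr 1
  rw [Finset.Nat.sum_antidiagonal_succ, Finset.Nat.sum_antidiagonal_succ]
  simp only [hbern, map_add, Finset.sum_add_distrib, Finset.Nat.antidiagonal_zero,
    Finset.sum_singleton, dad_zero, smul_zero, map_zero, zero_add, rho_divPow, map_smul]

theorem symIncl_symPow (η : g) (n : ℕ) :
    symIncl 𝕜 n (symPow 𝕜 η n) = (n ! : 𝕜) • divPow 𝕜 η n := by
  have h0 : (n ! : 𝕜) ≠ 0 := Nat.cast_ne_zero.mpr (Nat.factorial_ne_zero n)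
  rw [divPow, formalExp, map_smul, smul_smul, mul_inv_cancel₀ h0, one_smul]

theorem symAlg_hom_ext_divPow {W : Type*} [AddCommMonoid W] [Module 𝕜 W]
    {f h : SymAlg 𝕜 g →ₗ[𝕜] W} (H : ∀ (n : ℕ) (ξ : g), f (divPow 𝕜 ξ n) = h (divPow 𝕜 ξ n)) :
    f = h := by
  refine symAlg_hom_ext fun n ξ => ?_
  have := symIncl_symPow (𝕜 := 𝕜) ξ n
  rw [this, map_smul, map_smul, H]

/-- The family `rho` as a linear map. -/
def rhoLin (𝕜 : Type*) [RCLike 𝕜] (g : Type*) [LieRing g] [LieAlgebra 𝕜 g] :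
    g →ₗ[𝕜] Module.End 𝕜 (SymAlg 𝕜 g) where
  toFun := rho 𝕜
  map_add' x y := symAlg_hom_ext_divPow fun n η => by
    simp [rho_divPow, Finset.sum_add_distrib]
  map_smul' c x := symAlg_hom_ext_divPow fun n η => by
    simp [rho_divPow, Finset.smul_sum, smul_comm c]

/-- The action of the universal enveloping algebra on the symmetric algebra that extends `rho`. -/
def envAction (𝕜 : Type*) [RCLike 𝕜] (g : Type*) [LieRing g] [LieAlgebra 𝕜 g] :
    UniversalEnvelopingAlgebra 𝕜 g →ₐ[𝕜] Module.End 𝕜 (SymAlg 𝕜 g) :=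
  RingCon.liftₐ _ (TensorAlgebra.lift 𝕜 (rhoLin 𝕜 g)) <| by
    rw [UniversalEnvelopingAlgebra.ringCon, RingCon.ringConGen_le]
    intro a b h
    obtain ⟨x, y⟩ := h
    have hι : ∀ z, (TensorAlgebra.lift 𝕜 (rhoLin 𝕜 g)).toRingHom (TensorAlgebra.ι 𝕜 z) = rho 𝕜 z :=
      fun z => TensorAlgebra.lift_ι_apply (rhoLin 𝕜 g) z
    rw [RingCon.ker_apply, map_add, map_mul, map_mul, hι, hι, hι]
    exact symAlg_hom_ext_divPow fun n η => rho_commutator_divPow x y η n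

theorem envAction_envIncl (ξ : g) : envAction 𝕜 g (envIncl 𝕜 g ξ) = rho 𝕜 ξ :=
  TensorAlgebra.lift_ι_apply (rhoLin 𝕜 g) ξ

attribute [local instance] LieRing.ofAssociativeRing in
theorem envIncl_lie (x y : g) : envIncl 𝕜 g ⁅x, y⁆ =
    envIncl 𝕜 g x * envIncl 𝕜 g y - envIncl 𝕜 g y * envIncl 𝕜 g x := by
  rw [← LieRing.of_associative_ring_bracket]
  exact LieHom.map_lie (UniversalEnvelopingAlgebra.ι 𝕜) x y

theorem envIncl_ad_pow (η ξ : g) (j : ℕ) :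
    envIncl 𝕜 g ((ad 𝕜 g η ^ j) ξ) = (adOp (K := 𝕜) (envIncl 𝕜 g η) ^ j) (envIncl 𝕜 g ξ) := by
  induction j with
  | zero => rfl
  | succ j ih =>
    rw [pow_succ', Module.End.mul_apply, pow_succ', Module.End.mul_apply, ← ih, adOp_apply,
      ← envIncl_lie]
    rfl

theorem tensorToEnveloping_tprod (n : ℕ) (v : Fin n → g) :
    tensorToEnveloping 𝕜 g n (PiTensorProduct.tprod 𝕜 v) =
      (List.ofFn fun i => envIncl 𝕜 g (v i)).prod := by
  simp [tensorToEnveloping]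

theorem quant_symIncl (n : ℕ) (x : SymPower 𝕜 g n) :
    quant 𝕜 g (symIncl 𝕜 n x) = quantN 𝕜 g n x := by
  simp [quant]

theorem quantN_symPow (η : g) (n : ℕ) : quantN 𝕜 g n (symPow 𝕜 η n) = envIncl 𝕜 g η ^ n := by
  rw [quantN, LinearMap.comp_apply, Submodule.subtype_apply, coe_symPow, tensorToEnveloping_tprod]
  simp

theorem quant_divPow (η : g) (n : ℕ) :
    quant 𝕜 g (divPow 𝕜 η n) = (n ! : 𝕜)⁻¹ • envIncl 𝕜 g η ^ n := by
  rw [divPow, quant_symIncl, formalExp, map_smul, quantN_symPow]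

/-- The symmetric product `ζ ηᵐ` averages over the `m + 1` positions of `ζ`, which combines with
`1/m!` to the factor `1/(m+1)!` in `dpow`. -/
theorem quant_divPow₁ (η ζ : g) (m : ℕ) :
    quant 𝕜 g (divPow₁ 𝕜 η m ζ) = dpow (K := 𝕜) (envIncl 𝕜 g η) m (envIncl 𝕜 g ζ) := by
  rw [divPow₁_apply, map_smul, quant_symIncl, quantN, LinearMap.comp_apply,
    Submodule.subtype_apply, coe_symProd_cons_const, map_smul, map_sum, smul_smul, dpow_apply,
    Nat.factorial_succ, Nat.cast_mul, mul_inv_rev,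
    ← Fin.sum_univ_eq_sum_range
      (fun i => envIncl 𝕜 g η ^ i * envIncl 𝕜 g ζ * envIncl 𝕜 g η ^ (m - i)) (m + 1)]
  congr 1
  refine Finset.sum_congr rfl fun i _ => ?_
  have : (fun k => envIncl 𝕜 g (Function.update (fun _ => η) i ζ k)) =
      Function.update (fun _ => envIncl 𝕜 g η) i (envIncl 𝕜 g ζ) := by
    funext k
    by_cases h : k = i
    · subst h; simp
    · simp [h]
  rw [tensorToEnveloping_tprod, this, prod_ofFn_update]
  rfl

/-- `rho` corresponds to left multiplication under quantization. -/
theorem quant_rho (ξ : g) (x : SymAlg 𝕜 g) :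
    quant 𝕜 g (rho 𝕜 ξ x) = envIncl 𝕜 g ξ * quant 𝕜 g x := by
  have : quant 𝕜 g ∘ₗ rho 𝕜 ξ = LinearMap.mulLeft 𝕜 (envIncl 𝕜 g ξ) ∘ₗ quant 𝕜 g := by
    refine symAlg_hom_ext_divPow fun n η => ?_
    rw [LinearMap.comp_apply, LinearMap.comp_apply, LinearMap.mulLeft_apply, rho_divPow,
      quant_divPow, mul_smul_comm, mul_pow_eq_sum_dpow, map_sum]
    refine Finset.sum_congr rfl fun p _ => ?_
    rw [map_smul, quant_divPow₁, envIncl_ad_pow]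
  exact LinearMap.congr_fun this x

/-- Since `[ξ, ξ] = 0`, only the term `j = 0` of the Bernoulli sum survives. -/
theorem rho_self_divPow (ξ : g) (n : ℕ) :
    rho 𝕜 ξ (divPow 𝕜 ξ n) = ((n + 1 : ℕ) : 𝕜) • divPow 𝕜 ξ (n + 1) := by
  rw [rho_divPow]
  have h : ∀ j, (ad 𝕜 g ξ ^ (j + 1)) ξ = 0 := fun j => by
    rw [pow_succ, Module.End.mul_apply, ad_apply, lie_self, map_zero]
  cases n with
  | zero =>
    have h0 : bern 𝕜 0 = 1 := by
      simp [bern, bernoulliPowerSeries]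
    rw [Finset.Nat.antidiagonal_zero, Finset.sum_singleton, h0, one_smul, divPow₁_apply]
    have : (Fin.cons ξ fun _ => ξ : Fin 1 → g) = fun _ => ξ := by
      funext k
      refine Fin.cases rfl (fun k => rfl) k
    simp only [Nat.factorial_zero, Nat.cast_one, inv_one, one_smul, divPow, formalExp, symPow,
      zero_add, Nat.factorial_one]
    rw [← this]
    rfl
  | succ n =>
    have h0 : bern 𝕜 0 = 1 := by
      simp [bern, bernoulliPowerSeries]
    rw [Finset.Nat.sum_antidiagonal_succ]
    simp only [h, map_zero, smul_zero, Finset.sum_const_zero, add_zero, h0, one_smul, pow_zero]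
    rw [Module.End.one_apply, divPow₁_apply]
    have : (Fin.cons ξ fun _ => ξ : Fin (n + 1 + 1) → g) = fun _ => ξ := by
      funext k
      refine Fin.cases rfl (fun k => rfl) k
    have h1 : ((n + 1 + 1 : ℕ) : 𝕜) ≠ 0 := Nat.cast_ne_zero.mpr (Nat.succ_ne_zero _)
    rw [this, divPow, formalExp, map_smul, smul_smul, Nat.factorial_succ (n + 1), Nat.cast_mul,
      mul_inv_rev, mul_comm, mul_assoc, inv_mul_cancel₀ h1, mul_one]
    rfl

theorem rho_pow_one (ξ : g) (n : ℕ) :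
    (rho 𝕜 ξ ^ n : Module.End 𝕜 (SymAlg 𝕜 g)) (divPow 𝕜 0 0) = (n ! : 𝕜) • divPow 𝕜 ξ n := by
  induction n with
  | zero =>
    simp only [pow_zero, Module.End.one_apply, Nat.factorial_zero, Nat.cast_one, one_smul, divPow,
      formalExp, symPow]
    congr 3
    funext k
    exact k.elim0
  | succ n ih =>
    rw [pow_succ', Module.End.mul_apply, ih, map_smul, rho_self_divPow, smul_smul,
      Nat.factorial_succ, Nat.cast_mul, mul_comm]

/-- The inverse of the quantization map: apply an element of the enveloping algebra to `1`. -/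
def dequant (𝕜 : Type*) [RCLike 𝕜] (g : Type*) [LieRing g] [LieAlgebra 𝕜 g] :
    UniversalEnvelopingAlgebra 𝕜 g →ₗ[𝕜] SymAlg 𝕜 g :=
  LinearMap.applyₗ (R := 𝕜) (M := SymAlg 𝕜 g) (M₂ := SymAlg 𝕜 g) (divPow 𝕜 0 0) ∘ₗ (envAction 𝕜 g).toLinearMap

/-- On divided powers this says that applying `rho ξ` repeatedly to `1` produces the powers of `ξ`.
It is the injectivity half of the theorem. -/
theorem dequant_quant (x : SymAlg 𝕜 g) : dequant 𝕜 g (quant 𝕜 g x) = x := by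
  have h : dequant 𝕜 g ∘ₗ quant 𝕜 g = LinearMap.id := by
    refine symAlg_hom_ext_divPow fun n η => ?_
    have h0 : (n ! : 𝕜) ≠ 0 := Nat.cast_ne_zero.mpr (Nat.factorial_ne_zero n)
    rw [LinearMap.comp_apply, quant_divPow, map_smul, dequant, LinearMap.comp_apply,
      AlgHom.toLinearMap_apply, map_pow, envAction_envIncl, LinearMap.applyₗ_apply_apply,
      rho_pow_one, smul_smul, inv_mul_cancel₀ h0, one_smul, LinearMap.id_apply]
  exact LinearMap.congr_fun h x

theorem quant_one : quant 𝕜 g (divPow 𝕜 0 0) = 1 := by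
  rw [quant_divPow]; simp

/-- The intertwining relation for generators, `quant_rho`, extends to products and sums. Taking `x =
1` gives surjectivity. -/
theorem quant_envAction (u : UniversalEnvelopingAlgebra 𝕜 g) (x : SymAlg 𝕜 g) :
    quant 𝕜 g (envAction 𝕜 g u x) = u * quant 𝕜 g x := by
  obtain ⟨t, rfl⟩ := RingCon.mkₐ_surjective (α := 𝕜) (UniversalEnvelopingAlgebra.ringCon 𝕜 g) u
  change quant 𝕜 g (envAction 𝕜 g (UniversalEnvelopingAlgebra.mkAlgHom 𝕜 g t) x) =
    UniversalEnvelopingAlgebra.mkAlgHom 𝕜 g t * quant 𝕜 g x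
  induction t using TensorAlgebra.induction generalizing x with
  | algebraMap r => rw [AlgHom.commutes, AlgHom.commutes, Module.algebraMap_end_apply, map_smul,
      Algebra.smul_def]
  | ι ξ =>
    have := envAction_envIncl (𝕜 := 𝕜) ξ
    change quant 𝕜 g (envAction 𝕜 g (envIncl 𝕜 g ξ) x) = envIncl 𝕜 g ξ * quant 𝕜 g x
    rw [this, quant_rho]
  | mul a b ha hb => rw [map_mul, map_mul, Module.End.mul_apply, ha, hb, mul_assoc]
  | add a b ha hb => rw [map_add, map_add, LinearMap.add_apply, map_add, ha, hb, add_mul]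

theorem quant_dequant (u : UniversalEnvelopingAlgebra 𝕜 g) : quant 𝕜 g (dequant 𝕜 g u) = u := by
  have := quant_envAction (𝕜 := 𝕜) u (divPow 𝕜 0 0)
  rw [quant_one, mul_one] at this
  exact this

/-- The Poincaré-Birkhoff-Witt theorem for the symmetrization map. -/
theorem quant_bijective : Function.Bijective (quant 𝕜 g) :=
  Function.bijective_iff_has_inverse.mpr ⟨dequant 𝕜 g, dequant_quant, quant_dequant⟩

theorem quant_quantInv (u : UniversalEnvelopingAlgebra 𝕜 g) :
    quant 𝕜 g (quantInv 𝕜 g u) = u := by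
  rw [quantInv, dif_pos quant_bijective]
  exact LinearEquiv.apply_symm_apply (LinearEquiv.ofBijective _ quant_bijective) u

theorem quantInv_quant (x : SymAlg 𝕜 g) : quantInv 𝕜 g (quant 𝕜 g x) = x :=
  quant_bijective.1 (quant_quantInv _)

theorem quantInv_envIncl_mul (ξ : g) (u : UniversalEnvelopingAlgebra 𝕜 g) :
    quantInv 𝕜 g (envIncl 𝕜 g ξ * u) = rho 𝕜 ξ (quantInv 𝕜 g u) :=
  quant_bijective.1 (by rw [quant_quantInv, quant_rho, quant_quantInv])

end PBW

/-! ### The logarithmic series and the Bernoulli series. -/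

section LogSeries

open PowerSeries

variable (K : Type*) [Field K] [CharZero K]

/-- The truncated logarithm of `exp X` is compared with `X` by differentiating: a geometric sum
leaves the derivative `-(1 - exp X)ᴹ`, which is divisible by `Xᴹ`. -/
theorem X_pow_dvd_logSeries_sub_X (M : ℕ) :
    (X : K⟦X⟧) ^ (M + 1) ∣
      (∑ k ∈ Finset.range M, ((-1 : K) ^ k / (k + 1)) • (exp K - 1) ^ k) * (exp K - 1) - X := by
  have hdvd : (X : K⟦X⟧) ∣ exp K - 1 := by
    rw [X_dvd_iff]
    simp
  have hd : derivative K ((∑ k ∈ Finset.range M, ((-1 : K) ^ k / (k + 1)) • (exp K - 1) ^ k) *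
      (exp K - 1) - X) = - (1 - exp K) ^ M := by
    have h1 := geom_sum_mul_neg (1 - exp K) M
    rw [sub_sub_cancel] at h1
    rw [map_sub, derivative_X, sub_eq_iff_eq_add', ← sub_eq_add_neg, ← h1, Finset.sum_mul, map_sum,
      Finset.sum_mul]
    refine Finset.sum_congr rfl fun k _ => ?_
    have hk : (k : K) + 1 ≠ 0 := Nat.cast_add_one_ne_zero k
    rw [smul_mul_assoc, ← pow_succ, Derivation.map_smul, Derivation.leibniz_pow, map_sub,
      derivative_exp, Derivation.map_one_eq_zero, sub_zero, Nat.add_sub_cancel,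
      ← Nat.cast_smul_eq_nsmul K, smul_smul, smul_eq_mul, ← neg_sub (exp K) 1, neg_pow (exp K - 1),
      Nat.cast_add, Nat.cast_one, div_mul_cancel₀ _ hk, smul_eq_C_mul]
    rw [map_pow, map_neg, map_one]
    ring
  rw [X_pow_dvd_iff]
  intro m hm
  cases m with
  | zero => simp
  | succ m =>
    have h2 := congrArg (coeff m) hd
    rw [coeff_derivative] at h2
    have h3 : (X : K⟦X⟧) ^ M ∣ - (1 - exp K) ^ M := by
      rw [dvd_neg]
      refine pow_dvd_pow_of_dvd ?_ M
      rw [← neg_sub, dvd_neg]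
      exact hdvd
    rw [X_pow_dvd_iff.mp h3 m (by omega)] at h2
    exact (mul_eq_zero.mp h2).resolve_right (Nat.cast_add_one_ne_zero m)

variable {K} in
theorem X_pow_dvd_of_mul_exp_sub_one {M : ℕ} {D : K⟦X⟧}
    (h : (X : K⟦X⟧) ^ (M + 1) ∣ D * (exp K - 1)) : (X : K⟦X⟧) ^ M ∣ D := by
  obtain ⟨w, hw⟩ : (X : K⟦X⟧) ∣ exp K - 1 := by
    rw [X_dvd_iff]
    simp
  have hw0 : IsUnit w := by
    have h1 := congrArg (coeff 1) hw
    rw [show (1 : ℕ) = 0 + 1 from rfl, coeff_succ_X_mul, map_sub, coeff_exp, coeff_one,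
      if_neg (by norm_num), coeff_zero_eq_constantCoeff_apply] at h1
    rw [isUnit_iff_constantCoeff, ← h1]
    simp
  rw [hw, mul_comm X w, ← mul_assoc, pow_succ] at h
  have h2 := (mul_dvd_mul_iff_right X_ne_zero).mp h
  rwa [hw0.dvd_mul_right] at h2

/-- Multiplied by `exp X - 1`, both series agree with `X` modulo `X^(M+1)`; cancelling this factor,
a unit times `X`, costs one order. -/
theorem coeff_logSeries (M i : ℕ) (hi : i < M) :
    coeff i (∑ k ∈ Finset.range M, ((-1 : K) ^ k / (k + 1)) • (exp K - 1) ^ k) =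
      coeff i (bernoulliPowerSeries K) := by
  have h := X_pow_dvd_logSeries_sub_X K M
  generalize ∑ k ∈ Finset.range M, ((-1 : K) ^ k / (k + 1)) • (exp K - 1) ^ k = S at h ⊢
  have hX : S * (exp K - 1) - X = (S - bernoulliPowerSeries K) * (exp K - 1) := by
    rw [sub_mul, bernoulliPowerSeries_mul_exp_sub_one]
  rw [hX] at h
  have h3 := X_pow_dvd_iff.mp (X_pow_dvd_of_mul_exp_sub_one h) i hi
  rwa [map_sub, sub_eq_zero] at h3

end LogSeries

/-! ### Power series evaluated at nilpotent elements. -/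

section NilpotentEval

variable {K : Type*} [Field K] {A : Type*} [Ring A] [Algebra K A]

/-- Evaluation of a power series, truncated below degree `M`. -/
def pev (M : ℕ) (u : A) (f : PowerSeries K) : A :=
  Polynomial.aeval u (PowerSeries.trunc M f)

theorem pev_eq_sum (M : ℕ) (u : A) (f : PowerSeries K) :
    pev M u f = ∑ i ∈ Finset.range M, PowerSeries.coeff i f • u ^ i := by
  rw [pev, Polynomial.aeval_def, PowerSeries.eval₂_trunc_eq_sum_range]
  simp only [Algebra.smul_def]

theorem pev_congr {M : ℕ} (u : A) {f h : PowerSeries K}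
    (H : ∀ i < M, PowerSeries.coeff i f = PowerSeries.coeff i h) : pev M u f = pev M u h := by
  rw [pev_eq_sum, pev_eq_sum]
  exact Finset.sum_congr rfl fun i hi => by rw [H i (Finset.mem_range.mp hi)]

theorem pev_of_le {M N : ℕ} (hMN : M ≤ N) {u : A} (hu : u ^ M = 0) (f : PowerSeries K) :
    pev N u f = pev M u f := by
  rw [pev_eq_sum, pev_eq_sum]
  refine (Finset.sum_subset (Finset.range_subset_range.mpr hMN) fun i _ hi => ?_).symm
  rw [pow_eq_zero_of_le (by simpa using hi) hu, smul_zero]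

theorem aeval_trunc {M : ℕ} {u : A} (hu : u ^ M = 0) (p : Polynomial K) :
    Polynomial.aeval u (PowerSeries.trunc M (p : PowerSeries K)) = Polynomial.aeval u p := by
  change pev M u (p : PowerSeries K) = _
  rw [← pev_of_le (le_max_left M (p.natDegree + 1)) hu, pev_eq_sum,
    Polynomial.aeval_eq_sum_range' (lt_of_lt_of_le (Nat.lt_succ_self _)
      (le_max_right M (p.natDegree + 1)))]
  simp only [Polynomial.coeff_coe]

theorem pev_mul {M : ℕ} {u : A} (hu : u ^ M = 0) (f h : PowerSeries K) :
    pev M u (f * h) = pev M u f * pev M u h := by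
  rw [pev, ← PowerSeries.trunc_trunc_mul_trunc, ← Polynomial.coe_mul, aeval_trunc hu, map_mul]
  rfl

theorem pev_sub (M : ℕ) (u : A) (f h : PowerSeries K) :
    pev M u (f - h) = pev M u f - pev M u h := by
  simp [pev]

theorem pev_smul (M : ℕ) (u : A) (c : K) (f : PowerSeries K) :
    pev M u (c • f) = c • pev M u f := by
  simp [pev_eq_sum, Finset.smul_sum, smul_smul]

theorem pev_sum {ι : Type*} (M : ℕ) (u : A) (s : Finset ι) (f : ι → PowerSeries K) :
    pev M u (∑ i ∈ s, f i) = ∑ i ∈ s, pev M u (f i) := by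
  simp [pev]

theorem pev_one {M : ℕ} {u : A} (hu : u ^ M = 0) : pev M u (1 : PowerSeries K) = 1 := by
  rw [pev, ← Polynomial.coe_one, aeval_trunc hu, map_one]

theorem pev_X {M : ℕ} {u : A} (hu : u ^ M = 0) : pev M u (PowerSeries.X : PowerSeries K) = u := by
  rw [pev, ← Polynomial.coe_X, aeval_trunc hu, Polynomial.aeval_X]

theorem pev_pow {M : ℕ} {u : A} (hu : u ^ M = 0) (f : PowerSeries K) (k : ℕ) :
    pev M u (f ^ k) = pev M u f ^ k := by
  induction k with
  | zero => rw [pow_zero, pow_zero, pev_one hu]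
  | succ k ih => rw [pow_succ, pow_succ, pev_mul hu, ih]

variable [CharZero K]

/-- The exponential series truncated below degree `M`. -/
def nexp (K : Type*) [Field K] [CharZero K] {A : Type*} [Ring A] [Algebra K A] (M : ℕ) (u : A) : A :=
  pev M u (PowerSeries.exp K)

theorem nexp_eq_sum (M : ℕ) (u : A) :
    nexp K M u = ∑ i ∈ Finset.range M, (i ! : K)⁻¹ • u ^ i := by
  rw [nexp, pev_eq_sum]
  simp [PowerSeries.coeff_exp]

theorem sum_range_sum_antidiagonal {V : Type*} [AddCommMonoid V] (M : ℕ) (f : ℕ → ℕ → V)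
    (hf : ∀ i j, M ≤ i + j → f i j = 0) :
    ∑ n ∈ Finset.range M, ∑ p ∈ antidiagonal n, f p.1 p.2 =
      ∑ i ∈ Finset.range M, ∑ j ∈ Finset.range M, f i j := by
  rw [Finset.sum_sigma', ← Finset.sum_product']
  refine Finset.sum_bij_ne_zero (fun x _ _ => x.2) ?_ ?_ ?_ ?_
  · rintro ⟨n, i, j⟩ h _
    simp only [Finset.mem_sigma, Finset.mem_range, Finset.HasAntidiagonal.mem_antidiagonal,
      Finset.mem_product] at h ⊢
    omega
  · rintro ⟨n, i, j⟩ h _ ⟨n', i', j'⟩ h' _ e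
    simp only [Finset.mem_sigma, Finset.mem_range, Finset.HasAntidiagonal.mem_antidiagonal,
      Prod.mk.injEq] at h h' e
    obtain ⟨_, rfl⟩ := h
    obtain ⟨_, rfl⟩ := h'
    obtain ⟨rfl, rfl⟩ := e
    rfl
  · rintro ⟨i, j⟩ _ hne
    refine ⟨⟨i + j, (i, j)⟩, ?_, hne, rfl⟩
    simp only [Finset.mem_sigma, Finset.mem_range, Finset.HasAntidiagonal.mem_antidiagonal,
      and_true]
    by_contra h
    exact hne (hf i j (not_lt.mp h))
  · rintro ⟨n, i, j⟩ _ _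
    rfl

theorem nexp_add {M : ℕ} {u v : A} (huv : Commute u v) (hu : u ^ M = 0) (hv : v ^ M = 0)
    (hs : (u + v) ^ M = 0) : nexp K M (u + v) = nexp K M u * nexp K M v := by
  -- Passing to truncation order `2 * M` makes the surplus terms vanish: if `i + j ≥ 2 * M`, then `i
  -- ≥ M` or `j ≥ M`.
  have h2 : M ≤ 2 * M := by omega
  have e := fun z hz => pev_of_le (A := A) (u := z) h2 hz (PowerSeries.exp K)
  change pev M _ _ = pev M _ _ * pev M _ _
  rw [← e _ hs, ← e _ hu, ← e _ hv]
  change nexp K (2 * M) _ = nexp K (2 * M) _ * nexp K (2 * M) _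
  simp only [nexp_eq_sum]
  rw [Finset.sum_mul_sum, ← sum_range_sum_antidiagonal]
  · refine Finset.sum_congr rfl fun n _ => ?_
    rw [huv.add_pow', Finset.smul_sum]
    refine Finset.sum_congr rfl fun p hp => ?_
    have hn : p.1 + p.2 = n := Finset.HasAntidiagonal.mem_antidiagonal.mp hp
    rw [smul_mul_smul_comm, ← Nat.cast_smul_eq_nsmul K, smul_smul]
    congr 1
    subst hn
    have h0 : ((p.1 + p.2)! : K) ≠ 0 := Nat.cast_ne_zero.mpr (Nat.factorial_ne_zero _)
    have h1 : (p.1 ! : K) ≠ 0 := Nat.cast_ne_zero.mpr (Nat.factorial_ne_zero _)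
    have h3 : (p.2 ! : K) ≠ 0 := Nat.cast_ne_zero.mpr (Nat.factorial_ne_zero _)
    have h4 := Nat.add_choose_mul_factorial_mul_factorial p.1 p.2
    rw [← Nat.choose_symm_add] at h4
    rw [← h4] at h0 ⊢
    push_cast at h0 ⊢
    have h5 := left_ne_zero_of_mul (left_ne_zero_of_mul h0)
    field_simp
  · intro i j hij
    by_cases hi : M ≤ i
    · rw [pow_eq_zero_of_le hi hu, smul_zero, zero_mul]
    · rw [pow_eq_zero_of_le (by omega : M ≤ j) hv, smul_zero, mul_zero]

/-- This rewrites `u / (exp u - 1)` as a series in `exp u - 1`. The differential equation of the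
logarithm thereby involves only `exp (ad z)`, which is known once `exp z` is. -/
theorem pev_bernoulli {M : ℕ} {u : A} (hu : u ^ M = 0) :
    ∑ j ∈ Finset.range M, bern K j • u ^ j =
      ∑ k ∈ Finset.range M, ((-1 : K) ^ k / (k + 1)) • (nexp K M u - 1) ^ k := by
  have h := pev_congr (M := M) u fun i hi => coeff_logSeries K M i hi
  rw [pev_eq_sum M u (bernoulliPowerSeries K), pev_sum] at h
  simp only [pev_smul, pev_pow hu, pev_sub, pev_one hu] at h
  exact h.symm

end NilpotentEval

end GuttStar

set_option linter.unusedSectionVars false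

namespace GuttStar

open Finset.HasAntidiagonal (antidiagonal)

/-! ### The differential equation of the logarithm of a product of exponentials. -/

section NilpotentBCH

variable {K : Type*} [Field K] [CharZero K] {A : Type*} [Ring A] [Algebra K A] {M : ℕ}

theorem nexp_zero (hM : (0 : A) ^ M = 0) : nexp K M (0 : A) = 1 := by
  rw [nexp_eq_sum]
  cases M with
  | zero => simpa using hM.symm
  | succ M => simp [Finset.sum_range_succ']

theorem neg_pow_eq_zero {z : A} (hz : z ^ M = 0) : (-z) ^ M = 0 := by
  rw [neg_pow, hz, mul_zero]

theorem nexp_mul_nexp_neg {z : A} (hz : z ^ M = 0) : nexp K M z * nexp K M (-z) = 1 := by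
  have h0 : (0 : A) ^ M = 0 := by
    cases M with
    | zero => simpa using hz
    | succ M => simp
  rw [← nexp_add (Commute.neg_right rfl) hz (neg_pow_eq_zero hz) (by rwa [add_neg_cancel]),
    add_neg_cancel, nexp_zero h0]

theorem nexp_neg_mul_nexp {z : A} (hz : z ^ M = 0) : nexp K M (-z) * nexp K M z = 1 := by
  have := nexp_mul_nexp_neg (K := K) (neg_pow_eq_zero hz)
  rwa [neg_neg] at this

theorem nexp_mulLeft (z : A) :
    nexp K M (LinearMap.mulLeft K z : Module.End K A) = LinearMap.mulLeft K (nexp K M z) := by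
  refine LinearMap.ext fun w => ?_
  simp [nexp_eq_sum, LinearMap.sum_apply, Finset.sum_mul, LinearMap.pow_mulLeft]

theorem nexp_mulRight (z : A) :
    nexp K M (LinearMap.mulRight K z : Module.End K A) = LinearMap.mulRight K (nexp K M z) := by
  refine LinearMap.ext fun w => ?_
  simp [nexp_eq_sum, LinearMap.sum_apply, Finset.mul_sum, LinearMap.pow_mulRight]

/-- The commutator operator is the sum of the commuting nilpotent operators of left multiplication
by `z` and right multiplication by `-z`. -/
theorem nexp_adOp_apply {z : A} (hz : z ^ M = 0) (had : (adOp (K := K) z : Module.End K A) ^ M = 0)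
    (w : A) :
    nexp K M (adOp (K := K) z : Module.End K A) w = nexp K M z * w * nexp K M (-z) := by
  have hR : (LinearMap.mulRight K (-z) : Module.End K A) = - LinearMap.mulRight K z := by
    refine LinearMap.ext fun w => ?_
    simp
  have hsum : (adOp (K := K) z : Module.End K A) =
      LinearMap.mulLeft K z + LinearMap.mulRight K (-z) := by
    rw [hR, ← sub_eq_add_neg]
    rfl
  have hl : (LinearMap.mulLeft K z : Module.End K A) ^ M = 0 := by
    rw [LinearMap.pow_mulLeft, hz]
    simp
  have hr : (LinearMap.mulRight K (-z) : Module.End K A) ^ M = 0 := by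
    rw [LinearMap.pow_mulRight, neg_pow_eq_zero hz]
    simp
  rw [hsum, nexp_add (LinearMap.commute_mulLeft_right (R := K) z (-z)) hl hr (by rwa [← hsum]),
    nexp_mulLeft, nexp_mulRight, Module.End.mul_apply, LinearMap.mulLeft_apply,
    LinearMap.mulRight_apply, mul_assoc]

/-- The differential of the truncated exponential at `z` in the direction `w`. -/
def dexp (K : Type*) [Field K] {A : Type*} [Ring A] [Algebra K A] (M : ℕ) (z : A) : A →ₗ[K] A :=
  ∑ m ∈ Finset.range M, dpow (K := K) z m

theorem dexp_apply (z w : A) : dexp K M z w = ∑ m ∈ Finset.range M, dpow (K := K) z m w := by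
  rw [dexp, LinearMap.sum_apply]

theorem commute_mulLeft_adOp {s : A} (hs : ∀ a, Commute s a) (z : A) :
    Commute (LinearMap.mulLeft K s : Module.End K A) (adOp (K := K) z) := by
  refine LinearMap.ext fun w => ?_
  change s * (z * w - w * z) = z * (s * w) - s * w * z
  rw [mul_sub, (hs z).left_comm, mul_assoc]

theorem commute_mulLeft_dpow {s : A} (hs : ∀ a, Commute s a) (z : A) (m : ℕ) :
    Commute (LinearMap.mulLeft K s : Module.End K A) (dpow (K := K) z m) := by
  refine LinearMap.ext fun w => ?_
  change s * dpow z m w = dpow z m (s * w)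
  rw [dpow_apply, dpow_apply, mul_smul_comm, Finset.mul_sum]
  congr 1
  refine Finset.sum_congr rfl fun i _ => ?_
  rw [mul_assoc, mul_assoc, mul_assoc, (hs (z ^ i)).left_comm]

theorem commute_pow_of_forall {t : A} (ht : ∀ a, Commute t a) (n : ℕ) (a : A) :
    Commute (t ^ n) a := (ht a).pow_left n

theorem commute_mulLeft_nexp_adOp {s : A} (hs : ∀ a, Commute s a) (z : A) :
    Commute (LinearMap.mulLeft K s : Module.End K A)
      (nexp K M (adOp (K := K) z : Module.End K A)) := by
  rw [nexp_eq_sum]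
  exact Commute.sum_right _ _ _ fun i _ => ((commute_mulLeft_adOp hs z).pow_right i).smul_right _

theorem adOp_mul_pow {t : A} (ht : ∀ a, Commute t a) (a : A) (n : ℕ) (w : A) :
    (adOp (K := K) (t * a) ^ n) w = t ^ n * (adOp (K := K) a ^ n) w := by
  induction n with
  | zero => simp
  | succ n ih =>
    have hc := commute_mulLeft_adOp (K := K) (commute_pow_of_forall ht n) a
    have hc' := LinearMap.congr_fun hc.eq ((adOp (K := K) a ^ n) w)
    have had : ∀ v, adOp (K := K) (t * a) v = t * adOp (K := K) a v := fun v => by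
      rw [adOp_apply, adOp_apply, mul_sub, mul_assoc, (ht v).left_comm]
    rw [pow_succ', Module.End.mul_apply, ih, pow_succ' (adOp a), Module.End.mul_apply, had,
      pow_succ', mul_assoc]
    congr 1
    exact hc'.symm

theorem adOp_pow_eq_zero {t : A} (ht : ∀ a, Commute t a) (htM : t ^ M = 0) (a : A) :
    (adOp (K := K) (t * a) : Module.End K A) ^ M = 0 :=
  LinearMap.ext fun w => by rw [adOp_mul_pow ht, htM, zero_mul]; rfl

theorem central_mul_pow_eq_zero {t : A} (ht : ∀ a, Commute t a) (htM : t ^ M = 0) (a : A) :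
    (t * a) ^ M = 0 := by
  rw [(ht a).mul_pow, htM, zero_mul]

theorem dpow_central_mul {t : A} (ht : ∀ a, Commute t a) (a : A) (m : ℕ) (w : A) :
    dpow (K := K) (t * a) m w = t ^ m * dpow (K := K) a m w := by
  rw [dpow_apply, dpow_apply, mul_smul_comm, Finset.mul_sum]
  congr 1
  refine Finset.sum_congr rfl fun i hi => ?_
  have h : t ^ m = t ^ i * t ^ (m - i) := by
    rw [← pow_add]
    congr 1
    simp only [Finset.mem_range] at hi
    omega
  rw [(ht a).mul_pow, (ht a).mul_pow, h, mul_assoc, mul_assoc, mul_assoc, mul_assoc,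
    (commute_pow_of_forall ht (m - i) (a ^ i)).left_comm,
    (commute_pow_of_forall ht (m - i) w).left_comm]

/-- Summation of `mul_pow_eq_sum_dpow` over `n`: the Bernoulli series of `ad z` inverts the
differential of `exp` up to right multiplication by `exp z`. The square and triangular index ranges
differ by terms with a factor `t^(i+j) = 0`. -/
theorem mul_nexp_eq_dexp {t : A} (ht : ∀ a, Commute t a) (htM : t ^ M = 0) (a w : A) :
    w * nexp K M (t * a) = dexp K M (t * a)
      ((∑ j ∈ Finset.range M, bern K j • (adOp (K := K) (t * a) : Module.End K A) ^ j) w) := by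
  rw [dexp_apply, nexp_eq_sum, Finset.mul_sum]
  simp only [mul_smul_comm, mul_pow_eq_sum_dpow, LinearMap.sum_apply, LinearMap.smul_apply,
    map_sum, map_smul]
  rw [sum_range_sum_antidiagonal M
    (fun i j => bern K i • dpow (K := K) (t * a) j ((adOp (K := K) (t * a) ^ i) w)),
    Finset.sum_comm]
  intro i j hij
  have hc := LinearMap.congr_fun
    (commute_mulLeft_dpow (K := K) (commute_pow_of_forall ht i) a j).eq ((adOp (K := K) a ^ i) w)
  change t ^ i * dpow a j _ = dpow a j (t ^ i * _) at hc
  rw [dpow_central_mul ht, adOp_mul_pow ht, ← hc, ← mul_assoc, ← pow_add,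
    pow_eq_zero_of_le (by omega) htM, zero_mul, smul_zero]

section Derivation

variable {t : A} {θ : A →ₗ[K] A}

theorem derivation_pow (hθ : ∀ a b, θ (a * b) = θ a * b + a * θ b) (z : A) (n : ℕ) :
    θ (z ^ n) = ∑ i ∈ Finset.range n, z ^ i * θ z * z ^ (n - 1 - i) := by
  induction n with
  | zero =>
    have := hθ 1 1
    simpa using this
  | succ n ih =>
    rw [pow_succ', hθ, ih, Finset.sum_range_succ', add_comm, Finset.mul_sum]
    congr 1
    · refine Finset.sum_congr rfl fun i _ => ?_
      rw [show n + 1 - 1 - (i + 1) = n - 1 - i by omega, pow_succ']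
      simp only [mul_assoc]
    · simp

theorem derivation_nexp (hθ : ∀ a b, θ (a * b) = θ a * b + a * θ b) (ht : ∀ a, Commute t a)
    (htM : t ^ M = 0) (hθt : θ t = t) (a : A) :
    θ (nexp K M (t * a)) = dexp K M (t * a) (θ (t * a)) := by
  cases M with
  | zero =>
    simp [dexp_apply, nexp_eq_sum]
  | succ M =>
    -- `dexp` has one summand more than the derivative of the truncated exponential; it carries `tᴹ`
    -- from `dpow` and one further `t` from its argument.
    have hlast : dpow (K := K) (t * a) M (θ (t * a)) = 0 := by
      have hc := LinearMap.congr_fun (commute_mulLeft_dpow (K := K) ht a M).eq (a + θ a)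
      change t * dpow a M _ = dpow a M (t * _) at hc
      rw [dpow_central_mul ht, hθ, hθt, ← mul_add, ← hc, ← mul_assoc, ← pow_succ, htM, zero_mul]
    have h1 : θ 1 = 0 := by
      have := hθ 1 1
      simpa using this
    rw [nexp_eq_sum, dexp_apply, Finset.sum_range_succ', Finset.sum_range_succ, hlast, map_add,
      map_sum, pow_zero, map_smul, h1, smul_zero]
    congr 1
    refine Finset.sum_congr rfl fun m _ => ?_
    rw [map_smul, derivation_pow hθ, dpow_apply]
    rfl

theorem derivation_nexp_of_self (hθ : ∀ a b, θ (a * b) = θ a * b + a * θ b)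
    (ht : ∀ a, Commute t a) (htM : t ^ M = 0) (hθt : θ t = t) (a : A) (ha : θ (t * a) = t * a) :
    θ (nexp K M (t * a)) = t * a * nexp K M (t * a) := by
  rw [derivation_nexp hθ ht htM hθt, ha, mul_nexp_eq_dexp ht htM]
  congr 1
  cases M with
  | zero =>
    have h1 : (1 : A) = 0 := by simpa using htM
    rw [← mul_one (t * a), h1]
    simp
  | succ M =>
    have h0 : bern K 0 = 1 := by simp [bern, bernoulliPowerSeries]
    have h2 : ∀ j, ((adOp (K := K) (t * a) : Module.End K A) ^ (j + 1)) (t * a) = 0 := fun j => by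
      rw [pow_succ, Module.End.mul_apply, adOp_apply, sub_self, map_zero]
    simp only [LinearMap.sum_apply, LinearMap.smul_apply]
    rw [Finset.sum_range_succ', h0, Finset.sum_eq_zero fun j _ => by rw [h2, smul_zero]]
    simp

theorem commute_mul_sub_one_pow {R : Type*} [Ring R] {l x y : R} (hx : Commute l x)
    (hy : Commute l y) (k : ℕ) : Commute l ((x * y - 1) ^ k) :=
  ((hx.mul_right hy).sub_right (Commute.one_right l)).pow_right k

/-- The operator `u` preserves the multiples of `s`, so agreement there propagates to all powers. -/
theorem sub_one_pow_apply_eq {u v : Module.End K A} {s : A} (huv : ∀ w, u (s * w) = v (s * w))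
    (hsu : ∀ w, u (s * w) = s * u w) (k : ℕ) (w : A) :
    ((u - 1) ^ k : Module.End K A) (s * w) = ((v - 1) ^ k : Module.End K A) (s * w) := by
  induction k generalizing w with
  | zero => rfl
  | succ k ihk =>
    have h1 : (u - 1) (s * w) = s * (u w - w) := by
      rw [LinearMap.sub_apply, hsu, Module.End.one_apply, mul_sub]
    have h2 : (v - 1) (s * w) = s * (u w - w) := by
      rw [← h1, LinearMap.sub_apply, LinearMap.sub_apply, huv]
    rw [pow_succ, pow_succ, Module.End.mul_apply, Module.End.mul_apply, h1, h2, ihk]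

/-- A truncated Baker-Campbell-Hausdorff theorem: the solution of the differential equation of
the logarithm of `exp x exp y` exponentiates to `exp x exp y`. -/
theorem nexp_eq_nexp_mul_nexp (hθ : ∀ a b, θ (a * b) = θ a * b + a * θ b)
    (ht : ∀ a, Commute t a) (htM : t ^ M = 0) (hθt : θ t = t)
    (hker : ∀ n δ, t ^ n * θ (t * δ) = 0 → t ^ n * (t * δ) = 0)
    (a b c : A) (ha : θ (t * a) = t * a) (hb : θ (t * b) = t * b)
    (hc : θ (t * c) = ∑ k ∈ Finset.range M, ((-1 : K) ^ k / (k + 1)) •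
      ((nexp K M (adOp (K := K) (t * a) : Module.End K A) *
        nexp K M (adOp (K := K) (t * b) : Module.End K A) - 1) ^ k)
      (t * a + nexp K M (adOp (K := K) (t * a) : Module.End K A) (t * b))) :
    nexp K M (t * c) = nexp K M (t * a) * nexp K M (t * b) := by
  have hz := fun d => central_mul_pow_eq_zero ht htM d
  have had := fun d => adOp_pow_eq_zero (K := K) ht htM d
  set v : Module.End K A := nexp K M (adOp (K := K) (t * a) : Module.End K A) *
        nexp K M (adOp (K := K) (t * b) : Module.End K A) with hv
  set u : Module.End K A := nexp K M (adOp (K := K) (t * c) : Module.End K A) with hu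
  set E : A := nexp K M (t * a) * nexp K M (t * b) with hE
  set F : A := nexp K M (t * c) with hF
  set E' : A := nexp K M (-(t * b)) * nexp K M (-(t * a)) with hE'
  set F' : A := nexp K M (-(t * c)) with hF'
  have hEE' : E * E' = 1 := by
    rw [hE, hE', mul_assoc, ← mul_assoc (nexp K M (t * b)), nexp_mul_nexp_neg (hz b), one_mul,
      nexp_mul_nexp_neg (hz a)]
  have hF'F : F' * F = 1 := nexp_neg_mul_nexp (hz c)
  have hvw : ∀ w, v w = E * w * E' := fun w => by
    rw [hv, Module.End.mul_apply, nexp_adOp_apply (hz a) (had a), nexp_adOp_apply (hz b) (had b),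
      hE, hE']
    simp only [mul_assoc]
  have huw : ∀ w, u w = F * w * F' := fun w => nexp_adOp_apply (hz c) (had c) w
  set w₀ : A := a + nexp K M (t * a) * b * nexp K M (-(t * a)) with hw₀
  have hw : t * a + nexp K M (adOp (K := K) (t * a) : Module.End K A) (t * b) = t * w₀ := by
    rw [nexp_adOp_apply (hz a) (had a), hw₀, mul_add, (ht _).symm.left_comm, mul_assoc]
  have hθE : θ E = t * w₀ * E := by
    rw [hE, hθ, derivation_nexp_of_self hθ ht htM hθt a ha,
      derivation_nexp_of_self hθ ht htM hθt b hb, hw₀, mul_add, add_mul, ← mul_assoc]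
    have h := nexp_neg_mul_nexp (K := K) (hz a)
    congr 1
    · simp only [mul_assoc]
    · have h' : nexp K M (-(t * a)) * (nexp K M (t * a) * nexp K M (t * b)) = nexp K M (t * b) := by
        rw [← mul_assoc, h, one_mul]
      simp only [mul_assoc, h']
      exact (ht _).symm.left_comm _
  have hex : ∀ d, ∃ e, nexp K M (t * d) = 1 + t * e := by
    intro d
    obtain ⟨h, hh⟩ : (PowerSeries.X : PowerSeries K) ∣ PowerSeries.exp K - 1 := by
      rw [PowerSeries.X_dvd_iff]
      simp
    refine ⟨d * pev M (t * d) h, ?_⟩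
    have := congrArg (pev M (t * d)) hh
    rw [pev_sub, pev_mul (hz d), pev_one (hz d), pev_X (hz d), sub_eq_iff_eq_add'] at this
    rw [nexp, this, mul_assoc]
  obtain ⟨δ, hδ⟩ : ∃ δ, F - E = t * δ := by
    obtain ⟨e₁, h₁⟩ := hex a
    obtain ⟨e₂, h₂⟩ := hex b
    obtain ⟨e₃, h₃⟩ := hex c
    refine ⟨e₃ - e₁ - e₂ - e₁ * (t * e₂), ?_⟩
    rw [hF, hE, h₁, h₂, h₃]
    noncomm_ring
  -- The power of `t` that annihilates the error is lowered one step at a time; at `n = M` nothing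
  -- is left of it.
  have key : ∀ n ≤ M, t ^ (M - n) * (F - E) = 0 := by
    intro n
    induction n with
    | zero => intro _; rw [Nat.sub_zero, htM, zero_mul]
    | succ n ih =>
      intro hn
      set s : A := t ^ (M - (n + 1)) with hs
      have hst : s * t = t ^ (M - n) := by
        rw [hs, ← pow_succ]
        congr 1
        omega
      have hsc : ∀ a, Commute (s * t) a := fun a => by
        rw [hst]
        exact commute_pow_of_forall ht _ a
      have hFE : s * t * F = s * t * E := by
        have := ih (by omega)
        rwa [← hst, mul_sub, sub_eq_zero] at this
      have hFE' : s * t * F' = s * t * E' := by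
        calc s * t * F' = F' * (s * t * E) * E' := by
              rw [mul_assoc F', mul_assoc (s * t), hEE', mul_one, (hsc F').eq]
          _ = F' * F * (s * t) * E' := by rw [← hFE, (hsc F).eq, mul_assoc F' F]
          _ = s * t * E' := by rw [hF'F, one_mul]
      -- `u` and `v` are conjugation by `F` and by `E`. Since `s * t` is central and does not
      -- distinguish `F` from `E`, the two agree on multiples of `s * t`, which is exactly what the
      -- differential equation needs.
      have huv : ∀ w, u (s * t * w) = v (s * t * w) := fun w => by
        rw [huw, hvw]
        calc F * (s * t * w) * F' = s * t * F * w * F' := by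
              rw [← mul_assoc, ← (hsc F).eq]
          _ = E * (w * (s * t * F')) := by
              rw [hFE, (hsc E).eq, mul_assoc E, mul_assoc E, (hsc w).eq, mul_assoc w]
          _ = E * (s * t * w) * E' := by
              rw [hFE', (hsc w).eq, mul_assoc E, mul_assoc w]
      have hst_u : ∀ w, u (s * t * w) = s * t * u w := fun w =>
        (LinearMap.congr_fun (commute_mulLeft_nexp_adOp (K := K) (M := M) hsc (t * c)).eq w).symm
      have hpow := sub_one_pow_apply_eq huv hst_u
      have hss : ∀ a, Commute s a := commute_pow_of_forall ht _
      have hsv : ∀ k, Commute (LinearMap.mulLeft K s : Module.End K A) ((v - 1) ^ k) :=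
        commute_mul_sub_one_pow (commute_mulLeft_nexp_adOp hss _)
          (commute_mulLeft_nexp_adOp hss _)
      have hsθ : s * θ (t * c) = (∑ j ∈ Finset.range M,
          bern K j • (adOp (K := K) (t * c) : Module.End K A) ^ j) (s * t * w₀) := by
        rw [pev_bernoulli (had c), hc, hw, Finset.mul_sum, LinearMap.sum_apply]
        refine Finset.sum_congr rfl fun k _ => ?_
        rw [mul_smul_comm, LinearMap.smul_apply, hpow, mul_assoc]
        have h := LinearMap.congr_fun (hsv k).eq (t * w₀)
        rw [Module.End.mul_apply, Module.End.mul_apply, LinearMap.mulLeft_apply,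
          LinearMap.mulLeft_apply] at h
        rw [h]
      have hdexp : ∀ w, s * dexp K M (t * c) w = dexp K M (t * c) (s * w) := fun w => by
        rw [dexp_apply, dexp_apply, Finset.mul_sum]
        exact Finset.sum_congr rfl fun m _ =>
          LinearMap.congr_fun (commute_mulLeft_dpow (K := K) hss (t * c) m).eq w
      -- After multiplication by `s`, both `F` and `E` satisfy the same linear equation with
      -- coefficient `t * w₀`. The factor `t` there means that the agreement known so far suffices.
      have hfin : s * θ (t * δ) = 0 := by
        rw [← hδ, map_sub, mul_sub, hF, derivation_nexp hθ ht htM hθt, hdexp, hsθ,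
          ← mul_nexp_eq_dexp ht htM, ← hF, hθE, sub_eq_zero]
        calc s * t * w₀ * F = w₀ * (s * t * F) := by rw [(hsc w₀).eq, mul_assoc]
          _ = s * (t * w₀ * E) := by rw [hFE, ← mul_assoc, ← (hsc w₀).eq]; simp only [mul_assoc]
      rw [hδ]
      exact hker _ δ hfin
  have := key M le_rfl
  rw [Nat.sub_self, pow_zero, one_mul, sub_eq_zero] at this
  exact this

end Derivation

end NilpotentBCH

/-! ### Truncated power series with the Euler derivation. -/

section TruncatedSeries

/-- Congruence of power series modulo `X ^ M`. -/
def truncCon (U : Type*) [Ring U] (M : ℕ) : RingCon (PowerSeries U) where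
  r f g := ∀ n < M, PowerSeries.coeff n f = PowerSeries.coeff n g
  iseqv := ⟨fun _ _ _ => rfl, fun h n hn => (h n hn).symm, fun h h' n hn =>
    (h n hn).trans (h' n hn)⟩
  mul' := by
    intro f f' g g' hf hg n hn
    rw [PowerSeries.coeff_mul, PowerSeries.coeff_mul]
    refine Finset.sum_congr rfl fun p hp => ?_
    have h := Finset.HasAntidiagonal.mem_antidiagonal.mp hp
    rw [hf _ (by omega), hg _ (by omega)]
  add' := by
    intro f f' g g' hf hg n hn
    rw [map_add, map_add, hf n hn, hg n hn]

/-- The ring `U[t] / (t ^ M)` of truncated power series. -/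
def TruncSeries (U : Type*) [Ring U] (M : ℕ) : Type _ := (truncCon U M).Quotient

namespace TruncSeries

instance (U : Type*) [Ring U] (M : ℕ) : Ring (TruncSeries U M) :=
  inferInstanceAs (Ring (truncCon U M).Quotient)

instance (K U : Type*) [Field K] [Ring U] [Algebra K U] (M : ℕ) : Algebra K (TruncSeries U M) :=
  inferInstanceAs (Algebra K (truncCon U M).Quotient)

variable (K : Type*) [Field K] {U : Type*} [Ring U] [Algebra K U] (M : ℕ)

/-- The reduction modulo `X ^ M`. -/
def red : PowerSeries U →ₐ[K] TruncSeries U M where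
  __ := (truncCon U M).mk'
  commutes' _ := rfl

variable {M} in
theorem red_eq_iff {f g : PowerSeries U} :
    red K M f = red K M g ↔ ∀ n < M, PowerSeries.coeff n f = PowerSeries.coeff n g :=
  (truncCon U M).eq

variable {K M} in
theorem red_surjective : Function.Surjective (red K M (U := U)) :=
  fun a => (truncCon U M).mk'_surjective a

/-- The variable `t`. -/
def var (U : Type*) [Ring U] (M : ℕ) : TruncSeries U M := (truncCon U M).mk' PowerSeries.X

/-- The inclusion of the coefficients. -/
def const : U →ₐ[K] TruncSeries U M :=
  (red K M).comp (AlgHom.mk (PowerSeries.C) (fun _ => PowerSeries.algebraMap_apply.symm))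

theorem red_X : red K M (PowerSeries.X : PowerSeries U) = var U M := rfl

theorem red_C (u : U) : red K M (PowerSeries.C u) = const K M u := rfl

/-- The `n`-th coefficient of a truncated series. -/
def tcoeff (n : Fin M) : TruncSeries U M →ₗ[K] U where
  toFun a := Quotient.liftOn' a (fun f => PowerSeries.coeff n f) fun _ _ h => h n n.2
  map_add' a b := by
    obtain ⟨f, rfl⟩ := red_surjective (K := K) a
    obtain ⟨g, rfl⟩ := red_surjective (K := K) b
    exact map_add (PowerSeries.coeff (n : ℕ)) f g
  map_smul' c a := by
    obtain ⟨f, rfl⟩ := red_surjective (K := K) a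
    rfl

theorem tcoeff_red (n : Fin M) (f : PowerSeries U) :
    tcoeff K M n (red K M f) = PowerSeries.coeff n f := rfl

theorem ext_tcoeff {a b : TruncSeries U M} (h : ∀ n, tcoeff K M n a = tcoeff K M n b) : a = b := by
  obtain ⟨f, rfl⟩ := red_surjective (K := K) a
  obtain ⟨g, rfl⟩ := red_surjective (K := K) b
  exact (red_eq_iff K).2 fun n hn => h ⟨n, hn⟩

/-- The Euler derivation `t d/dt` of power series. -/
def eulerSeries (f : PowerSeries U) : PowerSeries U :=
  PowerSeries.mk fun n => (n : K) • PowerSeries.coeff n f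

/-- The Euler derivation `t d/dt` of truncated series. -/
def euler : TruncSeries U M →ₗ[K] TruncSeries U M where
  toFun a := Quotient.liftOn' a (fun f => red K M (eulerSeries K f)) fun f g h =>
    (red_eq_iff K).2 fun n hn => by
      rw [eulerSeries, eulerSeries, PowerSeries.coeff_mk, PowerSeries.coeff_mk, h n hn]
  map_add' a b := by
    obtain ⟨f, rfl⟩ := red_surjective (K := K) a
    obtain ⟨g, rfl⟩ := red_surjective (K := K) b
    change red K M (eulerSeries K (f + g)) = red K M (eulerSeries K f) + red K M (eulerSeries K g)
    rw [← map_add]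
    congr 1
    ext n
    simp only [eulerSeries, map_add, PowerSeries.coeff_mk, smul_add]
  map_smul' c a := by
    obtain ⟨f, rfl⟩ := red_surjective (K := K) a
    change red K M (eulerSeries K (c • f)) = c • red K M (eulerSeries K f)
    rw [← map_smul]
    congr 1
    ext n
    simp only [eulerSeries, PowerSeries.coeff_mk, PowerSeries.coeff_smul, smul_comm c]

theorem euler_red (f : PowerSeries U) : euler K M (red K M f) = red K M (eulerSeries K f) := rfl

theorem tcoeff_euler (n : Fin M) (a : TruncSeries U M) :
    tcoeff K M n (euler K M a) = (n : K) • tcoeff K M n a := by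
  obtain ⟨f, rfl⟩ := red_surjective (K := K) a
  rw [euler_red, tcoeff_red, eulerSeries, PowerSeries.coeff_mk, tcoeff_red]

theorem euler_mul (a b : TruncSeries U M) :
    euler K M (a * b) = euler K M a * b + a * euler K M b := by
  obtain ⟨f, rfl⟩ := red_surjective (K := K) a
  obtain ⟨g, rfl⟩ := red_surjective (K := K) b
  rw [euler_red, euler_red, ← map_mul, euler_red, ← map_mul, ← map_mul, ← map_add]
  congr 1
  ext n
  rw [map_add, PowerSeries.coeff_mul, PowerSeries.coeff_mul, ← Finset.sum_add_distrib, eulerSeries,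
    eulerSeries, eulerSeries, PowerSeries.coeff_mk, PowerSeries.coeff_mul, Finset.smul_sum]
  refine Finset.sum_congr rfl fun p hp => ?_
  rw [PowerSeries.coeff_mk, PowerSeries.coeff_mk, smul_mul_assoc, mul_smul_comm, ← add_smul,
    ← Nat.cast_add, Finset.HasAntidiagonal.mem_antidiagonal.mp hp]

variable {M} in
theorem commute_var (a : TruncSeries U M) : Commute (var U M) a := by
  obtain ⟨f, rfl⟩ := (truncCon U M).mk'_surjective a
  exact (PowerSeries.commute_X f).symm.map (truncCon U M).mk'

theorem tcoeff_var_pow_mul (k : ℕ) (n : Fin M) (f : PowerSeries U) :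
    tcoeff K M n (var U M ^ k * red K M f) =
      if k ≤ n then PowerSeries.coeff (n - k) f else 0 := by
  rw [← red_X K, ← map_pow, ← map_mul, tcoeff_red, PowerSeries.coeff_X_pow_mul']

theorem tcoeff_var_pow_mul_const (k : ℕ) (n : Fin M) (u : U) :
    tcoeff K M n (var U M ^ k * const K M u) = if k = n then u else 0 := by
  rw [← red_C, tcoeff_var_pow_mul, PowerSeries.coeff_C]
  split_ifs with h1 h2 h3 h3 h3 <;> first | rfl | omega

theorem var_pow_eq_zero : var U M ^ M = 0 := by
  have h : (truncCon U M).mk' (PowerSeries.X ^ M) = (truncCon U M).mk' 0 :=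
    (truncCon U M).eq.2 fun n hn => by rw [PowerSeries.coeff_X_pow, if_neg hn.ne, map_zero]
  exact (map_pow (truncCon U M).mk' _ _).symm.trans (h.trans (map_zero _))

theorem euler_var_pow_mul_const (k : ℕ) (u : U) :
    euler K M (var U M ^ k * const K M u) = (k : K) • (var U M ^ k * const K M u) := by
  refine ext_tcoeff K M fun n => ?_
  rw [tcoeff_euler, map_smul, tcoeff_var_pow_mul_const]
  split_ifs with h
  · rw [h]
  · simp

/-- The Euler derivation multiplies the coefficient of `tʲ` by `j`, so in characteristic zero it
loses only constant terms, and a multiple of `t` has none. This gives uniqueness for the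
differential equation. -/
theorem var_pow_mul_eq_zero_of_euler [CharZero K] (n : ℕ) (d : TruncSeries U M)
    (h : var U M ^ n * euler K M (var U M * d) = 0) : var U M ^ n * (var U M * d) = 0 := by
  obtain ⟨f, rfl⟩ := red_surjective (K := K) d
  refine ext_tcoeff K M fun m => ?_
  have h' := congrArg (tcoeff K M m) h
  rw [← red_X K, ← map_mul, red_X K] at h' ⊢
  rw [euler_red, tcoeff_var_pow_mul, map_zero] at h'
  rw [tcoeff_var_pow_mul, map_zero]
  split_ifs with hn
  · rw [if_pos hn, eulerSeries, PowerSeries.coeff_mk] at h'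
    rcases Nat.eq_zero_or_pos ((m : ℕ) - n) with h0 | h0
    · rw [h0, PowerSeries.coeff_zero_X_mul]
    · exact (smul_eq_zero_iff_right (Nat.cast_ne_zero.2 h0.ne')).1 h'
  · rfl

end TruncSeries

end TruncatedSeries

/-! ### Dynkin's series solves the differential equation. -/

section BCHSeries

variable {𝕜 : Type*} [RCLike 𝕜] {g : Type*} [LieRing g] [LieAlgebra 𝕜 g]

local notation "𝒰" => UniversalEnvelopingAlgebra 𝕜 g

/-- The nested bracket of a word, placed in the degree given by the length of the word. -/
def wordSeries (𝕜 : Type*) [RCLike 𝕜] {g : Type*} [LieRing g] [LieAlgebra 𝕜 g] (M : ℕ)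
    (w : List g) : TruncSeries (UniversalEnvelopingAlgebra 𝕜 g) M :=
  TruncSeries.var _ M ^ w.length * TruncSeries.const 𝕜 M (envIncl 𝕜 g (nestedBracket w))

/-- The monomial `t ξ`. -/
def letterSeries (𝕜 : Type*) [RCLike 𝕜] {g : Type*} [LieRing g] [LieAlgebra 𝕜 g] (M : ℕ)
    (ξ : g) : TruncSeries (UniversalEnvelopingAlgebra 𝕜 g) M :=
  TruncSeries.var _ M * TruncSeries.const 𝕜 M (envIncl 𝕜 g ξ)

variable {M : ℕ}

theorem wordSeries_nil : wordSeries 𝕜 M ([] : List g) = 0 := by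
  simp [wordSeries, nestedBracket]

theorem wordSeries_singleton (ξ : g) : wordSeries 𝕜 M [ξ] = letterSeries 𝕜 M ξ := by
  simp [wordSeries, letterSeries, nestedBracket]

theorem adOp_wordSeries (ξ : g) {w : List g} (hw : w ≠ []) :
    adOp (K := 𝕜) (letterSeries 𝕜 M ξ) (wordSeries 𝕜 M w) = wordSeries 𝕜 M (ξ :: w) := by
  obtain ⟨y, w, rfl⟩ := List.exists_cons_of_ne_nil hw
  rw [adOp_apply, wordSeries, wordSeries, letterSeries, nestedBracket, envIncl_lie, map_sub,
    map_mul, map_mul, mul_sub]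
  have h := TruncSeries.commute_var (M := M) (U := 𝒰)
  rw [← (((h (TruncSeries.const 𝕜 M (envIncl 𝕜 g ξ))).pow_left (y :: w).length).mul_mul_mul_comm
    (TruncSeries.var _ M)), (h _).symm.mul_mul_mul_comm, List.length_cons (a := ξ),
    ← pow_succ', ← pow_succ]

theorem adOp_pow_wordSeries (ξ : g) (r : ℕ) {w : List g} (hw : w ≠ []) :
    (adOp (K := 𝕜) (letterSeries 𝕜 M ξ) ^ r) (wordSeries 𝕜 M w) =
      wordSeries 𝕜 M (List.replicate r ξ ++ w) := by
  induction r with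
  | zero => rfl
  | succ r ih =>
    rw [pow_succ', Module.End.mul_apply, ih, adOp_wordSeries ξ (by simp [hw]),
      List.replicate_succ, List.cons_append]

theorem wordSeries_replicate (η : g) (s : ℕ) :
    wordSeries 𝕜 M (List.replicate (s + 2) η) = 0 := by
  induction s with
  | zero => simp [wordSeries, nestedBracket]
  | succ s ih =>
    rw [List.replicate_succ, ← adOp_wordSeries η (by simp), ih, map_zero]

/-- The weight `1 / (r! s!)`. -/
def bchWeight (𝕜 : Type*) [RCLike 𝕜] (p : ℕ × ℕ) : 𝕜 := ((p.1 ! * p.2 ! : 𝕜))⁻¹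

/-- The exponents that occur in the Baker-Campbell-Hausdorff series up to degree `M`. -/
def bchIndex (M : ℕ) : Finset (ℕ × ℕ) :=
  (Finset.range M ×ˢ Finset.range M).filter fun p => 1 ≤ p.1 + p.2

theorem sum_bchIndex {V : Type*} [AddCommMonoid V] (f : ℕ × ℕ → V) :
    ∑ p ∈ Finset.range (M + 1), ∑ q ∈ Finset.range (M + 1), f (p, q) =
      f (0, 0) + ∑ p ∈ bchIndex (M + 1), f p := by
  rw [← Finset.sum_product', bchIndex,
    ← Finset.sum_filter_not_add_sum_filter _ (fun p : ℕ × ℕ => 1 ≤ p.1 + p.2)]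
  congr 1
  rw [Finset.sum_eq_single_of_mem (0, 0) (by simp)]
  rintro ⟨p, q⟩ hp h0
  simp only [Finset.mem_filter] at hp
  refine absurd ?_ h0
  ext <;> simp <;> omega

theorem nexp_mul_nexp_sub_one {A : Type*} [Ring A] [Algebra 𝕜 A] (x y : A) :
    nexp 𝕜 (M + 1) x * nexp 𝕜 (M + 1) y - 1 =
      ∑ p ∈ bchIndex (M + 1), bchWeight 𝕜 p • (x ^ p.1 * y ^ p.2) := by
  rw [nexp_eq_sum, nexp_eq_sum, Finset.sum_mul_sum, sub_eq_iff_eq_add']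
  have h := sum_bchIndex (M := M) fun p => bchWeight 𝕜 p • (x ^ p.1 * y ^ p.2)
  simp only [bchWeight, Nat.factorial_zero, Nat.cast_one, mul_one, inv_one, pow_zero,
    one_smul] at h
  simp only [bchWeight]
  rw [← h]
  refine Finset.sum_congr rfl fun i _ => Finset.sum_congr rfl fun j _ => ?_
  rw [smul_mul_smul_comm, mul_inv]

/-- The bracket of `ξʳ ηˢ` vanishes for `s ≥ 2`, and for `s = 0` unless `r = 1`. The case `s = 1`
gives `exp(ad tξ)(tη)` and the remaining word gives `tξ`. The order `M + 2` ensures that exponents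
`0` and `1` are below the truncation. -/
theorem letterSeries_add_nexp (ξ η : g) :
    letterSeries 𝕜 (M + 2) ξ + nexp 𝕜 (M + 2)
      (adOp (K := 𝕜) (letterSeries 𝕜 (M + 2) ξ) : Module.End 𝕜 _) (letterSeries 𝕜 (M + 2) η) =
      ∑ p ∈ bchIndex (M + 2), bchWeight 𝕜 p •
        wordSeries 𝕜 (M + 2) (List.replicate p.1 ξ ++ List.replicate p.2 η) := by
  have h := sum_bchIndex (M := M + 1) fun p => bchWeight 𝕜 p •
        wordSeries 𝕜 (M + 2) (List.replicate p.1 ξ ++ List.replicate p.2 η)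
  simp only [List.replicate_zero, List.append_nil, wordSeries_nil, smul_zero, zero_add] at h
  rw [← h, Finset.sum_comm]
  rw [Finset.sum_range_succ' _ (M + 1), Finset.sum_range_succ' _ M, Finset.sum_eq_zero, zero_add,
    add_comm (letterSeries 𝕜 (M + 2) ξ)]
  · congr 1
    · rw [nexp_eq_sum, LinearMap.sum_apply]
      refine Finset.sum_congr rfl fun i _ => ?_
      rw [LinearMap.smul_apply, ← wordSeries_singleton η, adOp_pow_wordSeries ξ i (by simp)]
      simp [bchWeight]
    · rw [Finset.sum_range_succ' _ (M + 1), Finset.sum_range_succ' _ M, Finset.sum_eq_zero]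
      · simp [bchWeight, wordSeries_nil, wordSeries_singleton]
      · intro r _
        simp only [List.replicate_zero, List.append_nil, add_assoc, one_add_one_eq_two]
        rw [wordSeries_replicate, smul_zero]
  · intro s _
    refine Finset.sum_eq_zero fun r _ => ?_
    rw [← adOp_pow_wordSeries ξ r (by simp), add_assoc, one_add_one_eq_two, wordSeries_replicate,
      map_zero, smul_zero]

theorem bchWord_cons {α : Type*} {k : ℕ} (ξ η : α) (p : ℕ × ℕ) (m : Fin k → ℕ × ℕ) :
    bchWord ξ η (Fin.cons p m : Fin (k + 1) → ℕ × ℕ) =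
      List.replicate p.1 ξ ++ (List.replicate p.2 η ++ bchWord ξ η m) := by
  simp [bchWord, List.ofFn_succ]

theorem sum_piFinset_succ {α V : Type*} [AddCommMonoid V] (P : Finset α) (k : ℕ)
    (f : (Fin (k + 1) → α) → V) :
    ∑ m ∈ Fintype.piFinset (fun _ : Fin (k + 1) => P), f m =
      ∑ p ∈ P, ∑ m ∈ Fintype.piFinset (fun _ : Fin k => P), f (Fin.cons p m) := by
  rw [← Finset.sum_product']
  refine Finset.sum_nbij' (fun m => (m 0, fun i => m i.succ)) (fun x => Fin.cons x.1 x.2)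
    ?_ ?_ ?_ ?_ ?_
  · intro m hm
    simp only [Finset.mem_product, Fintype.mem_piFinset] at hm ⊢
    exact ⟨hm _, fun i => hm _⟩
  · intro x hx
    simp only [Finset.mem_product, Fintype.mem_piFinset] at hx ⊢
    exact Fin.cases hx.1 hx.2
  · intro m _
    exact Fin.cons_self_tail m
  · intro x _
    rfl
  · intro m _
    exact congrArg f (Fin.cons_self_tail m).symm

theorem bchWord_ne_nil {α : Type*} {k : ℕ} (ξ η : α) {m : Fin (k + 1) → ℕ × ℕ}
    (hm : m ∈ Fintype.piFinset fun _ : Fin (k + 1) => bchIndex M) : bchWord ξ η m ≠ [] := by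
  intro h
  have hl := length_bchWord ξ η m
  rw [h, List.length_nil, eq_comm, Finset.sum_eq_zero_iff] at hl
  have h0 := (Finset.mem_filter.mp (Fintype.mem_piFinset.mp hm 0)).2
  have := hl 0 (Finset.mem_univ _)
  omega

/-- Each factor `exp(ad x) exp(ad y) - 1` prepends one nonempty block `ξʳ ηˢ` to the word, so `k`
factors acting on the initial block give words of `k + 1` blocks. -/
theorem nexp_sub_one_pow_apply (ξ η : g) (k : ℕ) :
    ((nexp 𝕜 (M + 2) (adOp (K := 𝕜) (letterSeries 𝕜 (M + 2) ξ) : Module.End 𝕜 _) *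
      nexp 𝕜 (M + 2) (adOp (K := 𝕜) (letterSeries 𝕜 (M + 2) η) : Module.End 𝕜 _) - 1) ^ k)
      (letterSeries 𝕜 (M + 2) ξ + nexp 𝕜 (M + 2)
      (adOp (K := 𝕜) (letterSeries 𝕜 (M + 2) ξ) : Module.End 𝕜 _) (letterSeries 𝕜 (M + 2) η)) =
    ∑ m ∈ Fintype.piFinset (fun _ : Fin (k + 1) => bchIndex (M + 2)),
      (∏ i, bchWeight 𝕜 (m i)) • wordSeries 𝕜 (M + 2) (bchWord ξ η m) := by
  induction k with
  | zero =>
    rw [pow_zero, Module.End.one_apply, letterSeries_add_nexp, sum_piFinset_succ]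
    refine Finset.sum_congr rfl fun p _ => ?_
    simp [bchWord]
  | succ k ih =>
    rw [pow_succ', Module.End.mul_apply, ih, nexp_mul_nexp_sub_one, sum_piFinset_succ _ (k + 1),
      LinearMap.sum_apply]
    refine Finset.sum_congr rfl fun p _ => ?_
    rw [map_sum]
    refine Finset.sum_congr rfl fun m hm => ?_
    have hne := bchWord_ne_nil ξ η hm
    rw [map_smul, LinearMap.smul_apply, Module.End.mul_apply, adOp_pow_wordSeries η p.2 hne,
      adOp_pow_wordSeries ξ p.1 (by simp [hne]), bchWord_cons, smul_smul, mul_comm]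
    congr 1
    exact (Fin.prod_univ_succ fun i =>
      bchWeight 𝕜 ((Fin.cons p m : Fin (k + 2) → ℕ × ℕ) i)).symm

theorem bchTerm_zero (ξ η : g) : bchTerm 𝕜 0 ξ η = 0 := by
  simp [bchTerm]

/-- The factor `n` removes Dynkin's `1/n`. The index ranges may be enlarged to depend only on `M`:
exponents are bounded by their total `n`, and more than `n` nonempty blocks cannot have total length
`n`. -/
theorem smul_bchTerm (ξ η : g) {n : ℕ} (hn : n < M) :
    (n : 𝕜) • bchTerm 𝕜 n ξ η = ∑ k ∈ Finset.range M, ((-1 : 𝕜) ^ k / (k + 1)) •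
      ∑ m ∈ Fintype.piFinset (fun _ : Fin (k + 1) => bchIndex M) with
        ∑ i, ((m i).1 + (m i).2) = n,
        (∏ i, bchWeight 𝕜 (m i)) • nestedBracket (bchWord ξ η m) := by
  have hset : ∀ k, (Fintype.piFinset (fun _ : Fin (k + 1) => bchIndex M)).filter
        (fun m => ∑ i, ((m i).1 + (m i).2) = n) =
      ((Fintype.piFinset fun _ : Fin (k + 1) =>
        Finset.range (n + 1) ×ˢ Finset.range (n + 1)).filter fun m =>
        (∀ i, 1 ≤ (m i).1 + (m i).2) ∧ ∑ i, ((m i).1 + (m i).2) = n) := by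
    intro k
    ext m
    simp only [Finset.mem_filter, Fintype.mem_piFinset, bchIndex, Finset.mem_product,
      Finset.mem_range]
    constructor
    · rintro ⟨h1, h2⟩
      refine ⟨fun i => ?_, fun i => (h1 i).2, h2⟩
      have := Finset.single_le_sum (f := fun i => (m i).1 + (m i).2) (fun _ _ => Nat.zero_le _)
        (Finset.mem_univ i)
      omega
    · rintro ⟨h1, h2, h3⟩
      exact ⟨fun i => ⟨⟨by have := (h1 i).1; omega, by have := (h1 i).2; omega⟩, h2 i⟩, h3⟩
  simp only [hset]
  have hsub : ∑ k ∈ Finset.range n, ((-1 : 𝕜) ^ k / (k + 1)) •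
      ∑ m ∈ (Fintype.piFinset fun _ : Fin (k + 1) =>
        Finset.range (n + 1) ×ˢ Finset.range (n + 1)) with
        (∀ i, 1 ≤ (m i).1 + (m i).2) ∧ ∑ i, ((m i).1 + (m i).2) = n,
        (∏ i, bchWeight 𝕜 (m i)) • nestedBracket (bchWord ξ η m) =
      ∑ k ∈ Finset.range M, ((-1 : 𝕜) ^ k / (k + 1)) •
      ∑ m ∈ (Fintype.piFinset fun _ : Fin (k + 1) =>
        Finset.range (n + 1) ×ˢ Finset.range (n + 1)) with
        (∀ i, 1 ≤ (m i).1 + (m i).2) ∧ ∑ i, ((m i).1 + (m i).2) = n,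
        (∏ i, bchWeight 𝕜 (m i)) • nestedBracket (bchWord ξ η m) := by
    refine Finset.sum_subset (by simpa using hn.le) fun k _ hk => ?_
    rw [Finset.sum_eq_zero, smul_zero]
    intro m hm
    obtain ⟨-, h1, h2⟩ := Finset.mem_filter.mp hm
    have := Finset.sum_le_sum fun i (_ : i ∈ Finset.univ) => h1 i
    simp only [Finset.sum_const, Finset.card_univ, Fintype.card_fin, smul_eq_mul, mul_one, h2,
      Finset.mem_range] at this hk
    omega
  rw [← hsub, bchTerm, Finset.smul_sum, ← Finset.Ico_succ_right_eq_Icc, Order.succ_eq_add_one,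
    Finset.sum_Ico_eq_sum_range, Nat.add_sub_cancel]
  refine Finset.sum_congr rfl fun k hk => ?_
  have hn0 : (n : 𝕜) ≠ 0 := by
    have := Finset.mem_range.mp hk
    exact Nat.cast_ne_zero.2 (by omega)
  rw [add_comm 1 k, Finset.smul_sum, Finset.smul_sum]
  refine Finset.sum_congr rfl fun m _ => ?_
  rw [smul_smul, smul_smul, Nat.add_sub_cancel, Nat.cast_succ]
  congr 1
  simp only [bchWeight, Finset.prod_inv_distrib]
  field_simp

open TruncSeries in
theorem letterSeries_sum_pow {U : Type*} [Ring U] [Algebra 𝕜 U] (s : Finset ℕ) (u : ℕ → U)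
    (r : ℕ) :
    (∑ m ∈ s, var U M ^ m * const 𝕜 M (u m)) ^ r =
      ∑ m ∈ Fintype.piFinset (fun _ : Fin r => s),
        var U M ^ (∑ i, m i) * const 𝕜 M (List.ofFn fun i => u (m i)).prod := by
  induction r with
  | zero => simp
  | succ r ih =>
    rw [pow_succ', ih, sum_piFinset_succ, Finset.sum_mul]
    refine Finset.sum_congr rfl fun p _ => ?_
    rw [Finset.mul_sum]
    refine Finset.sum_congr rfl fun m _ => ?_
    rw [(((commute_var _).pow_left _).symm).mul_mul_mul_comm, ← pow_add, ← map_mul,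
      Fin.sum_univ_succ, List.ofFn_succ, List.prod_cons]
    rfl

open TruncSeries

/-- The Baker-Campbell-Hausdorff series, divided by `t`. -/
def bchSeries (𝕜 : Type*) [RCLike 𝕜] {g : Type*} [LieRing g] [LieAlgebra 𝕜 g] (M : ℕ)
    (ξ η : g) : TruncSeries (UniversalEnvelopingAlgebra 𝕜 g) M :=
  ∑ m ∈ Finset.range M, var _ M ^ (m - 1) * const 𝕜 M (envIncl 𝕜 g (bchTerm 𝕜 m ξ η))

theorem var_mul_bchSeries (ξ η : g) : var _ M * bchSeries 𝕜 M ξ η =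
    ∑ m ∈ Finset.range M, var _ M ^ m * const 𝕜 M (envIncl 𝕜 g (bchTerm 𝕜 m ξ η)) := by
  rw [bchSeries, Finset.mul_sum]
  refine Finset.sum_congr rfl fun m _ => ?_
  cases m with
  | zero => rw [bchTerm_zero, map_zero, map_zero, mul_zero, mul_zero]
  | succ m => rw [← mul_assoc, ← pow_succ', Nat.add_sub_cancel]

theorem euler_letterSeries (ξ : g) :
    euler 𝕜 M (letterSeries 𝕜 M ξ) = letterSeries 𝕜 M ξ := by
  have := euler_var_pow_mul_const 𝕜 M 1 (envIncl 𝕜 g ξ)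
  rwa [pow_one, Nat.cast_one, one_smul] at this

theorem tcoeff_wordSeries (i : Fin M) (w : List g) : tcoeff 𝕜 M i (wordSeries 𝕜 M w) =
    if w.length = i then envIncl 𝕜 g (nestedBracket w) else 0 :=
  tcoeff_var_pow_mul_const 𝕜 M _ i _

/-- Compared coefficientwise, the left side carries the factor `n` of `smul_bchTerm`. With
`nexp_sub_one_pow_apply` this is the required differential equation. -/
theorem euler_bchSeries (ξ η : g) :
    euler 𝕜 M (var _ M * bchSeries 𝕜 M ξ η) =
      ∑ k ∈ Finset.range M, ((-1 : 𝕜) ^ k / (k + 1)) •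
        ∑ m ∈ Fintype.piFinset (fun _ : Fin (k + 1) => bchIndex M),
          (∏ i, bchWeight 𝕜 (m i)) • wordSeries 𝕜 M (bchWord ξ η m) := by
  refine ext_tcoeff 𝕜 _ fun i => ?_
  have hl : tcoeff 𝕜 M i (euler 𝕜 M (var _ M * bchSeries 𝕜 M ξ η)) =
      envIncl 𝕜 g ((i : 𝕜) • bchTerm 𝕜 i ξ η) := by
    rw [var_mul_bchSeries, tcoeff_euler, map_sum, map_smul]
    simp only [tcoeff_var_pow_mul_const]
    rw [Finset.sum_ite_eq', if_pos (Finset.mem_range.2 i.2)]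
  rw [hl, smul_bchTerm _ _ i.2, map_sum, map_sum]
  refine Finset.sum_congr rfl fun k _ => ?_
  rw [map_smul, map_smul, map_sum, map_sum, Finset.sum_filter]
  refine congrArg _ (Finset.sum_congr rfl fun m _ => ?_)
  rw [map_smul, map_smul, tcoeff_wordSeries, length_bchWord]
  split_ifs
  · rfl
  · rw [smul_zero]

/-- The Baker-Campbell-Hausdorff theorem for truncated formal power series. -/
theorem nexp_bchSeries (ξ η : g) :
    nexp 𝕜 (M + 2) (var _ (M + 2) * bchSeries 𝕜 (M + 2) ξ η) =
      nexp 𝕜 (M + 2) (letterSeries 𝕜 (M + 2) ξ) * nexp 𝕜 (M + 2) (letterSeries 𝕜 (M + 2) η) := by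
  have hx := euler_letterSeries (𝕜 := 𝕜) (M := M + 2) ξ
  have hy := euler_letterSeries (𝕜 := 𝕜) (M := M + 2) η
  have hk := nexp_sub_one_pow_apply (𝕜 := 𝕜) (M := M) ξ η
  have hode := euler_bchSeries (𝕜 := 𝕜) (M := M + 2) ξ η
  simp only [← hk] at hode
  unfold letterSeries at hx hy hode ⊢
  have hvar : euler 𝕜 (M + 2) (var 𝒰 (M + 2)) = var 𝒰 (M + 2) := by
    have := euler_var_pow_mul_const 𝕜 (M + 2) 1 (1 : 𝒰)
    rwa [pow_one, map_one, mul_one, Nat.cast_one, one_smul] at this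
  have h := nexp_eq_nexp_mul_nexp (euler_mul 𝕜 (M + 2)) commute_var
    (var_pow_eq_zero (M + 2)) hvar (var_pow_mul_eq_zero_of_euler 𝕜 (M + 2))
  exact h _ _ (bchSeries 𝕜 (M + 2) ξ η) hx hy hode

theorem letterSeries_pow_mul_pow (ξ η : g) (i j : ℕ) :
    letterSeries 𝕜 M ξ ^ i * letterSeries 𝕜 M η ^ j =
      var _ M ^ (i + j) * const 𝕜 M (envIncl 𝕜 g ξ ^ i * envIncl 𝕜 g η ^ j) := by
  rw [letterSeries, letterSeries, (commute_var _).mul_pow, (commute_var _).mul_pow,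
    ((commute_var _).symm.pow_pow _ _).mul_mul_mul_comm, ← pow_add, map_mul, map_pow, map_pow]

/-- The homogeneous components of `exp ξ exp η` in terms of the Baker-Campbell-Hausdorff
series. -/
theorem sum_antidiagonal_envIncl_pow (ξ η : g) {n : ℕ} (hn : n < M + 2) :
    ∑ p ∈ antidiagonal n, ((p.1 ! : 𝕜)⁻¹ * (p.2 ! : 𝕜)⁻¹) •
      (envIncl 𝕜 g ξ ^ p.1 * envIncl 𝕜 g η ^ p.2) =
    ∑ r ∈ Finset.range (M + 2), (r ! : 𝕜)⁻¹ •
      ∑ m ∈ Fintype.piFinset (fun _ : Fin r => Finset.range (M + 2)) with ∑ i, m i = n,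
        (List.ofFn fun i => envIncl 𝕜 g (bchTerm 𝕜 (m i) ξ η)).prod := by
  have key := congrArg (tcoeff 𝕜 (M + 2) ⟨n, hn⟩) (nexp_bchSeries (𝕜 := 𝕜) ξ η)
  rw [var_mul_bchSeries, nexp_eq_sum, nexp_eq_sum, nexp_eq_sum, Finset.sum_mul_sum] at key
  simp only [letterSeries_sum_pow, letterSeries_pow_mul_pow, map_sum, map_smul,
    smul_mul_smul_comm, tcoeff_var_pow_mul_const] at key
  simp only [Finset.sum_filter]
  rw [key]
  simp only [smul_ite, smul_zero]
  rw [← Finset.sum_product', ← Finset.sum_filter]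
  refine Finset.sum_congr ?_ fun _ _ => rfl
  ext p
  simp only [Finset.HasAntidiagonal.mem_antidiagonal, Finset.mem_filter, Finset.mem_product,
    Finset.mem_range]
  omega

end BCHSeries

/-! ### Homogeneous components of products of exponentials. -/

section BCHComponents

variable {𝕜 : Type*} [RCLike 𝕜] {g : Type*} [LieRing g] [LieAlgebra 𝕜 g]

/-- A sum over a permutation-invariant set of indices is already symmetrized, so the average over
permutations changes nothing. -/
theorem quantN_sum_symProd {r : ℕ} (S : Finset (Fin r → ℕ)) (b : ℕ → g)
    (hS : ∀ (σ : Equiv.Perm (Fin r)) (m : Fin r → ℕ), m ∈ S → (fun i => m (σ i)) ∈ S) :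
    quantN 𝕜 g r (∑ m ∈ S, symProd 𝕜 fun i => b (m i)) =
      ∑ m ∈ S, (List.ofFn fun i => envIncl 𝕜 g (b (m i))).prod := by
  have h : (r ! : 𝕜) ≠ 0 := Nat.cast_ne_zero.mpr (Nat.factorial_ne_zero r)
  rw [map_sum]
  simp only [quantN_symProd]
  rw [← Finset.smul_sum, Finset.sum_comm]
  have hσ : ∀ σ : Equiv.Perm (Fin r),
      ∑ m ∈ S, (List.ofFn fun i => envIncl 𝕜 g (b (m (σ i)))).prod =
        ∑ m ∈ S, (List.ofFn fun i => envIncl 𝕜 g (b (m i))).prod := fun σ => by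
    refine Finset.sum_nbij' (fun m i => m (σ i)) (fun m i => m (σ⁻¹ i)) (fun m hm => hS σ m hm)
      (fun m hm => hS σ⁻¹ m hm) ?_ ?_ fun m _ => rfl
    · intro m _
      funext i
      exact congrArg m (σ.apply_symm_apply i)
    · intro m _
      funext i
      exact congrArg m (σ.symm_apply_apply i)
  simp only [hσ]
  rw [Finset.sum_const, Finset.card_univ, Fintype.card_perm, Fintype.card_fin,
    ← Nat.cast_smul_eq_nsmul 𝕜, smul_smul, inv_mul_cancel₀ h, one_smul]

/-- The component in `Symʳ(g)` of the part of degree `n` of `exp ξ exp η`. -/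
def expCoeff (𝕜 : Type*) [RCLike 𝕜] {g : Type*} [LieRing g] [LieAlgebra 𝕜 g] (D : ℕ) (ξ η : g)
    (n r : ℕ) : SymPower 𝕜 g r :=
  (r ! : 𝕜)⁻¹ • ∑ m ∈ Fintype.piFinset (fun _ : Fin r => Finset.range (D + 1)) with
    ∑ i, m i = n, symProd 𝕜 fun i => bchTerm 𝕜 (m i) ξ η

theorem symProd_eq_zero {r : ℕ} {v : Fin r → g} (i : Fin r) (h : v i = 0) :
    symProd 𝕜 v = 0 := by
  rw [← symProdMulti_apply]
  exact (symProdMulti 𝕜 g r).map_coord_zero i h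

theorem expCoeff_eq_zero_of_lt {D : ℕ} (ξ η : g) {n r : ℕ} (h : n < r) :
    expCoeff 𝕜 D ξ η n r = 0 := by
  rw [expCoeff, Finset.sum_eq_zero, smul_zero]
  intro m hm
  obtain ⟨i, hi⟩ : ∃ i, m i = 0 := by
    by_contra! hne
    have := Finset.sum_le_sum fun i (_ : i ∈ Finset.univ) => Nat.one_le_iff_ne_zero.2 (hne i)
    simp only [Finset.sum_const, Finset.card_univ, Fintype.card_fin, smul_eq_mul, mul_one,
      (Finset.mem_filter.mp hm).2] at this
    omega
  exact symProd_eq_zero i (by rw [hi, bchTerm_zero])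

/-- A product of `r` terms `BCH_m` with every `m ≤ D` has total degree at most `D r`. -/
theorem expCoeff_eq_zero_of_mul_lt {D : ℕ} (ξ η : g) {n r : ℕ} (h : D * r < n) :
    expCoeff 𝕜 D ξ η n r = 0 := by
  rw [expCoeff, Finset.filter_eq_empty_iff.2, Finset.sum_empty, smul_zero]
  intro m hm hsum
  have := Finset.sum_le_sum fun i (_ : i ∈ Finset.univ) =>
    Nat.lt_succ_iff.1 (Finset.mem_range.1 (Fintype.mem_piFinset.1 hm i))
  simp only [Finset.sum_const, Finset.card_univ, Fintype.card_fin, smul_eq_mul, hsum] at this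
  rw [mul_comm] at h
  omega

theorem bchTerm_eq_zero {D : ℕ} (hD : LieModule.lowerCentralSeries 𝕜 g g D = ⊥) (ξ η : g) {m : ℕ}
    (hm : D < m) : bchTerm 𝕜 m ξ η = 0 := by
  obtain ⟨m, rfl⟩ : ∃ k, m = k + 1 := ⟨m - 1, by omega⟩
  have h := LieModule.antitone_lowerCentralSeries 𝕜 g g (show D ≤ m by omega)
    (bchTerm_mem 𝕜 m ξ η)
  rw [hD] at h
  simpa using h

/-- The exponential of the Baker–Campbell–Hausdorff series is symmetric in its factors, hence
visibly in the image of the quantization map. Nilpotency removes all indices above `D`. -/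
theorem quantInv_sum_antidiagonal {D : ℕ} (hD : LieModule.lowerCentralSeries 𝕜 g g D = ⊥)
    (ξ η : g) (n r : ℕ) :
    quantInv 𝕜 g (∑ p ∈ antidiagonal n, ((p.1 ! : 𝕜)⁻¹ * (p.2 ! : 𝕜)⁻¹) •
      (envIncl 𝕜 g ξ ^ p.1 * envIncl 𝕜 g η ^ p.2)) r = expCoeff 𝕜 D ξ η n r := by
  have hsub : ∀ r, ∑ m ∈ Fintype.piFinset (fun _ : Fin r => Finset.range (D + 1)) with
        ∑ i, m i = n, symProd 𝕜 (fun i => bchTerm 𝕜 (m i) ξ η) =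
      ∑ m ∈ Fintype.piFinset (fun _ : Fin r => Finset.range (n + D + 2)) with
        ∑ i, m i = n, symProd 𝕜 fun i => bchTerm 𝕜 (m i) ξ η := fun r => by
    refine Finset.sum_subset (fun m hm => ?_) fun m hm hm' => ?_
    · rw [Finset.mem_filter, Fintype.mem_piFinset] at hm ⊢
      refine ⟨fun i => ?_, hm.2⟩
      have := Finset.mem_range.1 (hm.1 i)
      exact Finset.mem_range.2 (by omega)
    · obtain ⟨i, hi⟩ : ∃ i, D < m i := by
        by_contra! hle
        refine hm' (Finset.mem_filter.2 ⟨Fintype.mem_piFinset.2 fun i => ?_,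
          (Finset.mem_filter.1 hm).2⟩)
        exact Finset.mem_range.2 (Nat.lt_succ_of_le (hle i))
      exact symProd_eq_zero i (bchTerm_eq_zero hD ξ η hi)
  have key : ∑ p ∈ antidiagonal n, ((p.1 ! : 𝕜)⁻¹ * (p.2 ! : 𝕜)⁻¹) •
      (envIncl 𝕜 g ξ ^ p.1 * envIncl 𝕜 g η ^ p.2) =
      quant 𝕜 g (∑ r ∈ Finset.range (n + D + 2), symIncl 𝕜 r (expCoeff 𝕜 D ξ η n r)) := by
    rw [sum_antidiagonal_envIncl_pow (M := n + D) ξ η (by omega), map_sum]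
    refine Finset.sum_congr rfl fun r _ => ?_
    rw [quant_symIncl, expCoeff, map_smul, hsub,
      quantN_sum_symProd _ fun m => bchTerm 𝕜 m ξ η]
    intro σ m hm
    rw [Finset.mem_filter, Fintype.mem_piFinset] at hm ⊢
    refine ⟨fun i => hm.1 _, ?_⟩
    rw [← hm.2]
    exact Equiv.sum_comp σ m
  rw [key, quantInv_quant, DFinsupp.finsetSum_apply]
  by_cases hr : r < n + D + 2
  · rw [Finset.sum_eq_single_of_mem r (Finset.mem_range.2 hr)]
    · exact DirectSum.of_eq_same _ _
    · intro s _ hs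
      exact DirectSum.of_eq_of_ne _ _ _ hs.symm
  · rw [expCoeff_eq_zero_of_lt ξ η (by omega), Finset.sum_eq_zero]
    intro s hs
    have := Finset.mem_range.1 hs
    exact DirectSum.of_eq_of_ne _ _ _ (by omega)

/-- In a nilpotent Lie algebra the product of `Symᵏ(g)` and `Symˡ(g)` has no components of degree
less than `(k + l) / D`. -/
theorem quantInv_mul_apply_eq_zero {D : ℕ} (hD : LieModule.lowerCentralSeries 𝕜 g g D = ⊥)
    {k l r : ℕ} (h : D * r < k + l) (x : SymPower 𝕜 g k) (y : SymPower 𝕜 g l) :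
    quantInv 𝕜 g (quantN 𝕜 g k x * quantN 𝕜 g l y) r = 0 := by
  let B : SymPower 𝕜 g k →ₗ[𝕜] SymPower 𝕜 g l →ₗ[𝕜] SymPower 𝕜 g r :=
    ((LinearMap.mul 𝕜 (UniversalEnvelopingAlgebra 𝕜 g)).compl₁₂
      (quantN 𝕜 g k) (quantN 𝕜 g l)).compr₂
      ((DirectSum.component 𝕜 ℕ (fun m => SymPower 𝕜 g m) r).comp (quantInv 𝕜 g))
  suffices hB : B = 0 from LinearMap.congr_fun (LinearMap.congr_fun hB x) y
  refine symPower_hom_ext fun ξ => symPower_hom_ext fun η => ?_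
  change quantInv 𝕜 g (quantN 𝕜 g k (symPow 𝕜 ξ k) * quantN 𝕜 g l (symPow 𝕜 η l)) r = 0
  rw [quantN_symPow, quantN_symPow]
  -- Replacing `ξ` by `a • ξ` makes the vanishing degree `k + l` part a polynomial in `a`; its
  -- coefficient at `aᵏ` isolates the product of `ξᵏ` and `ηˡ`.
  have hv := coeff_eq_zero_of_forall_sum_pow_smul_eq_zero (K := 𝕜) (k + l + 1)
    (fun i => ((i ! : 𝕜)⁻¹ * ((k + l - i) ! : 𝕜)⁻¹) •
      quantInv 𝕜 g (envIncl 𝕜 g ξ ^ i * envIncl 𝕜 g η ^ (k + l - i)) r) (fun a => ?_) k (by omega)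
  · rw [Nat.add_sub_cancel_left] at hv
    refine (smul_eq_zero_iff_right (mul_ne_zero ?_ ?_)).1 hv <;>
    exact inv_ne_zero (Nat.cast_ne_zero.2 (Nat.factorial_ne_zero _))
  · have h0 := quantInv_sum_antidiagonal hD (a • ξ) η (k + l) r
    rw [expCoeff_eq_zero_of_mul_lt _ _ h, Finset.Nat.sum_antidiagonal_eq_sum_range_succ
      (fun i j => ((i ! : 𝕜)⁻¹ * (j ! : 𝕜)⁻¹) •
        (envIncl 𝕜 g (a • ξ) ^ i * envIncl 𝕜 g η ^ j)), map_sum, DFinsupp.finsetSum_apply] at h0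
    rw [← h0]
    refine Finset.sum_congr rfl fun i _ => ?_
    rw [map_smul, map_smul, smul_pow, smul_mul_assoc, map_smul, smul_comm, DFinsupp.smul_apply,
      DFinsupp.smul_apply]

theorem nestedBracket_map_smul (z : 𝕜) (w : List g) :
    nestedBracket (w.map (z • ·)) = z ^ w.length • nestedBracket w := by
  match w with
  | [] => simp [nestedBracket]
  | [x] => simp [nestedBracket]
  | x :: y :: w =>
    have ih := nestedBracket_map_smul z (y :: w)
    rw [List.map_cons] at ih
    rw [List.map_cons, List.map_cons, nestedBracket, ih, nestedBracket, smul_lie, lie_smul,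
      smul_smul, ← pow_succ', List.length_cons (a := x)]

theorem bchTerm_smul (z : 𝕜) (n : ℕ) (ξ η : g) :
    bchTerm 𝕜 n (z • ξ) (z • η) = z ^ n • bchTerm 𝕜 n ξ η := by
  have hword : ∀ {k : ℕ} (m : Fin k → ℕ × ℕ),
      bchWord (z • ξ) (z • η) m = (bchWord ξ η m).map (z • ·) := fun m => by
    simp [bchWord, List.map_flatten, List.map_ofFn, Function.comp_def]
  rw [bchTerm, bchTerm, Finset.smul_sum]
  refine Finset.sum_congr rfl fun k _ => ?_
  rw [Finset.smul_sum]
  refine Finset.sum_congr rfl fun m hm => ?_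
  rw [hword, nestedBracket_map_smul, length_bchWord, (Finset.mem_filter.1 hm).2.2, smul_comm]

theorem bch_eq_sum {D : ℕ} (hD : LieModule.lowerCentralSeries 𝕜 g g D = ⊥) (ξ η : g) :
    bch 𝕜 ξ η = ∑ n ∈ Finset.range (D + 1), bchTerm 𝕜 n ξ η := by
  refine finsum_eq_sum_of_support_subset _ fun n hn => ?_
  by_contra h
  exact hn (bchTerm_eq_zero hD ξ η (by simpa using h))

/-- Multilinear expansion of the `r`-th power of the finite sum `BCH`, grouped by total degree;
homogeneity of each `BCH_m` supplies `zⁿ`. -/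
theorem sum_pow_smul_expCoeff {D : ℕ} (hD : LieModule.lowerCentralSeries 𝕜 g g D = ⊥) (z : 𝕜)
    (ξ η : g) (r : ℕ) :
    ∑ n ∈ Finset.range (D * r + 1), z ^ n • expCoeff 𝕜 D ξ η n r =
      formalExp 𝕜 (bch 𝕜 (z • ξ) (z • η)) r := by
  simp only [expCoeff, formalExp, symPow]
  simp only [smul_comm (z ^ _)]
  rw [← Finset.smul_sum, bch_eq_sum hD]
  congr 1
  rw [← symProdMulti_apply,
    MultilinearMap.map_sum_finset (symProdMulti 𝕜 g r) (fun _ j => bchTerm 𝕜 j (z • ξ) (z • η))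
      (fun _ => Finset.range (D + 1))]
  simp only [Finset.smul_sum]
  rw [← Finset.sum_fiberwise_of_maps_to (t := Finset.range (D * r + 1)) 
    (g := fun m : Fin r → ℕ => ∑ i, m i)]
  · refine Finset.sum_congr rfl fun n _ => Finset.sum_congr rfl fun m hm => ?_
    simp only [bchTerm_smul]
    rw [MultilinearMap.map_smul_univ, Finset.prod_pow_eq_pow_sum, (Finset.mem_filter.1 hm).2,
      symProdMulti_apply]
  · intro m hm
    have := Finset.sum_le_sum fun i (_ : i ∈ Finset.univ) =>
      Nat.lt_succ_iff.1 (Finset.mem_range.1 (Fintype.mem_piFinset.1 hm i))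
    simp only [Finset.sum_const, Finset.card_univ, Fintype.card_fin, smul_eq_mul] at this
    rw [mul_comm] at this
    exact Finset.mem_range.2 (by omega)

end BCHComponents

/-! ### Projective tensor powers of seminorms. -/

section TensorSeminorm

open scoped NNReal

variable {𝕜 : Type*} [RCLike 𝕜] {V : Type*} [AddCommGroup V] [Module 𝕜 V]

theorem tensorSeminorm_tprod_le (p : Seminorm 𝕜 V) (n : ℕ) (v : Fin n → V) :
    tensorSeminorm p n (PiTensorProduct.tprod 𝕜 v) ≤ ∏ i, p (v i) := by
  refine ciInf_le_of_le (bddBelow_repCost p n _)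
    ⟨FreeAddMonoid.of (1, v), (PiTensorProduct.mem_lifts_iff _ _).2 (by simp)⟩ (le_of_eq ?_)
  simp [repCost]

/-- The universal property of the projective tensor power of a seminorm. -/
theorem le_mul_tensorSeminorm (p : Seminorm 𝕜 V) {n : ℕ} (s : Seminorm 𝕜 (⨂[𝕜]^n V)) {C : ℝ}
    (hC : 0 ≤ C) (h : ∀ v, s (PiTensorProduct.tprod 𝕜 v) ≤ C * ∏ i, p (v i)) (x : ⨂[𝕜]^n V) :
    s x ≤ C * tensorSeminorm p n x := by
  change _ ≤ C * ⨅ r : PiTensorProduct.lifts x, repCost p n r.1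
  rw [Real.mul_iInf_of_nonneg hC]
  refine le_ciInf fun r => ?_
  have hr := (PiTensorProduct.mem_lifts_iff x r.1).1 r.2
  suffices H : ∀ l : List (𝕜 × (Fin n → V)),
      s (l.map fun a => a.1 • PiTensorProduct.tprod 𝕜 a.2).sum ≤
        C * (l.map fun a => ‖a.1‖ * ∏ i, p (a.2 i)).sum by
    have h' := H (FreeAddMonoid.toList r.1)
    rwa [hr] at h'
  intro l
  induction l with
  | nil => simp
  | cons a l ih =>
    rw [List.map_cons, List.sum_cons, List.map_cons, List.sum_cons, mul_add]
    refine (map_add_le_add s _ _).trans (add_le_add ?_ ih)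
    rw [map_smul_eq_mul, mul_left_comm]
    exact mul_le_mul_of_nonneg_left (h a.2) (norm_nonneg _)

theorem tensorSeminorm_symmetrizer_tprod_le (p : Seminorm 𝕜 V) {n : ℕ} (v : Fin n → V) :
    tensorSeminorm p n (symProd 𝕜 v : ⨂[𝕜]^n V) ≤ ∏ i, p (v i) := by
  change tensorSeminorm p n (symmetrizer 𝕜 V n (PiTensorProduct.tprod 𝕜 v)) ≤ _
  rw [symmetrizer_tprod, map_smul_eq_mul, norm_inv, RCLike.norm_natCast,
    inv_mul_le_iff₀ (by positivity)]
  refine (Finset.le_sum_of_subadditive _ (map_zero _).le (map_add_le_add _) _ _).trans ?_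
  refine (Finset.sum_le_card_nsmul _ _ (∏ i, p (v i)) fun σ _ => ?_).trans_eq ?_
  · exact (tensorSeminorm_tprod_le p n _).trans_eq (Equiv.prod_comp σ fun i => p (v i))
  · rw [Finset.card_univ, Fintype.card_perm, Fintype.card_fin, nsmul_eq_mul]

theorem tensorSeminorm_mono {p q : Seminorm 𝕜 V} (h : p ≤ q) (n : ℕ) (x : ⨂[𝕜]^n V) :
    tensorSeminorm p n x ≤ tensorSeminorm q n x := by
  have := le_mul_tensorSeminorm q (tensorSeminorm p n) zero_le_one (fun v => ?_) x
  · rwa [one_mul] at this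
  · rw [one_mul]
    exact (tensorSeminorm_tprod_le p n v).trans
      (Finset.prod_le_prod (fun _ _ => apply_nonneg p _) fun i _ => h (v i))

theorem tensorSeminorm_smul (p : Seminorm 𝕜 V) (c : ℝ≥0) (n : ℕ) (x : ⨂[𝕜]^n V) :
    tensorSeminorm (c • p) n x = (c : ℝ) ^ n * tensorSeminorm p n x := by
  have hprod : ∀ v : Fin n → V, ∏ i, (c • p) (v i) = (c : ℝ) ^ n * ∏ i, p (v i) := fun v => by
    have : ∀ i, (c • p) (v i) = (c : ℝ) * p (v i) := fun i => rfl
    simp [this, Finset.prod_mul_distrib]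
  refine le_antisymm ?_ ?_
  · refine le_mul_tensorSeminorm p _ (by positivity) (fun v => ?_) x
    rw [← hprod]
    exact tensorSeminorm_tprod_le _ n v
  · have := le_mul_tensorSeminorm (c • p) ((c ^ n) • tensorSeminorm p n) zero_le_one
      (fun v => ?_) x
    · rw [one_mul] at this
      refine le_trans (le_of_eq ?_) this
      change _ = ((c ^ n : ℝ≥0) : ℝ) * _
      push_cast
      rfl
    · rw [one_mul, hprod]
      change ((c ^ n : ℝ≥0) : ℝ) * _ ≤ _
      push_cast
      exact mul_le_mul_of_nonneg_left (tensorSeminorm_tprod_le p n v) (by positivity)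

theorem symSeminorm_apply (R : ℝ) (p : Seminorm 𝕜 V) (x : SymAlg 𝕜 V) :
    symSeminorm R p x = ∑' n : ℕ, (n ! : ℝ) ^ R * tensorSeminorm p n (x n : ⨂[𝕜]^n V) := rfl

theorem symSeminorm_symIncl (R : ℝ) (p : Seminorm 𝕜 V) (n : ℕ) (x : SymPower 𝕜 V n) :
    symSeminorm R p (symIncl 𝕜 n x) = (n ! : ℝ) ^ R * tensorSeminorm p n (x : ⨂[𝕜]^n V) := by
  rw [symSeminorm_apply, tsum_eq_single n]
  · rw [show symIncl 𝕜 n x n = x from DirectSum.of_eq_same _ _]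
  · intro m hm
    rw [show symIncl 𝕜 n x m = 0 from DirectSum.of_eq_of_ne _ _ _ hm]
    simp

theorem symSeminorm_component_le (R : ℝ) (p : Seminorm 𝕜 V) (n : ℕ) (x : SymAlg 𝕜 V) :
    (n ! : ℝ) ^ R * tensorSeminorm p n (x n : ⨂[𝕜]^n V) ≤ symSeminorm R p x :=
  (summable_symSeminorm R p x).le_tsum n fun m _ => mul_nonneg (by positivity) (apply_nonneg _ _)

theorem symSeminorm_sum_le {ι : Type*} (R : ℝ) (p : Seminorm 𝕜 V) (s : Finset ι)
    (f : ι → SymAlg 𝕜 V) : symSeminorm R p (∑ i ∈ s, f i) ≤ ∑ i ∈ s, symSeminorm R p (f i) :=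
  Finset.le_sum_of_subadditive _ (map_zero _).le (map_add_le_add _) _ _

theorem sum_symIncl_component (x : SymAlg 𝕜 V) {N : ℕ} (hx : ∀ n, N ≤ n → x n = 0) :
    ∑ n ∈ Finset.range N, symIncl 𝕜 n (x n) = x := by
  refine DFinsupp.ext fun m => ?_
  rw [DFinsupp.finsetSum_apply]
  by_cases hm : m < N
  · rw [Finset.sum_eq_single_of_mem m (Finset.mem_range.2 hm)]
    · exact DirectSum.of_eq_same _ _
    · intro s _ hs
      exact DirectSum.of_eq_of_ne _ _ _ hs.symm
  · rw [hx m (not_lt.1 hm), Finset.sum_eq_zero]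
    intro s hs
    have := Finset.mem_range.1 hs
    exact DirectSum.of_eq_of_ne _ _ _ (by omega)

theorem symSeminorm_eq_sum (R : ℝ) (p : Seminorm 𝕜 V) (x : SymAlg 𝕜 V) {N : ℕ}
    (hx : ∀ n, N ≤ n → x n = 0) :
    symSeminorm R p x = ∑ n ∈ Finset.range N, symSeminorm R p (symIncl 𝕜 n (x n)) := by
  rw [symSeminorm_apply, tsum_eq_sum (s := Finset.range N)]
  · exact Finset.sum_congr rfl fun n _ => (symSeminorm_symIncl R p n _).symm
  · intro n hn
    rw [hx n (by simpa using hn)]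
    simp

end TensorSeminorm

/-! ### Submultiplicative seminorms on a nilpotent Lie algebra. -/

section Submultiplicative

variable {𝕜 : Type*} [RCLike 𝕜] {g : Type*} [LieRing g] [LieAlgebra 𝕜 g]

/-- The seminorm induced on the quotient by a subspace, as a seminorm on the whole space. -/
def quotSeminorm {V : Type*} [AddCommGroup V] [Module 𝕜 V] (p : Seminorm 𝕜 V)
    (S : Submodule 𝕜 V) : Seminorm 𝕜 V :=
  have hb : ∀ x, BddBelow (Set.range fun u : S => p (x + u)) := fun x =>
    ⟨0, by rintro _ ⟨u, rfl⟩; exact apply_nonneg p _⟩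
  Seminorm.ofSMulLE (fun x => ⨅ u : S, p (x + u))
    (le_antisymm (ciInf_le_of_le (hb 0) 0 (by simp)) (Real.iInf_nonneg fun u => apply_nonneg p _))
    (fun x y => le_ciInf_add_ciInf fun u v => ciInf_le_of_le (hb _) (u + v) (by
      have h : x + y + ((u + v : S) : V) = (x + u) + (y + v) := by
        rw [Submodule.coe_add]
        abel
      rw [h]
      exact map_add_le_add p _ _))
    (fun c x => by
      rw [Real.mul_iInf_of_nonneg (norm_nonneg _)]
      refine le_ciInf fun u => ciInf_le_of_le (hb _) (c • u) (le_of_eq ?_)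
      rw [Submodule.coe_smul, ← smul_add, map_smul_eq_mul])

section Quot

variable {V : Type*} [AddCommGroup V] [Module 𝕜 V] (p : Seminorm 𝕜 V) (S : Submodule 𝕜 V)

theorem quotSeminorm_le_add (x : V) {u : V} (hu : u ∈ S) : quotSeminorm p S x ≤ p (x + u) :=
  ciInf_le (f := fun u : S => p (x + u)) ⟨0, by rintro _ ⟨u, rfl⟩; exact apply_nonneg p _⟩ ⟨u, hu⟩

theorem quotSeminorm_le : quotSeminorm p S ≤ p := fun x => by
  simpa using quotSeminorm_le_add p S x S.zero_mem

theorem quotSeminorm_eq_zero {x : V} (hx : x ∈ S) : quotSeminorm p S x = 0 :=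
  le_antisymm (by simpa using quotSeminorm_le_add p S x (S.neg_mem hx)) (apply_nonneg _ _)

end Quot

variable [TopologicalSpace g] [PolynormableSpace 𝕜 g]

/-- A continuous Lie bracket is bounded by products of continuous seminorms. -/
theorem exists_seminorm_lie_le (hbracket : Continuous fun a : g × g => ⁅a.1, a.2⁆)
    (p : Seminorm 𝕜 g) (hp : Continuous p) :
    ∃ q : Seminorm 𝕜 g, Continuous q ∧ ∀ a b, p ⁅a, b⁆ ≤ q a * q b := by
  have hw := PolynormableSpace.withSeminorms 𝕜 g
  have hcont : Continuous fun a : g × g => p ⁅a.1, a.2⁆ := hp.comp hbracket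
  have hU : {a : g × g | p ⁅a.1, a.2⁆ < 1} ∈ nhds ((0, 0) : g × g) :=
    (isOpen_lt hcont continuous_const).mem_nhds (by simp)
  rw [nhds_prod_eq] at hU
  obtain ⟨W, hW, hWU⟩ := Filter.mem_prod_same_iff.1 hU
  obtain ⟨s, r, hr, hball⟩ := (hw.mem_nhds_iff _ _).1 hW
  set q₀ : Seminorm 𝕜 g := ∑ i ∈ s, (i : Seminorm 𝕜 g) with hq₀
  have hq₀c : Continuous q₀ := by
    have : (q₀ : g → ℝ) = fun x => ∑ i ∈ s, (i : Seminorm 𝕜 g) x := by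
      funext x
      rw [← Finset.sum_apply]
      exact congrFun (map_sum (FunLike.coeAddMonoidHom (Seminorm 𝕜 g) g ℝ) _ s) x
    rw [this]
    exact continuous_finsetSum _ fun i _ => i.2
  have hlt : ∀ x, q₀ x < r → x ∈ W := fun x hx => by
    refine hball ?_
    rw [Seminorm.mem_ball_zero]
    exact lt_of_le_of_lt (Seminorm.finset_sup_le_sum (fun i : {p : Seminorm 𝕜 g // Continuous p} =>
      (i : Seminorm 𝕜 g)) s x) hx
  let c : NNReal := ⟨r⁻¹, by positivity⟩
  refine ⟨c • q₀, ?_, fun a b => ?_⟩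
  · exact continuous_const.mul hq₀c
  have hscale : ∀ x (δ : ℝ), 0 < δ → ∃ t : ℝ, t = r⁻¹ * q₀ x + δ ∧ 0 < t ∧
      ((t : 𝕜)⁻¹ • x) ∈ W := fun x δ hδ => by
    have ht : 0 < r⁻¹ * q₀ x + δ := by
      have := apply_nonneg q₀ x
      positivity
    refine ⟨_, rfl, ht, hlt _ ?_⟩
    rw [map_smul_eq_mul, norm_inv, RCLike.norm_ofReal, abs_of_pos ht, inv_mul_lt_iff₀ ht, add_mul,
      mul_right_comm, inv_mul_cancel₀ hr.ne', one_mul]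
    exact lt_add_of_pos_right _ (by positivity)
  -- The shift by `δ` permits normalization even where `q₀` vanishes.
  have hδ : ∀ δ : ℝ, 0 < δ → p ⁅a, b⁆ ≤ (r⁻¹ * q₀ a + δ) * (r⁻¹ * q₀ b + δ) := fun δ hδ => by
    obtain ⟨t, ht, ht0, hta⟩ := hscale a δ hδ
    obtain ⟨u, hu, hu0, hub⟩ := hscale b δ hδ
    rw [← ht, ← hu]
    have h := hWU (Set.mk_mem_prod hta hub)
    simp only [Set.mem_ofPred_eq, smul_lie, lie_smul, map_smul_eq_mul, norm_inv,
      RCLike.norm_ofReal, abs_of_pos ht0, abs_of_pos hu0] at h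
    rw [inv_mul_lt_iff₀ hu0, mul_one, inv_mul_lt_iff₀ ht0] at h
    exact h.le
  have hlim : Filter.Tendsto (fun δ : ℝ => (r⁻¹ * q₀ a + δ) * (r⁻¹ * q₀ b + δ))
      (nhdsWithin 0 (Set.Ioi 0)) (nhds ((r⁻¹ * q₀ a + 0) * (r⁻¹ * q₀ b + 0))) :=
    ((Continuous.tendsto (by fun_prop) 0).mono_left nhdsWithin_le_nhds)
  rw [add_zero, add_zero] at hlim
  refine ge_of_tendsto hlim ?_
  filter_upwards [self_mem_nhdsWithin] with δ h
  exact hδ δ h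

/-- In a nilpotent locally convex Lie algebra the submultiplicative seminorms define the
topology. -/
theorem exists_submultiplicative_seminorm (hbracket : Continuous fun a : g × g => ⁅a.1, a.2⁆)
    (k : ℕ) (p : Seminorm 𝕜 g) (hp : Continuous p)
    (hk : ∀ x ∈ LieModule.lowerCentralSeries 𝕜 g g k, p x = 0) :
    ∃ q : Seminorm 𝕜 g, Continuous q ∧ p ≤ q ∧ ∀ a b, q ⁅a, b⁆ ≤ q a * q b := by
  have := (PolynormableSpace.withSeminorms 𝕜 g).topologicalAddGroup
  induction k generalizing p with
  | zero =>
    refine ⟨p, hp, le_rfl, fun a b => ?_⟩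
    rw [hk _ (by simp)]
    exact mul_nonneg (apply_nonneg _ _) (apply_nonneg _ _)
  | succ k ih =>
    obtain ⟨q₁, hq₁, hpq⟩ := exists_seminorm_lie_le hbracket p hp
    set S := (LieModule.lowerCentralSeries 𝕜 g g k).toSubmodule with hS
    -- The bounding seminorm is replaced by its quotient modulo the `k`-th term of the lower central
    -- series, so that it meets the induction hypothesis.
    obtain ⟨q, hq, hle, hsub⟩ := ih (quotSeminorm q₁ S)
      (Seminorm.continuous_of_le hq₁ (quotSeminorm_le q₁ S)) fun x hx => quotSeminorm_eq_zero q₁ S hx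
    have hnull : ∀ x y, p y = 0 → p (x + y) = p x := fun x y hy => by
      refine le_antisymm ?_ ?_
      · simpa [hy] using map_add_le_add p x y
      · simpa [hy] using map_sub_le_add p (x + y) y
    have hzero : ∀ a, ∀ u ∈ S, p ⁅a, u⁆ = 0 := fun a u hu => by
      refine hk _ ?_
      rw [LieModule.lowerCentralSeries_succ]
      exact LieSubmodule.lie_mem_lie (LieSubmodule.mem_top a) hu
    have hzero' : ∀ a, ∀ u ∈ S, p ⁅u, a⁆ = 0 := fun a u hu => by
      rw [← lie_skew, map_neg_eq_map, hzero a u hu]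
    -- Brackets with `S` lie in the next term of the series, where `p` vanishes. Translating `a` and
    -- `b` by `S` therefore does not change `p ⁅a, b⁆`, and an infimum may be taken in each
    -- variable.
    have hb : ∀ a b, p ⁅a, b⁆ ≤ quotSeminorm q₁ S a * quotSeminorm q₁ S b := fun a b => by
      have h1 : ∀ u ∈ S, ∀ w ∈ S, p ⁅a, b⁆ ≤ q₁ (a + u) * q₁ (b + w) := fun u hu w hw => by
        refine le_trans (le_of_eq ?_) (hpq (a + u) (b + w))
        rw [add_lie, lie_add, hnull _ _ (hzero' _ u hu), hnull _ _ (hzero _ w hw)]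
      have h2 : ∀ u ∈ S, p ⁅a, b⁆ ≤ q₁ (a + u) * quotSeminorm q₁ S b := fun u hu => by
        change _ ≤ _ * ⨅ w : S, q₁ (b + w)
        rw [Real.mul_iInf_of_nonneg (apply_nonneg _ _)]
        exact le_ciInf fun w => h1 u hu w w.2
      change _ ≤ (⨅ u : S, q₁ (a + u)) * _
      rw [Real.iInf_mul_of_nonneg (apply_nonneg _ _)]
      exact le_ciInf fun u => h2 u u.2
    refine ⟨p ⊔ q, ?_, le_sup_left, fun a b => ?_⟩
    · have : ((p ⊔ q : Seminorm 𝕜 g) : g → ℝ) = fun x => max (p x) (q x) := by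
        funext x
        rfl
      rw [this]
      exact hp.max hq
    · have hqa : ∀ x, q x ≤ (p ⊔ q) x := fun x => le_sup_right (a := p) x
      have hmul : q a * q b ≤ (p ⊔ q) a * (p ⊔ q) b :=
        mul_le_mul (hqa a) (hqa b) (apply_nonneg _ _) (apply_nonneg _ _)
      refine (max_le ?_ ((hsub a b).trans hmul) : max (p ⁅a, b⁆) (q ⁅a, b⁆) ≤ _)
      exact ((hb a b).trans (mul_le_mul (hle a) (hle b) (apply_nonneg _ _)
        (apply_nonneg _ _))).trans hmul

end Submultiplicative

/-! ### Estimates for products in the enveloping algebra. -/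

section RhoBound

open scoped NNReal

variable {𝕜 : Type*} [RCLike 𝕜] {g : Type*} [LieRing g] [LieAlgebra 𝕜 g]

theorem adChain_succ (ξ : g) {j : ℕ} (v : Fin (j + 1) → g) :
    adChain 𝕜 ξ (j + 1) v = ⁅v 0, adChain 𝕜 ξ j fun i => v i.succ⁆ := by
  rw [adChain_apply, adChain_apply, List.ofFn_succ, List.prod_cons]
  rfl

theorem adChain_mem (ξ : g) {j : ℕ} (v : Fin j → g) :
    adChain 𝕜 ξ j v ∈ LieModule.lowerCentralSeries 𝕜 g g j := by
  induction j with
  | zero => simp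
  | succ j ih =>
    rw [adChain_succ, LieModule.lowerCentralSeries_succ]
    exact LieSubmodule.lie_mem_lie (LieSubmodule.mem_top _) (ih _)

theorem adChain_eq_zero {D : ℕ} (hD : LieModule.lowerCentralSeries 𝕜 g g D = ⊥) (ξ : g) {j : ℕ}
    (hj : D ≤ j) (v : Fin j → g) : adChain 𝕜 ξ j v = 0 := by
  have h := LieModule.antitone_lowerCentralSeries 𝕜 g g hj (adChain_mem ξ v)
  rw [hD] at h
  simpa using h

variable {q : Seminorm 𝕜 g}

theorem seminorm_adChain_le (hq : ∀ a b, q ⁅a, b⁆ ≤ q a * q b) (ξ : g) {j : ℕ} (v : Fin j → g) :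
    q (adChain 𝕜 ξ j v) ≤ q ξ * ∏ i, q (v i) := by
  induction j with
  | zero => simp [adChain_apply]
  | succ j ih =>
    rw [adChain_succ, Fin.prod_univ_succ, mul_left_comm]
    exact (hq _ _).trans (mul_le_mul_of_nonneg_left (ih _) (apply_nonneg _ _))

theorem tensorSeminorm_insertAd_le (hq : ∀ a b, q ⁅a, b⁆ ≤ q a * q b) (ξ : g) (j m : ℕ)
    (v : Fin (j + m) → g) :
    tensorSeminorm q (m + 1) (insertAd 𝕜 ξ j m v : ⨂[𝕜]^(m + 1) g) ≤ q ξ * ∏ i, q (v i) := by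
  rw [insertAd_apply]
  refine (tensorSeminorm_symmetrizer_tprod_le q _).trans ?_
  rw [Fin.prod_univ_succ, Fin.prod_univ_add, ← mul_assoc]
  refine mul_le_mul (seminorm_adChain_le hq ξ _) le_rfl
    (Finset.prod_nonneg fun i _ => apply_nonneg _ _)
    (mul_nonneg (apply_nonneg _ _) (Finset.prod_nonneg fun i _ => apply_nonneg _ _))

theorem insertAd_eq_zero {D : ℕ} (hD : LieModule.lowerCentralSeries 𝕜 g g D = ⊥) (ξ : g) {j : ℕ}
    (hj : D ≤ j) (m : ℕ) (v : Fin (j + m) → g) : insertAd 𝕜 ξ j m v = 0 := by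
  rw [insertAd_apply]
  exact symProd_eq_zero 0 (adChain_eq_zero hD ξ hj _)

/-- A bound for the operators of left multiplication. -/
def rhoBound (𝕜 : Type*) [RCLike 𝕜] (D : ℕ) : ℝ := ∑ j ∈ Finset.range D, ‖bern 𝕜 j‖

theorem rhoBound_nonneg (D : ℕ) : 0 ≤ rhoBound 𝕜 D := Finset.sum_nonneg fun _ _ => norm_nonneg _

/-- The quotient `n!/m!` is a product of `j` factors at most `n`. -/
theorem norm_factorial_mul_bern_le {n j m : ℕ} (h : j + m = n) {τ : ℝ} (hτ : (n : ℝ) ≤ τ) :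
    ‖(n ! : 𝕜) * (m ! : 𝕜)⁻¹ * bern 𝕜 j‖ ≤ τ ^ j * ‖bern 𝕜 j‖ := by
  have h1 := Nat.factorial_mul_descFactorial (show j ≤ n by omega)
  rw [show n - j = m by omega] at h1
  have hm : (m ! : 𝕜) ≠ 0 := Nat.cast_ne_zero.2 (Nat.factorial_ne_zero m)
  rw [norm_mul]
  refine mul_le_mul_of_nonneg_right ?_ (norm_nonneg _)
  rw [← h1, Nat.cast_mul, mul_right_comm, mul_inv_cancel₀ hm, one_mul, RCLike.norm_natCast]
  calc ((n.descFactorial j : ℕ) : ℝ) ≤ ((n ^ j : ℕ) : ℝ) :=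
        Nat.cast_le.2 (Nat.descFactorial_le_pow n j)
    _ = (n : ℝ) ^ j := by push_cast; rfl
    _ ≤ τ ^ j := by gcongr

/-- A term with `j` brackets lowers the tensor degree by `j` and so gains `τ^(-j)` in the rescaled
seminorm, which pays for `n!/m! ≤ τʲ`. Nilpotency leaves finitely many `j`, so the constant does not
depend on `n`. Since `rhoN` is defined on all tensors, elementary ones suffice. -/
theorem symSeminorm_rhoN_le (hq : ∀ a b, q ⁅a, b⁆ ≤ q a * q b) {D : ℕ}
    (hD : LieModule.lowerCentralSeries 𝕜 g g D = ⊥) (ξ : g) {n : ℕ} {τ : ℝ≥0} (hτ : (n : ℝ) ≤ τ)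
    (x : ⨂[𝕜]^n g) :
    symSeminorm 0 (τ • q) (rhoN 𝕜 ξ n x) ≤
      rhoBound 𝕜 D * τ * q ξ * tensorSeminorm (τ • q) n x := by
  have hC := rhoBound_nonneg (𝕜 := 𝕜) D
  refine le_mul_tensorSeminorm (τ • q) ((symSeminorm 0 (τ • q)).comp (rhoN 𝕜 ξ n))
    (mul_nonneg (mul_nonneg hC τ.coe_nonneg) (apply_nonneg _ _)) (fun v => ?_) x
  change symSeminorm 0 (τ • q) (rhoN 𝕜 ξ n (PiTensorProduct.tprod 𝕜 v)) ≤ _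
  have hprod : ∏ i, (τ • q) (v i) = (τ : ℝ) ^ n * ∏ i, q (v i) := by
    have : ∀ i, (τ • q) (v i) = (τ : ℝ) * q (v i) := fun i => rfl
    simp [this, Finset.prod_mul_distrib]
  have hP : 0 ≤ ∏ i, q (v i) := Finset.prod_nonneg fun i _ => apply_nonneg _ _
  set X : ℝ := (τ : ℝ) ^ (n + 1) * (q ξ * ∏ i, q (v i)) with hX
  have hX0 : 0 ≤ X := by
    have := apply_nonneg q ξ
    positivity
  rw [rhoN_tprod]
  refine (symSeminorm_sum_le _ _ _ _).trans ?_
  have hterm : ∀ p ∈ (antidiagonal n).attach, symSeminorm 0 (τ • q)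
      (((n ! : 𝕜) * (p.1.2 ! : 𝕜)⁻¹ * bern 𝕜 p.1.1) • symIncl 𝕜 (p.1.2 + 1)
        (insertAd 𝕜 ξ p.1.1 p.1.2 fun i =>
          v (finCongr (Finset.HasAntidiagonal.mem_antidiagonal.mp p.2) i))) ≤
      if p.1.1 < D then ‖bern 𝕜 p.1.1‖ * X else 0 := by
    rintro ⟨⟨j, m⟩, hp⟩ _
    have hjm : j + m = n := Finset.HasAntidiagonal.mem_antidiagonal.mp hp
    split_ifs with hj
    · rw [map_smul_eq_mul, symSeminorm_symIncl, Real.rpow_zero, one_mul, tensorSeminorm_smul]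
      have h1 := norm_factorial_mul_bern_le (𝕜 := 𝕜) hjm hτ
      have h2 := tensorSeminorm_insertAd_le hq ξ j m fun i => v (finCongr hjm i)
      rw [Equiv.prod_comp (finCongr hjm) fun i => q (v i)] at h2
      calc _ ≤ ((τ : ℝ) ^ j * ‖bern 𝕜 j‖) * ((τ : ℝ) ^ (m + 1) * (q ξ * ∏ i, q (v i))) :=
            mul_le_mul h1 (mul_le_mul_of_nonneg_left h2 (by positivity))
              (mul_nonneg (by positivity) (apply_nonneg _ _)) (by positivity)
        _ = ‖bern 𝕜 j‖ * X := by
            rw [hX, show n + 1 = j + (m + 1) by omega, pow_add]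
            ring
    · rw [insertAd_eq_zero hD ξ (not_lt.1 hj), map_zero, smul_zero]
      exact (map_zero _).le
  refine (Finset.sum_le_sum hterm).trans ?_
  rw [Finset.sum_attach (antidiagonal n) fun p => if p.1 < D then ‖bern 𝕜 p.1‖ * X else 0,
    Finset.Nat.sum_antidiagonal_eq_sum_range_succ_mk, ← Finset.sum_filter]
  calc _ ≤ ∑ j ∈ Finset.range D, ‖bern 𝕜 j‖ * X :=
        Finset.sum_le_sum_of_subset_of_nonneg
          (fun j hj => Finset.mem_range.2 (Finset.mem_filter.1 hj).2)
          fun j _ _ => mul_nonneg (norm_nonneg _) hX0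
    _ = rhoBound 𝕜 D * X := by rw [← Finset.sum_mul]; rfl
    _ = _ := by
      rw [hprod, hX]
      ring

theorem rhoN_apply_eq_zero (ξ : g) {n d : ℕ} (h : n + 1 < d) (x : ⨂[𝕜]^n g) :
    rhoN 𝕜 ξ n x d = 0 := by
  suffices H : (DirectSum.component 𝕜 ℕ (fun m => SymPower 𝕜 g m) d).comp (rhoN 𝕜 ξ n) = 0 from
    LinearMap.congr_fun H x
  refine PiTensorProduct.ext (MultilinearMap.ext fun v => ?_)
  change (rhoN 𝕜 ξ n (PiTensorProduct.tprod 𝕜 v)) d = 0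
  rw [rhoN_tprod, DFinsupp.finsetSum_apply]
  refine Finset.sum_eq_zero fun p _ => ?_
  have hp := Finset.HasAntidiagonal.mem_antidiagonal.mp p.2
  rw [← map_smul]
  exact DirectSum.of_eq_of_ne _ _ _ (by omega)

theorem rho_eq_sum (ξ : g) (x : SymAlg 𝕜 g) {N : ℕ} (hx : ∀ n, N ≤ n → x n = 0) :
    rho 𝕜 ξ x = ∑ n ∈ Finset.range N, rhoN 𝕜 ξ n (x n : ⨂[𝕜]^n g) := by
  conv_lhs => rw [← sum_symIncl_component x hx, map_sum]
  exact Finset.sum_congr rfl fun n _ => rho_symIncl ξ n (x n)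

theorem rho_apply_eq_zero (ξ : g) (x : SymAlg 𝕜 g) {N : ℕ} (hx : ∀ n, N ≤ n → x n = 0) (d : ℕ)
    (hd : N + 1 ≤ d) : rho 𝕜 ξ x d = 0 := by
  rw [rho_eq_sum ξ x hx, DFinsupp.finsetSum_apply]
  refine Finset.sum_eq_zero fun n hn => rhoN_apply_eq_zero ξ ?_ _
  have := Finset.mem_range.1 hn
  omega

theorem symSeminorm_rho_le (hq : ∀ a b, q ⁅a, b⁆ ≤ q a * q b) {D : ℕ}
    (hD : LieModule.lowerCentralSeries 𝕜 g g D = ⊥) (ξ : g) {N : ℕ} {τ : ℝ≥0} (hτ : (N : ℝ) ≤ τ)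
    (x : SymAlg 𝕜 g) (hx : ∀ n, N + 1 ≤ n → x n = 0) :
    symSeminorm 0 (τ • q) (rho 𝕜 ξ x) ≤
      rhoBound 𝕜 D * τ * q ξ * symSeminorm 0 (τ • q) x := by
  rw [rho_eq_sum ξ x hx, symSeminorm_eq_sum _ _ x hx, Finset.mul_sum]
  refine (symSeminorm_sum_le _ _ _ _).trans (Finset.sum_le_sum fun n hn => ?_)
  rw [symSeminorm_symIncl, Real.rpow_zero, one_mul]
  refine symSeminorm_rhoN_le hq hD ξ (le_trans ?_ hτ) _
  exact Nat.cast_le.2 (Nat.lt_succ_iff.1 (Finset.mem_range.1 hn))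

/-- The factors `w i` are multiplied on one at a time. The degree bound belongs to the induction
because each application of `rho` needs all degrees to be at most `τ`. -/
theorem quantInv_prod_mul_bound (hq : ∀ a b, q ⁅a, b⁆ ≤ q a * q b) {D : ℕ}
    (hD : LieModule.lowerCentralSeries 𝕜 g g D = ⊥) {k l : ℕ} {τ : ℝ≥0}
    (hτ : ((k + l : ℕ) : ℝ) ≤ τ) (w : Fin k → g) (y : SymPower 𝕜 g l) :
    (∀ n, k + l + 1 ≤ n →
      quantInv 𝕜 g ((List.ofFn fun i => envIncl 𝕜 g (w i)).prod * quantN 𝕜 g l y) n = 0) ∧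
    symSeminorm 0 (τ • q)
        (quantInv 𝕜 g ((List.ofFn fun i => envIncl 𝕜 g (w i)).prod * quantN 𝕜 g l y)) ≤
      (rhoBound 𝕜 D * τ) ^ k * tensorSeminorm (τ • q) l (y : ⨂[𝕜]^l g) * ∏ i, q (w i) := by
  induction k with
  | zero =>
    rw [List.ofFn_zero, List.prod_nil, one_mul, ← quant_symIncl, quantInv_quant]
    refine ⟨fun n hn => DirectSum.of_eq_of_ne _ _ _ (by omega), ?_⟩
    rw [symSeminorm_symIncl]
    simp
  | succ k ih =>
    obtain ⟨h1, h2⟩ := ih (le_trans (Nat.cast_le.2 (by omega)) hτ) fun i => w i.succ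
    rw [List.ofFn_succ, List.prod_cons, mul_assoc, quantInv_envIncl_mul]
    refine ⟨fun n hn => rho_apply_eq_zero _ _ h1 n (by omega), ?_⟩
    refine (symSeminorm_rho_le hq hD (w 0) (le_trans (Nat.cast_le.2 (by omega)) hτ) _ h1).trans ?_
    refine (mul_le_mul_of_nonneg_left h2 ?_).trans_eq ?_
    · exact mul_nonneg (mul_nonneg (rhoBound_nonneg D) τ.coe_nonneg) (apply_nonneg _ _)
    · rw [Fin.prod_univ_succ]
      ring

/-- The basic estimate for the product of the universal enveloping algebra, transported to the
symmetric algebra. -/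
theorem pow_mul_tensorSeminorm_quantInv_le (hq : ∀ a b, q ⁅a, b⁆ ≤ q a * q b) {D : ℕ}
    (hD : LieModule.lowerCentralSeries 𝕜 g g D = ⊥) {k l : ℕ} (x : SymPower 𝕜 g k)
    (y : SymPower 𝕜 g l) (r : ℕ) :
    ((k + l : ℕ) : ℝ) ^ r * tensorSeminorm q r
        (quantInv 𝕜 g (quantN 𝕜 g k x * quantN 𝕜 g l y) r : ⨂[𝕜]^r g) ≤
      rhoBound 𝕜 D ^ k * ((k + l : ℕ) : ℝ) ^ (k + l) *
        (tensorSeminorm q k (x : ⨂[𝕜]^k g) * tensorSeminorm q l (y : ⨂[𝕜]^l g)) := by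
  -- No degree above `k + l` occurs during the successive multiplications, so this scale serves for
  -- all of them.
  set τ : ℝ≥0 := ((k + l : ℕ) : ℝ≥0) with hτ
  have hτ' : (τ : ℝ) = ((k + l : ℕ) : ℝ) := by rw [hτ]; rfl
  have hle : ((k + l : ℕ) : ℝ) ≤ τ := hτ'.ge
  have h1 := symSeminorm_component_le 0 (τ • q) r
    (quantInv 𝕜 g (quantN 𝕜 g k x * quantN 𝕜 g l y))
  rw [Real.rpow_zero, one_mul, tensorSeminorm_smul] at h1
  rw [← hτ']
  refine h1.trans ?_
  have h2 := le_mul_tensorSeminorm q ((symSeminorm 0 (τ • q)).comp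
    ((quantInv 𝕜 g).comp ((LinearMap.mulRight 𝕜 (quantN 𝕜 g l y)).comp
      (tensorToEnveloping 𝕜 g k))))
    (C := (rhoBound 𝕜 D * τ) ^ k * tensorSeminorm (τ • q) l (y : ⨂[𝕜]^l g))
    (mul_nonneg (pow_nonneg (mul_nonneg (rhoBound_nonneg D) τ.coe_nonneg) k) (apply_nonneg _ _))
    (fun w => ?_) x
  · refine h2.trans (le_of_eq ?_)
    rw [tensorSeminorm_smul]
    ring
  · change symSeminorm 0 (τ • q) (quantInv 𝕜 g (tensorToEnveloping 𝕜 g k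
      (PiTensorProduct.tprod 𝕜 w) * quantN 𝕜 g l y)) ≤ _
    rw [tensorToEnveloping_tprod]
    exact (quantInv_prod_mul_bound hq hD hle w y).2

end RhoBound

/-! ### Factorial estimates. -/

section FactorialEstimates

theorem pow_self_le_exp_mul_factorial (n : ℕ) : (n : ℝ) ^ n ≤ Real.exp 1 ^ n * n ! := by
  have h := Real.pow_div_factorial_le_exp (n : ℝ) n.cast_nonneg n
  rwa [div_le_iff₀ (by positivity), ← mul_one (n : ℝ), Real.exp_nat_mul, mul_one] at h

theorem factorial_le_pow_mul_factorial_pow {D r n : ℕ} (h : n ≤ D * r) :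
    (n ! : ℝ) ≤ ((D * Real.exp 1) ^ D) ^ r * (r ! : ℝ) ^ D := by
  calc (n ! : ℝ) ≤ ((D * r : ℕ)! : ℝ) := Nat.cast_le.2 (Nat.factorial_le h)
    _ ≤ (((D * r) ^ (D * r) : ℕ) : ℝ) := Nat.cast_le.2 (Nat.factorial_le_pow _)
    _ = ((D : ℝ) ^ D) ^ r * ((r : ℝ) ^ r) ^ D := by
      push_cast
      rw [mul_pow, ← pow_mul, ← pow_mul, mul_comm r D]
    _ ≤ ((D : ℝ) ^ D) ^ r * (Real.exp 1 ^ r * r !) ^ D := by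
      gcongr
      exact pow_self_le_exp_mul_factorial r
    _ = _ := by
      rw [mul_pow, mul_pow (D : ℝ), mul_pow, ← pow_mul (Real.exp 1), ← pow_mul (Real.exp 1),
        mul_comm r D, mul_assoc]

/-- For `s ≥ 0` the binomial coefficient is at most `2^(k+l)`. Negative `s` also occurs, as `ε` is
not bounded above, and then `k! l! ≤ (k+l)!` suffices. -/
theorem factorial_rpow_le (k l : ℕ) {s : ℝ} (hs : s ≤ 1) :
    ((k + l)! : ℝ) ^ s ≤ 2 ^ (k + l) * ((k ! : ℝ) * l !) ^ s := by
  have h1 : ((k + l)! : ℝ) ≤ 2 ^ (k + l) * ((k ! : ℝ) * l !) := by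
    have h := Nat.add_choose_mul_factorial_mul_factorial k l
    have h2 : (k + l).choose l ≤ 2 ^ (k + l) := Nat.choose_le_two_pow _ _
    rw [← h, mul_assoc]
    push_cast
    gcongr
    exact_mod_cast h2
  have h2 : (k ! : ℝ) * l ! ≤ (k + l)! := by
    exact_mod_cast Nat.le_of_dvd (Nat.factorial_pos _) (Nat.factorial_mul_factorial_dvd_factorial_add k l)
  have hpos : (0 : ℝ) < (k ! : ℝ) * l ! := by positivity
  have htwo : (1 : ℝ) ≤ 2 ^ (k + l) := one_le_pow₀ one_le_two
  rcases le_total 0 s with h0 | h0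
  · refine (Real.rpow_le_rpow (by positivity) h1 h0).trans ?_
    rw [Real.mul_rpow (by positivity) hpos.le]
    refine mul_le_mul_of_nonneg_right ?_ (by positivity)
    calc ((2 : ℝ) ^ (k + l)) ^ s ≤ ((2 : ℝ) ^ (k + l)) ^ (1 : ℝ) :=
          Real.rpow_le_rpow_of_exponent_le htwo hs
      _ = _ := Real.rpow_one _
  · refine (Real.rpow_le_rpow_of_nonpos hpos h2 h0).trans ?_
    exact le_mul_of_one_le_left (by positivity) htwo

/-- The constant in `factorial_estimate`. -/
def factorialConst (D : ℕ) (ε : ℝ) : ℝ :=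
  2 * Real.exp 1 * ((D * Real.exp 1) ^ D) ^ (ε / D)

theorem factorialConst_nonneg (D : ℕ) (ε : ℝ) : 0 ≤ factorialConst D ε := by
  unfold factorialConst
  positivity

theorem factorial_estimate {D k l r : ℕ} {ε : ℝ} (hε : 0 < ε) (hD : 0 < D) (hr : r ≤ k + l)
    (h : k + l ≤ D * r) :
    (r ! : ℝ) ^ (1 - ε) * ((k + l : ℕ) : ℝ) ^ (k + l) ≤ ((k + l : ℕ) : ℝ) ^ r *
      (factorialConst D ε ^ (k + l) * ((k ! : ℝ) * l !) ^ (1 - ε / D)) := by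
  set n := k + l with hn
  set δ : ℝ := ε / D with hδ
  have hD' : (0 : ℝ) < D := Nat.cast_pos.2 hD
  have hδ0 : 0 < δ := by positivity
  have hD1 : (1 : ℝ) ≤ D := Nat.one_le_cast.2 hD
  set E : ℝ := (D * Real.exp 1) ^ D with hE
  have hE1 : 1 ≤ E := one_le_pow₀ (by
    have := Real.one_le_exp (zero_le_one (α := ℝ))
    nlinarith)
  have hE0 : 0 < E := by positivity
  have hr0 : (0 : ℝ) < r ! := by positivity
  have hn0 : (0 : ℝ) < n ! := by positivity
  have h1 : (r ! : ℝ) ≤ (n : ℝ) ^ r := by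
    calc (r ! : ℝ) ≤ ((r ^ r : ℕ) : ℝ) := Nat.cast_le.2 (Nat.factorial_le_pow r)
      _ = (r : ℝ) ^ r := by push_cast; rfl
      _ ≤ (n : ℝ) ^ r := by gcongr
  have h2 : (n ! : ℝ) ≤ E ^ n * (r ! : ℝ) ^ D :=
    (factorial_le_pow_mul_factorial_pow h).trans
      (mul_le_mul_of_nonneg_right (pow_le_pow_right₀ hE1 hr) (by positivity))
  -- Here nilpotency enters: `n ≤ D r` makes `n!` at most an exponential times `(r!)ᴰ`, so the
  -- saving `(r!)^(-ε)` is worth `(n!)^(-ε/D)`.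
  have h3 : (r ! : ℝ) ^ (-ε) ≤ (n ! : ℝ) ^ (-δ) * (E ^ δ) ^ n := by
    have h4 := Real.rpow_le_rpow_of_nonpos hn0 h2 (neg_nonpos.2 hδ0.le)
    rw [Real.mul_rpow (by positivity) (by positivity), ← Real.rpow_natCast (r ! : ℝ) D,
      ← Real.rpow_mul hr0.le, mul_neg, hδ, mul_div_cancel₀ _ hD'.ne', ← hδ,
      Real.rpow_neg (by positivity), inv_mul_le_iff₀ (by positivity)] at h4
    refine h4.trans_eq ?_
    rw [mul_comm, ← Real.rpow_natCast E n, ← Real.rpow_natCast (E ^ δ) n, ← Real.rpow_mul hE0.le,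
      ← Real.rpow_mul hE0.le, mul_comm δ]
  calc (r ! : ℝ) ^ (1 - ε) * (n : ℝ) ^ n
      = (r ! : ℝ) * (r ! : ℝ) ^ (-ε) * (n : ℝ) ^ n := by
        rw [sub_eq_add_neg, Real.rpow_add hr0, Real.rpow_one]
    _ ≤ (n : ℝ) ^ r * ((n ! : ℝ) ^ (-δ) * (E ^ δ) ^ n) * (Real.exp 1 ^ n * n !) := by
        gcongr
        exact pow_self_le_exp_mul_factorial n
    _ = (n : ℝ) ^ r * ((Real.exp 1 * E ^ δ) ^ n * (n ! : ℝ) ^ (1 - δ)) := by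
        rw [sub_eq_add_neg, Real.rpow_add hn0, Real.rpow_one, mul_pow]
        ring
    _ ≤ (n : ℝ) ^ r * ((Real.exp 1 * E ^ δ) ^ n *
          (2 ^ n * ((k ! : ℝ) * l !) ^ (1 - δ))) := by
        gcongr
        exact factorial_rpow_le k l (by linarith)
    _ = _ := by
        rw [factorialConst, mul_assoc 2, mul_pow 2]
        ring

end FactorialEstimates

/-! ### Continuity estimates for the star product. -/

section StarBound

open scoped NNReal

variable {𝕜 : Type*} [RCLike 𝕜] {g : Type*} [LieRing g] [LieAlgebra 𝕜 g]

/-- The homogeneous component of degree `r` of the star product of homogeneous elements. -/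
def starComponent (z : 𝕜) {k l : ℕ} (r : ℕ) (x : SymPower 𝕜 g k) (y : SymPower 𝕜 g l) :
    SymPower 𝕜 g r :=
  if r ≤ k + l then z ^ (k + l - r) • quantInv 𝕜 g (quantN 𝕜 g k x * quantN 𝕜 g l y) r else 0

theorem star_symIncl (z : 𝕜) (k l : ℕ) (x : SymPower 𝕜 g k) (y : SymPower 𝕜 g l) :
    star g z (symIncl 𝕜 k x) (symIncl 𝕜 l y) =
      ∑ r ∈ Finset.range (k + l + 1), symIncl 𝕜 r (starComponent z r x y) := by
  rw [star_lof, starHom_apply, ← Finset.sum_range_reflect]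
  refine Finset.sum_congr rfl fun r hr => ?_
  have hr' : r ≤ k + l := Nat.lt_succ_iff.1 (Finset.mem_range.1 hr)
  have h1 : k + l + 1 - 1 - r = k + l - r := by omega
  have h2 : k + l - (k + l - r) = r := by omega
  rw [starComponent, if_pos hr', map_smul, h1, h2]

variable [TopologicalSpace g] [PolynormableSpace 𝕜 g]

/-- All exponential constants, including powers of `z`, are absorbed by rescaling the seminorm. The
spare factor `2^(k+l)` is kept for summing over `r`. -/
theorem exists_seminorm_starComponent_le (hbracket : Continuous fun a : g × g => ⁅a.1, a.2⁆)
    [LieRing.IsNilpotent g] (p : Seminorm 𝕜 g) (hp : Continuous p) {ε : ℝ} (hε : 0 < ε) (z : 𝕜) :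
    ∃ q : Seminorm 𝕜 g, Continuous q ∧ ∃ δ : ℝ, 0 < δ ∧ ∀ (k l r : ℕ) (x : SymPower 𝕜 g k)
      (y : SymPower 𝕜 g l), 2 ^ (k + l) * ((r ! : ℝ) ^ (1 - ε) *
        tensorSeminorm p r (starComponent z r x y : ⨂[𝕜]^r g)) ≤
      ((k ! : ℝ) ^ (1 - δ) * tensorSeminorm q k (x : ⨂[𝕜]^k g)) *
        ((l ! : ℝ) ^ (1 - δ) * tensorSeminorm q l (y : ⨂[𝕜]^l g)) := by
  obtain ⟨D', hD'⟩ := LieModule.IsNilpotent.nilpotent 𝕜 g g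
  -- `D` is made positive because the new exponent is `ε / D`.
  obtain ⟨D, hD0, hD⟩ : ∃ D, 0 < D ∧ LieModule.lowerCentralSeries 𝕜 g g D = ⊥ :=
    ⟨D' + 1, Nat.succ_pos _, le_bot_iff.1 (hD' ▸
      LieModule.antitone_lowerCentralSeries 𝕜 g g (Nat.le_succ D'))⟩
  obtain ⟨q, hqc, hpq, hq⟩ := exists_submultiplicative_seminorm hbracket D p hp fun x hx => by
    rw [hD, LieSubmodule.mem_bot] at hx
    rw [hx, map_zero]
  have hC := rhoBound_nonneg (𝕜 := 𝕜) D
  have hF := factorialConst_nonneg D ε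
  set A : ℝ := 2 * ((1 + ‖z‖) * (1 + rhoBound 𝕜 D) * factorialConst D ε) with hA
  have hA0 : 0 ≤ A := by positivity
  let a : ℝ≥0 := ⟨A, hA0⟩
  refine ⟨a • q, continuous_const.mul hqc, ε / D, by positivity, fun k l r x y => ?_⟩
  set n := k + l with hn
  set Q : ℝ := tensorSeminorm q k (x : ⨂[𝕜]^k g) * tensorSeminorm q l (y : ⨂[𝕜]^l g) with hQ
  have hQ0 : 0 ≤ Q := mul_nonneg (apply_nonneg _ _) (apply_nonneg _ _)
  have hrhs : ((k ! : ℝ) ^ (1 - ε / D) * tensorSeminorm (a • q) k (x : ⨂[𝕜]^k g)) *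
        ((l ! : ℝ) ^ (1 - ε / D) * tensorSeminorm (a • q) l (y : ⨂[𝕜]^l g)) =
      A ^ n * (((k ! : ℝ) * l !) ^ (1 - ε / D) * Q) := by
    rw [tensorSeminorm_smul, tensorSeminorm_smul, Real.mul_rpow (by positivity) (by positivity),
      hQ, hn, pow_add]
    change _ * (A ^ k * _) * (_ * (A ^ l * _)) = _
    ring
  rw [hrhs]
  have hnonneg : 0 ≤ A ^ n * (((k ! : ℝ) * l !) ^ (1 - ε / D) * Q) := by positivity
  rw [starComponent]
  split_ifs with hr
  swap
  · simpa using hnonneg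
  rcases lt_or_ge (D * r) n with hlt | hle
  · rw [quantInv_mul_apply_eq_zero hD hlt, smul_zero]
    simpa using hnonneg
  have key := pow_mul_tensorSeminorm_quantInv_le hq hD x y r
  set T : SymPower 𝕜 g r := quantInv 𝕜 g (quantN 𝕜 g k x * quantN 𝕜 g l y) r with hT
  have hest := factorial_estimate hε hD0 hr hle
  rw [← hn, ← hQ] at key
  rw [← hn] at hest
  have hnr : (0 : ℝ) < (n : ℝ) ^ r := by
    rcases Nat.eq_zero_or_pos n with h0 | h0
    · rw [show r = 0 by omega, pow_zero]
      exact one_pos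
    · positivity
  have hz : ‖z‖ ^ (n - r) ≤ (1 + ‖z‖) ^ n :=
    (pow_le_pow_left₀ (norm_nonneg z) (by linarith) _).trans
      (pow_le_pow_right₀ (by linarith [norm_nonneg z]) (Nat.sub_le _ _))
  have hCk : rhoBound 𝕜 D ^ k ≤ (1 + rhoBound 𝕜 D) ^ n :=
    (pow_le_pow_left₀ hC (by linarith) _).trans
      (pow_le_pow_right₀ (by linarith) (Nat.le_add_right _ _))
  have hcomp : (r ! : ℝ) ^ (1 - ε) * tensorSeminorm q r (T : ⨂[𝕜]^r g) ≤
      (1 + rhoBound 𝕜 D) ^ n * (factorialConst D ε ^ n *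
        ((k ! : ℝ) * l !) ^ (1 - ε / D)) * Q := by
    refine le_of_mul_le_mul_left ?_ hnr
    calc (n : ℝ) ^ r * ((r ! : ℝ) ^ (1 - ε) * tensorSeminorm q r (T : ⨂[𝕜]^r g))
        = (r ! : ℝ) ^ (1 - ε) * ((n : ℝ) ^ r * tensorSeminorm q r (T : ⨂[𝕜]^r g)) := by ring
      _ ≤ (r ! : ℝ) ^ (1 - ε) * (rhoBound 𝕜 D ^ k * (n : ℝ) ^ n * Q) := by gcongr
      _ = rhoBound 𝕜 D ^ k * ((r ! : ℝ) ^ (1 - ε) * (n : ℝ) ^ n) * Q := by ring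
      _ ≤ (1 + rhoBound 𝕜 D) ^ n * ((n : ℝ) ^ r * (factorialConst D ε ^ n *
            ((k ! : ℝ) * l !) ^ (1 - ε / D))) * Q := by gcongr
      _ = _ := by ring
  have hsm : tensorSeminorm p r ((z ^ (n - r) • T : SymPower 𝕜 g r) : ⨂[𝕜]^r g) ≤
      (1 + ‖z‖) ^ n * tensorSeminorm q r (T : ⨂[𝕜]^r g) := by
    rw [Submodule.coe_smul, map_smul_eq_mul, norm_pow]
    exact mul_le_mul hz (tensorSeminorm_mono hpq r _) (apply_nonneg _ _) (by positivity)
  calc (2 : ℝ) ^ n * ((r ! : ℝ) ^ (1 - ε) *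
        tensorSeminorm p r ((z ^ (n - r) • T : SymPower 𝕜 g r) : ⨂[𝕜]^r g))
      ≤ (2 : ℝ) ^ n * ((r ! : ℝ) ^ (1 - ε) *
        ((1 + ‖z‖) ^ n * tensorSeminorm q r (T : ⨂[𝕜]^r g))) := by gcongr
    _ = (2 : ℝ) ^ n * (1 + ‖z‖) ^ n *
        ((r ! : ℝ) ^ (1 - ε) * tensorSeminorm q r (T : ⨂[𝕜]^r g)) := by ring
    _ ≤ (2 : ℝ) ^ n * (1 + ‖z‖) ^ n * ((1 + rhoBound 𝕜 D) ^ n * (factorialConst D ε ^ n *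
        ((k ! : ℝ) * l !) ^ (1 - ε / D)) * Q) := by gcongr
    _ = _ := by
      rw [hA, mul_pow, mul_pow, mul_pow]
      ring

/-- Continuity estimate for the Gutt star product. -/
theorem exists_seminorm_star_le (hbracket : Continuous fun a : g × g => ⁅a.1, a.2⁆)
    [LieRing.IsNilpotent g] (p : Seminorm 𝕜 g) (hp : Continuous p) {ε : ℝ} (hε : 0 < ε) (z : 𝕜) :
    ∃ q : Seminorm 𝕜 g, Continuous q ∧ ∃ δ : ℝ, 0 < δ ∧ ∀ x y : SymAlg 𝕜 g,
      symSeminorm (1 - ε) p (star g z x y) ≤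
        symSeminorm (1 - δ) q x * symSeminorm (1 - δ) q y := by
  obtain ⟨q, hq, δ, hδ, h⟩ := exists_seminorm_starComponent_le hbracket p hp hε z
  refine ⟨q, hq, δ, hδ, fun x y => ?_⟩
  -- At most `k + l + 1 ≤ 2^(k+l)` components occur, which uses up the spare factor.
  have hhom : ∀ k l (x : SymPower 𝕜 g k) (y : SymPower 𝕜 g l),
      symSeminorm (1 - ε) p (star g z (symIncl 𝕜 k x) (symIncl 𝕜 l y)) ≤
        symSeminorm (1 - δ) q (symIncl 𝕜 k x) * symSeminorm (1 - δ) q (symIncl 𝕜 l y) := by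
    intro k l x y
    rw [star_symIncl, symSeminorm_symIncl, symSeminorm_symIncl]
    refine (symSeminorm_sum_le _ _ _ _).trans ?_
    refine (Finset.sum_le_card_nsmul _ _ ((2 ^ (k + l))⁻¹ *
      (((k ! : ℝ) ^ (1 - δ) * tensorSeminorm q k (x : ⨂[𝕜]^k g)) *
        ((l ! : ℝ) ^ (1 - δ) * tensorSeminorm q l (y : ⨂[𝕜]^l g)))) fun r _ => ?_).trans ?_
    · rw [symSeminorm_symIncl, le_inv_mul_iff₀ (by positivity)]
      exact h k l r x y
    · rw [Finset.card_range, nsmul_eq_mul, ← mul_assoc]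
      refine mul_le_of_le_one_left ?_ ?_
      · exact mul_nonneg (mul_nonneg (by positivity) (apply_nonneg _ _))
          (mul_nonneg (by positivity) (apply_nonneg _ _))
      · rw [mul_inv_le_iff₀ (by positivity), one_mul]
        exact_mod_cast Nat.lt_two_pow_self (n := k + l)
  have hfin : ∀ x : SymAlg 𝕜 g, ∃ N, ∀ n, N ≤ n → x n = 0 := fun x => by
    classical
    refine ⟨(DFinsupp.support x).sup id + 1, fun n hn => ?_⟩
    by_contra hne
    have := Finset.le_sup (f := id) (DFinsupp.mem_support_iff.2 hne)
    simp only [id] at this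
    omega
  obtain ⟨N, hN⟩ := hfin x
  obtain ⟨N', hN'⟩ := hfin y
  rw [symSeminorm_eq_sum _ q x hN, symSeminorm_eq_sum _ q y hN', Finset.sum_mul_sum]
  have hexp : star g z x y = ∑ k ∈ Finset.range N, ∑ l ∈ Finset.range N',
      star g z (symIncl 𝕜 k (x k)) (symIncl 𝕜 l (y l)) := by
    conv_lhs => rw [← sum_symIncl_component x hN, ← sum_symIncl_component y hN']
    rw [map_sum, Finset.sum_comm]
    refine Finset.sum_congr rfl fun l _ => ?_
    rw [map_sum, LinearMap.sum_apply]
  rw [hexp]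
  refine (symSeminorm_sum_le _ _ _ _).trans (Finset.sum_le_sum fun k _ => ?_)
  exact (symSeminorm_sum_le _ _ _ _).trans (Finset.sum_le_sum fun l _ => hhom k l _ _)

end StarBound

/-! ### The seminorms of the projective limit, and summability in its completion. -/

section SymTopology

variable {𝕜 : Type*} [RCLike 𝕜] {V : Type*} [AddCommGroup V] [Module 𝕜 V] [TopologicalSpace V]

/-- The seminorms `p_{R - ε}` that define the topology of `Sym_{R⁻}(V)`. -/
def symMinusSeminorm (𝕜 : Type*) [RCLike 𝕜] (V : Type*) [AddCommGroup V] [Module 𝕜 V]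
    [TopologicalSpace V] (R : ℝ) :
    SeminormFamily 𝕜 (SymMinus 𝕜 V R) ({ε : ℝ // 0 < ε} × {p : Seminorm 𝕜 V // Continuous p}) :=
  fun i => symSeminorm (R - i.1.1) i.2.1

theorem withSeminorms_symMinus (R : ℝ) : WithSeminorms (symMinusSeminorm 𝕜 V R) := by
  rw [SeminormFamily.withSeminorms_iff_topologicalSpace_eq_iInf, iInf_prod]
  refine (UniformSpace.toTopologicalSpace_iInf).trans (iInf_congr fun ε => ?_)
  exact UniformSpace.toTopologicalSpace_iInf

theorem summable_symHat {ι : Type*} {R : ℝ} (f : ι → SymMinus 𝕜 V R)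
    (h : ∀ p : Seminorm 𝕜 V, Continuous p → ∀ ε : ℝ, 0 < ε →
      Summable fun i => symSeminorm (R - ε) p (f i)) :
    Summable fun i => (f i : SymHat 𝕜 V R) := by
  classical
  rw [summable_iff_cauchySeq_finset]
  have hc : CauchySeq fun s : Finset ι => ∑ i ∈ s, f i := by
    rw [cauchySeq_finset_iff_sum_vanishing]
    intro e he
    obtain ⟨S, r, hr, hS⟩ := ((withSeminorms_symMinus (𝕜 := 𝕜) (V := V) R).mem_nhds_iff _ _).1 he
    have hi : ∀ j, ∃ s : Finset ι, ∀ t, Disjoint t s →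
        symMinusSeminorm 𝕜 V R j (∑ i ∈ t, f i) < r := fun j => by
      have hj := h j.2.1 j.2.2 j.1.1 j.1.2
      obtain ⟨s, hs⟩ := summable_iff_vanishing_norm.1 hj r hr
      refine ⟨s, fun t ht => lt_of_le_of_lt ?_ (lt_of_le_of_lt (le_abs_self _) (hs t ht))⟩
      exact Finset.le_sum_of_subadditive _ (map_zero _).le (map_add_le_add _) _ _
    choose s hs using hi
    refine ⟨S.biUnion s, fun t ht => hS ?_⟩
    rw [Seminorm.mem_ball_zero]
    refine Seminorm.finset_sup_apply_lt hr fun j hj => hs j t ?_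
    exact ht.mono_right (Finset.subset_biUnion_of_mem s hj)
  have hm := (UniformSpace.Completion.uniformContinuous_coe (SymMinus 𝕜 V R)).comp_cauchySeq hc
  have hsum : (fun s : Finset ι => ∑ i ∈ s, (f i : SymHat 𝕜 V R)) =
      ((↑) : SymMinus 𝕜 V R → SymHat 𝕜 V R) ∘ fun s : Finset ι => ∑ i ∈ s, f i :=
    funext fun s => (map_sum (UniformSpace.Completion.toCompl : SymMinus 𝕜 V R →+ SymHat 𝕜 V R) f s).symm
  rwa [hsum]

end SymTopology

/-! ### The star product on the completion. -/

section StarTopology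

variable {𝕜 : Type*} [RCLike 𝕜] {g : Type*} [LieRing g] [LieAlgebra 𝕜 g]
  [TopologicalSpace g] [PolynormableSpace 𝕜 g]

/-- The star product as a biadditive map. -/
def starHom₂ (𝕜 : Type*) [RCLike 𝕜] (g : Type*) [LieRing g] [LieAlgebra 𝕜 g] (R : ℝ) (z : 𝕜) :
    SymMinus 𝕜 g R →ₗ[𝕜] SymMinus 𝕜 g R →ₗ[𝕜] SymMinus 𝕜 g R := star g z

theorem continuous_starMinus (hbracket : Continuous fun a : g × g => ⁅a.1, a.2⁆)
    [LieRing.IsNilpotent g] (z : 𝕜) :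
    Continuous fun a : SymMinus 𝕜 g 1 × SymMinus 𝕜 g 1 => starMinus z a.1 a.2 := by
  have hw := withSeminorms_symMinus (𝕜 := 𝕜) (V := g) 1
  refine continuous_iff_continuousAt.2 fun a => ?_
  refine (hw.tendsto_nhds _ _).2 fun i r hr => ?_
  obtain ⟨q, hq, δ, hδ, h⟩ := exists_seminorm_star_le hbracket i.2.1 i.2.2 i.1.2 z
  set Q := symMinusSeminorm 𝕜 g 1 (⟨δ, hδ⟩, ⟨q, hq⟩) with hQ
  have hQc : Continuous Q := hw.continuous_seminorm _
  have hle : ∀ b : SymMinus 𝕜 g 1 × SymMinus 𝕜 g 1,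
      symMinusSeminorm 𝕜 g 1 i (starMinus z b.1 b.2 - starMinus z a.1 a.2) ≤
        Q (b.1 - a.1) * Q b.2 + Q a.1 * Q (b.2 - a.2) := fun b => by
    have hsplit : starMinus z b.1 b.2 - starMinus z a.1 a.2 =
        starMinus z (b.1 - a.1) b.2 + starMinus z a.1 (b.2 - a.2) := by
      change starHom₂ 𝕜 g 1 z b.1 b.2 - starHom₂ 𝕜 g 1 z a.1 a.2 =
        starHom₂ 𝕜 g 1 z (b.1 - a.1) b.2 + starHom₂ 𝕜 g 1 z a.1 (b.2 - a.2)
      rw [map_sub, map_sub, LinearMap.sub_apply]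
      abel
    rw [hsplit]
    exact (map_add_le_add _ _ _).trans (add_le_add (h _ _) (h _ _))
  have hlim : Filter.Tendsto (fun b : SymMinus 𝕜 g 1 × SymMinus 𝕜 g 1 =>
      Q (b.1 - a.1) * Q b.2 + Q a.1 * Q (b.2 - a.2)) (nhds a) (nhds 0) := by
    have hc : Continuous fun b : SymMinus 𝕜 g 1 × SymMinus 𝕜 g 1 =>
        Q (b.1 - a.1) * Q b.2 + Q a.1 * Q (b.2 - a.2) := by
      fun_prop
    have := hc.tendsto a
    simpa using this
  filter_upwards [hlim.eventually_lt_const hr] with b hb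
  exact (hle b).trans_lt hb

theorem continuous_starHat (hbracket : Continuous fun a : g × g => ⁅a.1, a.2⁆)
    [LieRing.IsNilpotent g] (z : 𝕜) :
    Continuous fun a : SymHat 𝕜 g 1 × SymHat 𝕜 g 1 => starHat z a.1 a.2 := by
  let B : SymMinus 𝕜 g 1 →+ SymMinus 𝕜 g 1 →+ SymHat 𝕜 g 1 :=
    AddMonoidHom.mk' (fun x => UniformSpace.Completion.toCompl.comp
      (starHom₂ 𝕜 g 1 z x).toAddMonoidHom) fun x y => by
        ext w
        change ((starHom₂ 𝕜 g 1 z (x + y) w : SymMinus 𝕜 g 1) : SymHat 𝕜 g 1) =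
          (starHom₂ 𝕜 g 1 z x w : SymMinus 𝕜 g 1) + (starHom₂ 𝕜 g 1 z y w : SymMinus 𝕜 g 1)
        rw [map_add, LinearMap.add_apply, UniformSpace.Completion.coe_add]
  have hB : Continuous fun a : SymMinus 𝕜 g 1 × SymMinus 𝕜 g 1 => B a.1 a.2 :=
    (UniformSpace.Completion.continuous_coe _).comp (continuous_starMinus hbracket z)
  exact IsDenseInducing.extend_Z_bilin
    (e := (UniformSpace.Completion.toCompl : SymMinus 𝕜 g 1 →+ SymHat 𝕜 g 1))
    (f := (UniformSpace.Completion.toCompl : SymMinus 𝕜 g 1 →+ SymHat 𝕜 g 1))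
    UniformSpace.Completion.isDenseInducing_coe UniformSpace.Completion.isDenseInducing_coe hB

theorem starHat_coe (hbracket : Continuous fun a : g × g => ⁅a.1, a.2⁆)
    [LieRing.IsNilpotent g] (z : 𝕜) (x y : SymMinus 𝕜 g 1) :
    starHat z (x : SymHat 𝕜 g 1) (y : SymHat 𝕜 g 1) = (starMinus z x y : SymMinus 𝕜 g 1) :=
  (UniformSpace.Completion.isDenseInducing_coe.prodMap
    UniformSpace.Completion.isDenseInducing_coe).extend_eq
    ((UniformSpace.Completion.continuous_coe _).comp (continuous_starMinus hbracket z)) (x, y)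

theorem starHat_add_left (hbracket : Continuous fun a : g × g => ⁅a.1, a.2⁆)
    [LieRing.IsNilpotent g] (z : 𝕜) (x x' y : SymHat 𝕜 g 1) :
    starHat z (x + x') y = starHat z x y + starHat z x' y := by
  have hc := continuous_starHat hbracket z
  refine UniformSpace.Completion.induction_on₃ x x' y (isClosed_eq ?_ ?_) fun x x' y => ?_
  · exact hc.comp (((continuous_fst).add (continuous_fst.comp continuous_snd)).prodMk
      (continuous_snd.comp continuous_snd))
  · exact (hc.comp (continuous_fst.prodMk (continuous_snd.comp continuous_snd))).add
      (hc.comp continuous_snd)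
  · rw [← UniformSpace.Completion.coe_add, starHat_coe hbracket, starHat_coe hbracket,
      starHat_coe hbracket, ← UniformSpace.Completion.coe_add]
    congr 1
    change starHom₂ 𝕜 g 1 z (x + x') y = starHom₂ 𝕜 g 1 z x y + starHom₂ 𝕜 g 1 z x' y
    rw [map_add, LinearMap.add_apply]

theorem starHat_add_right (hbracket : Continuous fun a : g × g => ⁅a.1, a.2⁆)
    [LieRing.IsNilpotent g] (z : 𝕜) (x y y' : SymHat 𝕜 g 1) :
    starHat z x (y + y') = starHat z x y + starHat z x y' := by
  have hc := continuous_starHat hbracket z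
  refine UniformSpace.Completion.induction_on₃ x y y' (isClosed_eq ?_ ?_) fun x y y' => ?_
  · exact hc.comp (continuous_fst.prodMk
      ((continuous_fst.comp continuous_snd).add (continuous_snd.comp continuous_snd)))
  · exact (hc.comp (continuous_fst.prodMk (continuous_fst.comp continuous_snd))).add
      (hc.comp (continuous_fst.prodMk (continuous_snd.comp continuous_snd)))
  · rw [← UniformSpace.Completion.coe_add, starHat_coe hbracket, starHat_coe hbracket,
      starHat_coe hbracket, ← UniformSpace.Completion.coe_add]
    congr 1
    change starHom₂ 𝕜 g 1 z x (y + y') = starHom₂ 𝕜 g 1 z x y + starHom₂ 𝕜 g 1 z x y'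
    rw [map_add]

theorem hasSum_starHat_left (hbracket : Continuous fun a : g × g => ⁅a.1, a.2⁆)
    [LieRing.IsNilpotent g] (z : 𝕜) {ι : Type*} {f : ι → SymHat 𝕜 g 1} {a : SymHat 𝕜 g 1}
    (hf : HasSum f a) (y : SymHat 𝕜 g 1) :
    HasSum (fun i => starHat z (f i) y) (starHat z a y) :=
  hf.map (AddMonoidHom.mk' (fun x => starHat z x y) fun x x' =>
    starHat_add_left hbracket z x x' y)
    ((continuous_starHat hbracket z).comp (continuous_id.prodMk continuous_const))

theorem hasSum_starHat_right (hbracket : Continuous fun a : g × g => ⁅a.1, a.2⁆)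
    [LieRing.IsNilpotent g] (z : 𝕜) {ι : Type*} {f : ι → SymHat 𝕜 g 1} {b : SymHat 𝕜 g 1}
    (hf : HasSum f b) (x : SymHat 𝕜 g 1) :
    HasSum (fun i => starHat z x (f i)) (starHat z x b) :=
  hf.map (AddMonoidHom.mk' (fun y => starHat z x y) fun y y' =>
    starHat_add_right hbracket z x y y')
    ((continuous_starHat hbracket z).comp (continuous_const.prodMk continuous_id))

end StarTopology

/-! ### Convergence of the exponential series. -/

section Exponential

variable {𝕜 : Type*} [RCLike 𝕜] {V : Type*} [AddCommGroup V] [Module 𝕜 V]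

theorem summable_factorial_rpow_mul {B δ : ℝ} (hB : 0 ≤ B) (hδ : 0 < δ) :
    Summable fun n : ℕ => (n ! : ℝ) ^ (1 - δ) * (B ^ n / n !) := by
  -- With this choice `cⁿ ≤ eᶜ n!`, raised to the power `δ`, bounds `Bⁿ/(n!)^δ` by a constant times
  -- `2⁻ⁿ`.
  set c : ℝ := (2 * B) ^ δ⁻¹ with hc
  have hc0 : 0 ≤ c := by positivity
  have hcδ : c ^ δ = 2 * B := Real.rpow_inv_rpow (by positivity) hδ.ne'
  refine Summable.of_nonneg_of_le (fun n => by positivity) (fun n => ?_)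
    (summable_geometric_two.mul_left (Real.exp c ^ δ))
  have hn : (0 : ℝ) < n ! := by positivity
  have h1 : c ^ n ≤ Real.exp c * n ! := by
    have h := Real.pow_div_factorial_le_exp c hc0 n
    rwa [div_le_iff₀ hn] at h
  have h2 := Real.rpow_le_rpow (by positivity) h1 hδ.le
  rw [Real.mul_rpow (Real.exp_pos c).le hn.le, ← Real.rpow_natCast c n, ← Real.rpow_mul hc0,
    mul_comm (n : ℝ), Real.rpow_mul hc0, hcδ, Real.rpow_natCast, mul_pow] at h2
  have h3 : (n ! : ℝ) ^ (1 - δ) * (B ^ n / n !) = B ^ n / (n ! : ℝ) ^ δ := by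
    rw [Real.rpow_sub hn, Real.rpow_one]
    field_simp
  rw [h3, div_le_iff₀ (by positivity), one_div, inv_pow, ← div_eq_mul_inv, div_mul_eq_mul_div,
    le_div_iff₀ (by positivity), mul_comm]
  exact h2

theorem tensorSeminorm_formalExp_le (p : Seminorm 𝕜 V) (ξ : V) (n : ℕ) :
    tensorSeminorm p n (formalExp 𝕜 ξ n : ⨂[𝕜]^n V) ≤ p ξ ^ n / n ! := by
  rw [formalExp, Submodule.coe_smul, map_smul_eq_mul, norm_inv, RCLike.norm_natCast, div_eq_inv_mul]
  refine mul_le_mul_of_nonneg_left ?_ (by positivity)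
  exact (tensorSeminorm_symmetrizer_tprod_le p _).trans_eq (by simp)

theorem summable_formalExp (p : Seminorm 𝕜 V) (ξ : V) {ε : ℝ} (hε : 0 < ε) :
    Summable fun n : ℕ => (n ! : ℝ) ^ (1 - ε) *
      tensorSeminorm p n (formalExp 𝕜 ξ n : ⨂[𝕜]^n V) :=
  Summable.of_nonneg_of_le (fun n => mul_nonneg (by positivity) (apply_nonneg _ _))
    (fun n => mul_le_mul_of_nonneg_left (tensorSeminorm_formalExp_le p ξ n) (by positivity))
    (summable_factorial_rpow_mul (apply_nonneg p ξ) hε)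

theorem symPow_smul (c : 𝕜) (ξ : V) (n : ℕ) : symPow 𝕜 (c • ξ) n = c ^ n • symPow 𝕜 ξ n := by
  rw [symPow, symPow, ← symProdMulti_apply,
    MultilinearMap.map_smul_univ (symProdMulti 𝕜 V n) (fun _ => c) fun _ => ξ]
  simp

theorem formalExp_smul (c : 𝕜) (ξ : V) (n : ℕ) :
    formalExp 𝕜 (c • ξ) n = c ^ n • formalExp 𝕜 ξ n := by
  rw [formalExp, symPow_smul, smul_comm, formalExp]

variable [TopologicalSpace V]

theorem hasSum_expHat (ξ : V) : HasSum
    (fun n : ℕ => ((inclSymMinus 𝕜 1 n (formalExp 𝕜 ξ n) : SymMinus 𝕜 V 1) : SymHat 𝕜 V 1))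
    (expHat 𝕜 1 ξ) := by
  refine Summable.hasSum (summable_symHat _ fun p _ ε hε => ?_)
  refine (summable_formalExp (𝕜 := 𝕜) p ξ hε).congr fun n => ?_
  exact (symSeminorm_symIncl (1 - ε) p n _).symm

end Exponential

/-! ### Products of exponentials. -/

section ExponentialProduct

variable {𝕜 : Type*} [RCLike 𝕜] {g : Type*} [LieRing g] [LieAlgebra 𝕜 g]
  [TopologicalSpace g] [PolynormableSpace 𝕜 g]

/-- The components of the product of two exponential series. -/
def expStarComponent (z : 𝕜) (ξ η : g) (k l r : ℕ) : SymMinus 𝕜 g 1 :=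
  inclSymMinus 𝕜 1 r (starComponent z r (formalExp 𝕜 ξ k) (formalExp 𝕜 η l))

/-- Since `r ≤ k + l` for nonzero components, the spare factor `2^(k+l)` provides the geometric
decay `2⁻ʳ`; the majorant is a product of three convergent series. -/
theorem summable_expStarComponent (hbracket : Continuous fun a : g × g => ⁅a.1, a.2⁆)
    [LieRing.IsNilpotent g] (z : 𝕜) (ξ η : g) :
    Summable fun a : ℕ × ℕ × ℕ =>
      (expStarComponent z ξ η a.1 a.2.1 a.2.2 : SymHat 𝕜 g 1) := by
  refine summable_symHat _ fun p hp ε hε => ?_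
  obtain ⟨q, -, δ, hδ, h⟩ := exists_seminorm_starComponent_le hbracket p hp hε z
  have hs := ((summable_formalExp (𝕜 := 𝕜) q ξ hδ).mul_of_nonneg
    ((summable_formalExp (𝕜 := 𝕜) q η hδ).mul_of_nonneg summable_geometric_two
      (fun n => mul_nonneg (by positivity) (apply_nonneg _ _)) fun n => by positivity)
    (fun n => mul_nonneg (by positivity) (apply_nonneg _ _))
    fun n => mul_nonneg (mul_nonneg (by positivity) (apply_nonneg _ _)) (by positivity))
  refine Summable.of_nonneg_of_le (fun a => apply_nonneg _ _) (fun a => ?_) hs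
  obtain ⟨k, l, r⟩ := a
  refine (symSeminorm_symIncl (1 - ε) p r _).trans_le ?_
  have hnn : 0 ≤ ((k ! : ℝ) ^ (1 - δ) * tensorSeminorm q k (formalExp 𝕜 ξ k : ⨂[𝕜]^k g)) *
      ((l ! : ℝ) ^ (1 - δ) * tensorSeminorm q l (formalExp 𝕜 η l : ⨂[𝕜]^l g)) :=
    mul_nonneg (mul_nonneg (by positivity) (apply_nonneg _ _))
      (mul_nonneg (by positivity) (apply_nonneg _ _))
  change _ ≤ ((k ! : ℝ) ^ (1 - δ) * tensorSeminorm q k (formalExp 𝕜 ξ k : ⨂[𝕜]^k g)) *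
      (((l ! : ℝ) ^ (1 - δ) * tensorSeminorm q l (formalExp 𝕜 η l : ⨂[𝕜]^l g)) * (1 / 2) ^ r)
  rw [← mul_assoc]
  by_cases hr : r ≤ k + l
  · have h1 := h k l r (formalExp 𝕜 ξ k) (formalExp 𝕜 η l)
    rw [mul_comm, ← le_div_iff₀ (by positivity)] at h1
    refine h1.trans ?_
    rw [div_eq_mul_one_div, ← one_div_pow]
    exact mul_le_mul_of_nonneg_left
      (pow_le_pow_of_le_one (by norm_num) (by norm_num) hr) hnn
  · rw [starComponent, if_neg hr]
    simpa using hnn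

theorem hasSum_coe_of_ne_finset_zero {E : Type*} [AddCommGroup E] [UniformSpace E]
    [IsUniformAddGroup E] {ι : Type*} {f : ι → E} {s : Finset ι} (h : ∀ i ∉ s, f i = 0) :
    HasSum (fun i => (f i : UniformSpace.Completion E))
      ((∑ i ∈ s, f i : E) : UniformSpace.Completion E) :=
  (hasSum_sum_of_ne_finset_zero (L := SummationFilter.unconditional ι) h).map
    (UniformSpace.Completion.toCompl : E →+ UniformSpace.Completion E)
    UniformSpace.Completion.continuous_toCompl

/-- Summing over `r`, then `l`, then `k` gives the product, by continuity in each argument;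
unconditional summability identifies the iterated sum with the sum over triples. -/
theorem hasSum_expStarComponent (hbracket : Continuous fun a : g × g => ⁅a.1, a.2⁆)
    [LieRing.IsNilpotent g] (z : 𝕜) (ξ η : g) :
    HasSum (fun a : ℕ × ℕ × ℕ => (expStarComponent z ξ η a.1 a.2.1 a.2.2 : SymHat 𝕜 g 1))
      (starHat z (expHat 𝕜 1 ξ) (expHat 𝕜 1 η)) := by
  have hs := summable_expStarComponent hbracket z ξ η
  have h1 : ∀ k l, HasSum (fun r => (expStarComponent z ξ η k l r : SymHat 𝕜 g 1))
      (starHat z ((inclSymMinus 𝕜 1 k (formalExp 𝕜 ξ k) : SymMinus 𝕜 g 1) : SymHat 𝕜 g 1)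
        ((inclSymMinus 𝕜 1 l (formalExp 𝕜 η l) : SymMinus 𝕜 g 1) : SymHat 𝕜 g 1)) := by
    intro k l
    have hsum : starMinus z (inclSymMinus 𝕜 1 k (formalExp 𝕜 ξ k))
        (inclSymMinus 𝕜 1 l (formalExp 𝕜 η l)) =
        ∑ r ∈ Finset.range (k + l + 1), expStarComponent z ξ η k l r :=
      star_symIncl z k l (formalExp 𝕜 ξ k) (formalExp 𝕜 η l)
    rw [starHat_coe hbracket, hsum]
    refine hasSum_coe_of_ne_finset_zero fun r hr => ?_
    rw [expStarComponent, starComponent, if_neg (by simpa using hr), map_zero]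
  have h2 : ∀ k, HasSum (fun b : ℕ × ℕ => (expStarComponent z ξ η k b.1 b.2 : SymHat 𝕜 g 1))
      (starHat z ((inclSymMinus 𝕜 1 k (formalExp 𝕜 ξ k) : SymMinus 𝕜 g 1) : SymHat 𝕜 g 1)
        (expHat 𝕜 1 η)) := by
    intro k
    have hk := (hs.prod_factor k).hasSum
    have := hk.prod_fiberwise (h1 k)
    rwa [← this.unique (hasSum_starHat_right hbracket z (hasSum_expHat η) _)]
  have h3 := hs.hasSum.prod_fiberwise h2
  rw [← h3.unique (hasSum_starHat_left hbracket z (hasSum_expHat ξ) _)]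
  exact hs.hasSum

/-- The triple sum is regrouped by the degree `r`, which reduces an identity in the completion to
finite sums in each `Symʳ(g)`. -/
theorem starHat_expHat (hbracket : Continuous fun a : g × g => ⁅a.1, a.2⁆)
    [LieRing.IsNilpotent g] (z : 𝕜) (ξ η ζ : g) (S : ℕ → Finset (ℕ × ℕ))
    (hS : ∀ r, ∀ a ∉ S r, starComponent z r (formalExp 𝕜 ξ a.1) (formalExp 𝕜 η a.2) = 0)
    (hζ : ∀ r, ∑ a ∈ S r, starComponent z r (formalExp 𝕜 ξ a.1) (formalExp 𝕜 η a.2) =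
      formalExp 𝕜 ζ r) :
    starHat z (expHat 𝕜 1 ξ) (expHat 𝕜 1 η) = expHat 𝕜 1 ζ := by
  have h := hasSum_expStarComponent hbracket z ξ η
  let e : ℕ × ℕ × ℕ ≃ ℕ × ℕ × ℕ :=
    ⟨fun a => (a.2.1, a.2.2, a.1), fun a => (a.2.2, a.1, a.2.1), fun _ => rfl, fun _ => rfl⟩
  rw [← e.hasSum_iff] at h
  refine (h.prod_fiberwise fun r => ?_).unique (hasSum_expHat ζ)
  have hsum : ∑ a ∈ S r, expStarComponent z ξ η a.1 a.2 r =
      inclSymMinus 𝕜 1 r (formalExp 𝕜 ζ r) := by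
    rw [← hζ, map_sum]
    rfl
  rw [← hsum]
  refine hasSum_coe_of_ne_finset_zero fun a ha => ?_
  exact (congrArg (inclSymMinus 𝕜 1 r) (hS r a ha)).trans (map_zero _)

/-- Products of exponentials are given by the Baker-Campbell-Hausdorff series. -/
theorem starHat_expHat_bch (hbracket : Continuous fun a : g × g => ⁅a.1, a.2⁆)
    [LieRing.IsNilpotent g] (ξ η : g) {z : 𝕜} (hz : z ≠ 0) :
    starHat z (expHat 𝕜 1 ξ) (expHat 𝕜 1 η) = expHat 𝕜 1 (z⁻¹ • bch 𝕜 (z • ξ) (z • η)) := by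
  obtain ⟨D, hD⟩ := LieModule.IsNilpotent.nilpotent 𝕜 g g
  refine starHat_expHat hbracket z ξ η _
    -- By nilpotency only pairs with `k + l ≤ D r` contribute to degree `r`.
    (fun r => (Finset.range (D * r + 1) ×ˢ Finset.range (D * r + 1)).filter
      fun a => a.1 + a.2 ∈ Finset.range (D * r + 1)) (fun r a ha => ?_) fun r => ?_
  · have hlt : D * r < a.1 + a.2 := by
      by_contra hle
      refine ha ?_
      simp only [Finset.mem_filter, Finset.mem_product, Finset.mem_range]
      omega
    rw [starComponent, quantInv_mul_apply_eq_zero hD hlt, smul_zero, ite_self]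
  rw [← Finset.sum_fiberwise_of_maps_to (t := Finset.range (D * r + 1))
    (g := fun a : ℕ × ℕ => a.1 + a.2) fun a ha => (Finset.mem_filter.1 ha).2]
  rw [formalExp_smul, ← sum_pow_smul_expCoeff hD, Finset.smul_sum]
  refine Finset.sum_congr rfl fun n hn => ?_
  have hn' := Finset.mem_range.1 hn
  have hset : ((Finset.range (D * r + 1) ×ˢ Finset.range (D * r + 1)).filter
      fun a => a.1 + a.2 ∈ Finset.range (D * r + 1)).filter (fun a => a.1 + a.2 = n) =
      antidiagonal n := by
    ext a
    simp only [Finset.mem_filter, Finset.mem_product, Finset.mem_range,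
      Finset.HasAntidiagonal.mem_antidiagonal]
    omega
  rw [hset]
  rcases lt_or_ge n r with hlt | hle
  · rw [expCoeff_eq_zero_of_lt ξ η hlt, smul_zero, smul_zero]
    refine Finset.sum_eq_zero fun a ha => ?_
    rw [starComponent, if_neg]
    rw [Finset.HasAntidiagonal.mem_antidiagonal.1 ha]
    omega
  · have hterm : ∀ a ∈ antidiagonal n,
        starComponent z r (formalExp 𝕜 ξ a.1) (formalExp 𝕜 η a.2) =
        z ^ (n - r) • quantInv 𝕜 g (((a.1 ! : 𝕜)⁻¹ * (a.2 ! : 𝕜)⁻¹) •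
          (envIncl 𝕜 g ξ ^ a.1 * envIncl 𝕜 g η ^ a.2)) r := fun a ha => by
      have ha' := Finset.HasAntidiagonal.mem_antidiagonal.1 ha
      rw [starComponent, if_pos (by omega), ha', formalExp, formalExp, map_smul, map_smul,
        quantN_symPow, quantN_symPow, smul_mul_smul_comm]
    rw [Finset.sum_congr rfl hterm, ← Finset.smul_sum, ← DFinsupp.finsetSum_apply, ← map_sum,
      quantInv_sum_antidiagonal hD, smul_smul]
    congr 1
    rw [inv_pow, pow_sub₀ z hz hle, mul_comm]

/-- Products of exponentials of multiples of one vector. -/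
theorem starHat_expHat_smul (hbracket : Continuous fun a : g × g => ⁅a.1, a.2⁆)
    [LieRing.IsNilpotent g] (z s t : 𝕜) (ξ : g) :
    starHat z (expHat 𝕜 1 (t • ξ)) (expHat 𝕜 1 (s • ξ)) = expHat 𝕜 1 ((t + s) • ξ) := by
  -- Powers of one vector multiply without correction terms, so only `r = k + l` occurs and `z`
  -- enters as `z⁰`; hence `z = 0` needs no separate treatment.
  have hq : ∀ k l, quantInv 𝕜 g (quantN 𝕜 g k (formalExp 𝕜 (t • ξ) k) *
      quantN 𝕜 g l (formalExp 𝕜 (s • ξ) l)) = symIncl 𝕜 (k + l)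
        (((k ! : 𝕜)⁻¹ * t ^ k * ((l ! : 𝕜)⁻¹ * s ^ l)) • symPow 𝕜 ξ (k + l)) := fun k l => by
    rw [formalExp, formalExp, symPow_smul, symPow_smul, smul_smul, smul_smul, map_smul, map_smul,
      quantN_symPow, quantN_symPow, smul_mul_smul_comm, ← pow_add, ← quantN_symPow,
      ← quant_symIncl, map_smul, quantInv_quant, map_smul]
  refine starHat_expHat hbracket z (t • ξ) (s • ξ) _ antidiagonal (fun r a ha => ?_) fun r => ?_
  · rw [starComponent, hq]
    have hne : r ≠ a.1 + a.2 := fun h => ha (Finset.HasAntidiagonal.mem_antidiagonal.2 h.symm)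
    rw [show symIncl 𝕜 (a.1 + a.2) _ r = 0 from DirectSum.of_eq_of_ne _ _ _ hne, smul_zero,
      ite_self]
  have hterm : ∀ a ∈ antidiagonal r,
      starComponent z r (formalExp 𝕜 (t • ξ) a.1) (formalExp 𝕜 (s • ξ) a.2) =
        ((a.1 ! : 𝕜)⁻¹ * t ^ a.1 * ((a.2 ! : 𝕜)⁻¹ * s ^ a.2)) • symPow 𝕜 ξ r := fun a ha => by
    obtain rfl := Finset.HasAntidiagonal.mem_antidiagonal.1 ha
    rw [starComponent, if_pos le_rfl, hq, Nat.sub_self, pow_zero, one_smul]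
    exact DirectSum.of_eq_same _ _
  rw [Finset.sum_congr rfl hterm, ← Finset.sum_smul, formalExp_smul, formalExp, smul_smul]
  congr 1
  rw [(Commute.all t s).add_pow', Finset.sum_mul]
  refine Finset.sum_congr rfl fun a ha => ?_
  obtain rfl := Finset.HasAntidiagonal.mem_antidiagonal.1 ha
  have h := congrArg (Nat.cast (R := 𝕜)) (Nat.add_choose_mul_factorial_mul_factorial a.1 a.2)
  have h1 : (a.1 ! : 𝕜) ≠ 0 := Nat.cast_ne_zero.2 (Nat.factorial_ne_zero _)
  have h2 : (a.2 ! : 𝕜) ≠ 0 := Nat.cast_ne_zero.2 (Nat.factorial_ne_zero _)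
  have h3 : ((a.1 + a.2)! : 𝕜) ≠ 0 := Nat.cast_ne_zero.2 (Nat.factorial_ne_zero _)
  push_cast at h
  rw [nsmul_eq_mul]
  field_simp
  rw [Nat.choose_symm_add, ← h]
  ring

end ExponentialProduct

end GuttStar

end

theorem mainTheorem4 {𝕜 : Type*} [RCLike 𝕜] {g : Type*} [LieRing g] [LieAlgebra 𝕜 g]
    [TopologicalSpace g] [PolynormableSpace 𝕜 g]
    (hbracket : Continuous fun a : g × g => ⁅a.1, a.2⁆)
    [LieRing.IsNilpotent g] :
    -- the Gutt star product extends continuously to the completion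
    (∀ z : 𝕜,
      Continuous (fun a : GuttStar.SymHat 𝕜 g 1 × GuttStar.SymHat 𝕜 g 1 =>
        GuttStar.starHat z a.1 a.2) ∧
      ∀ x y : GuttStar.SymMinus 𝕜 g 1,
        GuttStar.starHat z (x : GuttStar.SymHat 𝕜 g 1) (y : GuttStar.SymHat 𝕜 g 1) =
          (GuttStar.starMinus z x y : GuttStar.SymMinus 𝕜 g 1)) ∧
    -- the exponential series of every vector belongs to the completion
    (∀ ξ : g,
      (∀ p : Seminorm 𝕜 g, Continuous p → ∀ ε : ℝ, 0 < ε →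
        Summable fun n : ℕ => (n.factorial : ℝ) ^ (1 - ε) *
          GuttStar.tensorSeminorm p n (GuttStar.formalExp 𝕜 ξ n : TensorPower 𝕜 n g)) ∧
      HasSum
        (fun n : ℕ => ((GuttStar.inclSymMinus 𝕜 1 n (GuttStar.formalExp 𝕜 ξ n) :
          GuttStar.SymMinus 𝕜 g 1) : GuttStar.SymHat 𝕜 g 1))
        (GuttStar.expHat 𝕜 1 ξ)) ∧
    -- products of exponentials are given by the Baker-Campbell-Hausdorff series
    (∀ (ξ η : g) (z : 𝕜), z ≠ 0 →
      GuttStar.starHat z (GuttStar.expHat 𝕜 1 ξ) (GuttStar.expHat 𝕜 1 η) =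
        GuttStar.expHat 𝕜 1 (z⁻¹ • GuttStar.bch 𝕜 (z • ξ) (z • η))) ∧
    -- one-parameter groups
    (∀ (z s t : 𝕜) (ξ : g),
      GuttStar.starHat z (GuttStar.expHat 𝕜 1 (t • ξ)) (GuttStar.expHat 𝕜 1 (s • ξ)) =
        GuttStar.expHat 𝕜 1 ((t + s) • ξ)) := by
  refine ⟨fun z => ⟨GuttStar.continuous_starHat hbracket z, GuttStar.starHat_coe hbracket z⟩,
    fun ξ => ⟨fun p _ ε hε => GuttStar.summable_formalExp p ξ hε, GuttStar.hasSum_expHat ξ⟩,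
    fun ξ η z hz => GuttStar.starHat_expHat_bch hbracket ξ η hz,
    fun z s t ξ => GuttStar.starHat_expHat_smul hbracket z s t ξ⟩
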